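/- **Setting.** Cells are the elements of $\mathbb Z^2$ (first coordinate eastwards, second northwards). For a finite set $A$, the space $A^{\mathbb Z^2}$ carries the metric $d_C(x,y)=2^{-\min\{\|i\|_\infty : x_i\neq y_i\}}$ (and $d_C(x,x)=0$). Let $F:A^{\mathbb Z^2}\to A^{\mathbb Z^2}$. A point $x$ is an *equicontinuous point* of $F$ if for all $\epsilon>0$ there is $\delta>0$ such that $d_C(x,y)<\delta$ implies $d_C(F^n(x),F^n(y))<\epsilon$ for all $n\in\mathbb N$. The map $F$ is *sensitive* if there is $\epsilon>0$ such that for all $\delta>0$ and all $x$ there are $y$ and $n\in\mathbb N$ with $d_C(x,y)<\delta$ and $d_C(F^n(x),F^n(y))>\epsilon$. A *tile set* $\tau$ is a finite set $T$ of tiles with two relations $H,V\subseteq T\times T$. A *valid tiling* is a map $c:\mathbb Z^2\to T$ with $(c(z),c(z+(1,0)))\in H$ and $(c(z),c(z+(0,1)))\in V$ for all $z$; $\tau$ *tiles the plane* if a valid tiling exists. **The cellular automaton $G_\tau$.** Its states are the *liquid* states $\mathcal L=\{U,D,0\}$ and the *solid* states $\mathcal S=T\times X$, where $X=\{\downarrow,\uparrow,\leftarrow,\rightarrow,\swarrow,\searrow,\nwarrow,\nearrow,\bot\}$.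 For a cell with arrow $a\in X$, a cell of the surrounding $3\times3$ window is *outside* if it lies behind $a$ horizontally or vertically (for $\downarrow$: the three cells of the row above; for $\searrow$: the five cells of the row above and of the column to the west; for $\bot$: none; the others by rotation). The remaining cells of the window, the centre included, form the *inside region*. A $3\times3$ pattern is *allowed* if 1. as far as only solid/liquid is concerned, it is a $3\times 3$ window of a $3\times3$ solid square in an otherwise liquid plane; 2. the arrows on the solid cells of each of its $2\times2$ blocks agree with those of some full $2\times2$ block of $$\begin{matrix} &&&\downarrow&\downarrow&&\\ &\searrow&\downarrow&\downarrow&\downarrow&\swarrow&\\ \rightarrow&\rightarrow&\searrow&\downarrow&\swarrow&\leftarrow&\leftarrow\\ \rightarrow&\rightarrow&\rightarrow&\bot&\leftarrow&\leftarrow&\leftarrow\\ &\rightarrow&\nearrow&\uparrow&\nwarrow&\leftarrow&\\ &\nearrow&\uparrow&\uparrow&\uparrow&\nwarrow&\\ &&&\uparrow&\uparrow&& \end{matrix}$$ 3. each liquid cell of it that touches (also diagonally) a solid cell of it is outside for that solid cell; 4. horizontally (vertically) adjacent solid cells of it carry tiles related by $H$ ($V$). A pattern that fits into a $3\times3$ window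 is *forbidden* if it is not part of an allowed $3\times3$ pattern; a $5\times5$ pattern is forbidden if it contains a $3\times 3$ pattern that is not allowed. All cells are updated synchronously: * A solid cell becomes $0$ if its $5\times5$ neighbourhood is forbidden and, in addition, either its inside region forms a forbidden pattern or the cell together with one other cell of its $5\times5$ neighbourhood forms a forbidden pattern. Otherwise it is unchanged. * A liquid cell becomes $0$ if its $5\times5$ neighbourhood is forbidden. Otherwise it becomes $U$ if its $3\times3$ neighbourhood matches one of the following (rows from north to south, separated by "/"; $*$ means "$0$ or solid", $S$ means "solid", $d$ means "$0$, $D$ or solid", $u$ means "$0$, $U$ or solid"): $*00/S00/SU0$; $000/000/SU0$; $000/00U/SSd$; $000/00U/0{*}S$; $0U{*}/00S/00S$; $0US/00S/00D$; ${*}{*}{*}/{*}0U/{*}{*}D$. It becomes $D$ if it matches one of: $SD0/S00/{*}00$; $SD0/000/000$; $SSu/00D/000$; $0{*}S/00D/000$; $00S/00S/0D{*}$; $00U/00S/0DS$; ${*}{*}U/{*}0D/{*}{*}{*}$. In all other cases it becomes $0$. **Proposition.** Let $\tau$ be any tile set. If $\tau$ does not tile the plane, then $G_\tau$ is sensitive.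 If $\tau$ tiles the plane, then $G_\tau$ has an equicontinuous point. Moreover, every equicontinuous point of $G_\tau$ consists only of solid states, contains exactly one occurrence of $\bot$, and its $T$-component is a valid tiling. -/

import Mathlib

noncomputable section

open Classical

namespace Onion

/-! ### Configurations, cellular automata, topological dynamics -/

/-- The cells of the plane. The first coordinate grows eastwards, the second one northwards. -/
abbrev Cell : Type := ℤ × ℤ

/-- The norm `‖i‖_∞` on the plane. -/
def supNorm (i : Cell) : ℕ := max i.1.natAbs i.2.natAbs

/-- The metric `d_C(x, y) = 2 ^ (- min {‖i‖_∞ : x i ≠ y i})` (which is `0` when `x = y`). -/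
def dC {A : Type*} (x y : Cell → A) : ℝ :=
  if x = y then 0 else (1 / 2 : ℝ) ^ sInf {n : ℕ | ∃ i, x i ≠ y i ∧ supNorm i = n}

/-- `F` is a (two-dimensional) cellular automaton: a finite neighbourhood and a local rule. -/
def IsCellularAutomaton {A : Type*} (F : (Cell → A) → (Cell → A)) : Prop :=
  ∃ (U : Finset Cell) (f : (U → A) → A), ∀ x z, F x z = f (fun u => x (z + u))

def IsEquicontinuousPoint {X : Type*} (d : X → X → ℝ) (F : X → X) (x : X) : Prop :=
  ∀ ε : ℝ, 0 < ε → ∃ δ : ℝ, 0 < δ ∧ ∀ y, d x y < δ → ∀ n : ℕ, d (F^[n] x) (F^[n] y) < ε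

def IsSensitive {X : Type*} (d : X → X → ℝ) (F : X → X) : Prop :=
  ∃ ε : ℝ, 0 < ε ∧ ∀ δ : ℝ, 0 < δ → ∀ x, ∃ y, ∃ n : ℕ, d x y < δ ∧ ε < d (F^[n] x) (F^[n] y)

/-! ### Tile sets -/

/-- A tile set with set of tiles `T`, given by its constraints on adjacent cells:
`H s t` means that `t` may stand immediately to the east of `s`,
`V s t` that `t` may stand immediately to the north of `s`. -/
structure TileSet (T : Type*) where
  H : T → T → Prop
  V : T → T → Prop

/-- `c` is a valid tiling of the plane. -/
def TileSet.IsTiling {T : Type*} (τ : TileSet T) (c : Cell → T) : Prop :=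
  ∀ z, τ.H (c z) (c (z + (1, 0))) ∧ τ.V (c z) (c (z + (0, 1)))

def TileSet.TilesPlane {T : Type*} (τ : TileSet T) : Prop :=
  ∃ c : Cell → T, τ.IsTiling c

/-! ### States -/

/-- The component `X`: the eight arrows and `⊥`. -/
inductive Arrow
  | down | up | left | right | downLeft | downRight | upLeft | upRight | bot
  deriving DecidableEq

/-- Horizontal direction of an arrow (`1` for east). -/
def Arrow.dx : Arrow → ℤ
  | down => 0 | up => 0 | left => -1 | right => 1
  | downLeft => -1 | downRight => 1 | upLeft => -1 | upRight => 1 | bot => 0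

/-- Vertical direction of an arrow (`1` for north). -/
def Arrow.dy : Arrow → ℤ
  | down => -1 | up => 1 | left => 0 | right => 0
  | downLeft => -1 | downRight => -1 | upLeft => 1 | upRight => 1 | bot => 0

/-- The cell at relative position `u` (with `‖u‖_∞ ≤ 1`) is on the outside of an arrow: it lies
behind the arrow in the horizontal or in the vertical direction. Thus `↓` has the three cells of
the row above outside, `↘` the five cells of the row above and of the column to the west, and `⊥`
none. -/
def Arrow.Outside (a : Arrow) (u : Cell) : Prop :=
  (a.dx ≠ 0 ∧ u.1 = -a.dx) ∨ (a.dy ≠ 0 ∧ u.2 = -a.dy)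

/-- The states: the liquid ones `U`, `D`, `0`, and the solid ones, which form the set `T × X`. -/
inductive State (T : Type*)
  | U | D | zero
  | solid (t : T) (a : Arrow)

variable {T : Type*}

def State.IsSolid (s : State T) : Prop := ∃ t a, s = solid t a

def State.IsLiquid (s : State T) : Prop := ¬ s.IsSolid

def State.tile : State T → Option T
  | solid t _ => some t
  | _ => none

def State.arrow : State T → Option Arrow
  | solid _ a => some a
  | _ => none

/-! ### The obstacle subshift -/

/-- The partial configuration of arrows that lists the allowed `2 × 2` patterns
(rows from north to south). -/
def onionPicture : Fin 7 → Fin 7 → Option Arrow :=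
  let d := some Arrow.down
  let u := some Arrow.up
  let l := some Arrow.left
  let r := some Arrow.right
  let se := some Arrow.downRight
  let sw := some Arrow.downLeft
  let ne := some Arrow.upRight
  let nw := some Arrow.upLeft
  let o := some Arrow.bot
  let e : Option Arrow := none
  ![![e,  e,  e,  d,  d,  e,  e],
    ![e,  se, d,  d,  d,  sw, e],
    ![r,  r,  se, d,  sw, l,  l],
    ![r,  r,  r,  o,  l,  l,  l],
    ![e,  r,  ne, u,  nw, l,  e],
    ![e,  ne, u,  u,  u,  nw, e],
    ![e,  e,  e,  u,  u,  e,  e]]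

/-- The `2 × 2` pattern with northern row `a b` and southern row `c d` appears in the picture. -/
def OnionBlock (a b c d : Arrow) : Prop :=
  ∃ i j : Fin 6,
    onionPicture i.castSucc j.castSucc = some a ∧ onionPicture i.castSucc j.succ = some b ∧
    onionPicture i.succ j.castSucc = some c ∧ onionPicture i.succ j.succ = some d

/-- If the state is solid, its arrow is `a`. -/
def State.AgreesWith (s : State T) (a : Arrow) : Prop := ∀ b, s.arrow = some b → b = a

/-- The `3 × 3` window centred at `m`. -/
def window (m : Cell) : Set Cell := {p | supNorm (p - m) ≤ 1}

/-- The `3 × 3` pattern of `x` around `m` is allowed by the obstacle subshift. -/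
structure AllowedAt (τ : TileSet T) (x : Cell → State T) (m : Cell) : Prop where
  /-- The window shows a part of a `3 × 3` solid square in a liquid plane, as far as only the
  distinction solid / liquid is concerned. -/
  shape : ∃ s : Cell, ∀ u, supNorm u ≤ 1 → ((x (m + u)).IsSolid ↔ supNorm (s + u) ≤ 1)
  /-- The solid cells of every `2 × 2` block carry arrows of a block of the picture. -/
  arrows : ∀ p, p ∈ window m → p + (1, -1) ∈ window m → ∃ a b c d, OnionBlock a b c d ∧
    (x p).AgreesWith a ∧ (x (p + (1, 0))).AgreesWith b ∧
    (x (p + (0, -1))).AgreesWith c ∧ (x (p + (1, -1))).AgreesWith d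
  /-- Solid cells that touch a liquid cell have it on their outside: the arrows on the border of
  an obstacle point to the inside of the obstacle. -/
  border : ∀ p q a, p ∈ window m → q ∈ window m → supNorm (q - p) ≤ 1 →
    (x p).arrow = some a → (x q).IsLiquid → a.Outside (q - p)
  /-- Horizontal tiling constraints. -/
  horizontal : ∀ p s t, p ∈ window m → p + (1, 0) ∈ window m →
    (x p).tile = some s → (x (p + (1, 0))).tile = some t → τ.H s t
  /-- Vertical tiling constraints. -/
  vertical : ∀ p s t, p ∈ window m → p + (0, 1) ∈ window m →
    (x p).tile = some s → (x (p + (0, 1))).tile = some t → τ.V s t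

/-- The restriction of `x` to the set of cells `S` (part of some `3 × 3` window in all uses) is a
forbidden pattern: it is not part of any allowed `3 × 3` pattern. -/
def PatternForbidden (τ : TileSet T) (x : Cell → State T) (S : Set Cell) : Prop :=
  ¬ ∃ (m : Cell) (y : Cell → State T), S ⊆ window m ∧ (∀ p ∈ S, y p = x p) ∧ AllowedAt τ y m

/-- The `5 × 5` pattern of `x` around the origin contains a `3 × 3` pattern that is not allowed. -/
def NeighbourhoodForbidden (τ : TileSet T) (x : Cell → State T) : Prop :=
  ∃ m, supNorm m ≤ 1 ∧ ¬ AllowedAt τ x m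

/-- The inside region of a cell at the origin with arrow `a`. -/
def insideRegion (a : Arrow) : Set Cell := {u | supNorm u ≤ 1 ∧ ¬ a.Outside u}

/-- The solid cell with arrow `a` at the origin is eroded (once its neighbourhood is forbidden):
its inside region is a forbidden pattern, or so is the cell together with one of its neighbours. -/
def Eroded (τ : TileSet T) (x : Cell → State T) (a : Arrow) : Prop :=
  PatternForbidden τ x (insideRegion a) ∨
    ∃ w, w ≠ 0 ∧ supNorm w ≤ 2 ∧ PatternForbidden τ x {0, w}

/-! ### Movement of the liquid particles -/

/-- The left-hand side of a transition rule: the rows from north to south and, in each row, from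
west to east, of the sets of states that the rule accepts. -/
abbrev RulePattern (T : Type*) : Type _ := Fin 3 → Fin 3 → Set (State T)

/-- The `3 × 3` pattern of `x` around the origin matches `P`. -/
def RulePattern.Matches (P : RulePattern T) (x : Cell → State T) : Prop :=
  ∀ i j : Fin 3, x ((j : ℤ) - 1, 1 - (i : ℤ)) ∈ P i j

/-- Left-hand sides of the rules that produce `U`. -/
def upRules (T : Type*) : List (RulePattern T) :=
  let O : Set (State T) := {.zero}
  let U : Set (State T) := {.U}
  let D : Set (State T) := {.D}
  let S : Set (State T) := {s | s.IsSolid}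
  let OS := O ∪ S
  let ODS := O ∪ D ∪ S
  [![![OS, O,  O ], ![S,  O, O], ![S,  U,  O  ]],
   ![![O,  O,  O ], ![O,  O, O], ![S,  U,  O  ]],
   ![![O,  O,  O ], ![O,  O, U], ![S,  S,  ODS]],
   ![![O,  O,  O ], ![O,  O, U], ![O,  OS, S  ]],
   ![![O,  U,  OS], ![O,  O, S], ![O,  O,  S  ]],
   ![![O,  U,  S ], ![O,  O, S], ![O,  O,  D  ]],
   ![![OS, OS, OS], ![OS, O, U], ![OS, OS, D  ]]]

/-- Left-hand sides of the rules that produce `D`. -/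
def downRules (T : Type*) : List (RulePattern T) :=
  let O : Set (State T) := {.zero}
  let U : Set (State T) := {.U}
  let D : Set (State T) := {.D}
  let S : Set (State T) := {s | s.IsSolid}
  let OS := O ∪ S
  let OUS := O ∪ U ∪ S
  [![![S,  D,  O  ], ![S,  O, O], ![OS, O,  O ]],
   ![![S,  D,  O  ], ![O,  O, O], ![O,  O,  O ]],
   ![![S,  S,  OUS], ![O,  O, D], ![O,  O,  O ]],
   ![![O,  OS, S  ], ![O,  O, D], ![O,  O,  O ]],
   ![![O,  O,  S  ], ![O,  O, S], ![O,  D,  OS]],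
   ![![O,  O,  U  ], ![O,  O, S], ![O,  D,  S ]],
   ![![OS, OS, U  ], ![OS, O, D], ![OS, OS, OS]]]

/-! ### The onion cellular automaton -/

/-- The local rule, applied to the configuration `x` as seen from the cell at the origin. -/
def localRule (τ : TileSet T) (x : Cell → State T) : State T :=
  match x 0 with
  | .solid t a => if NeighbourhoodForbidden τ x ∧ Eroded τ x a then .zero else .solid t a
  | _ =>
    if NeighbourhoodForbidden τ x then .zero
    else if ∃ P ∈ upRules T, P.Matches x then .U
    else if ∃ P ∈ downRules T, P.Matches x then .D
    else .zero

/-- The onion cellular automaton `G_τ`. -/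
def onionCA (τ : TileSet T) : (Cell → State T) → (Cell → State T) :=
  fun x z => localRule τ (fun u => x (z + u))

/-! ### The map is a cellular automaton with neighbourhood of radius 2 -/

theorem supNorm_le_iff (u : Cell) (k : ℕ) :
    supNorm u ≤ k ↔ (-(k : ℤ) ≤ u.1 ∧ u.1 ≤ k) ∧ (-(k : ℤ) ≤ u.2 ∧ u.2 ≤ k) := by
  unfold supNorm
  rw [max_le_iff]
  omega

theorem AllowedAt.congr {τ : TileSet T} {x y : Cell → State T} {m : Cell}
    (h : ∀ p ∈ window m, x p = y p) (hx : AllowedAt τ x m) : AllowedAt τ y m := by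
  have hw : ∀ p : Cell, p ∈ window m → p + (1, -1) ∈ window m →
      p + (1, 0) ∈ window m ∧ p + (0, -1) ∈ window m := by
    intro p h1 h2
    simp only [window, Set.mem_ofPred_eq, supNorm_le_iff, Prod.fst_sub, Prod.snd_sub,
      Prod.fst_add, Prod.snd_add] at *
    omega
  refine ⟨?_, ?_, ?_, ?_, ?_⟩
  · obtain ⟨s, hs⟩ := hx.shape
    refine ⟨s, fun u hu => ?_⟩
    rw [← h (m + u) (by simpa [window] using hu)]
    exact hs u hu
  · intro p h1 h2
    rw [← h _ h1, ← h _ h2, ← h _ (hw p h1 h2).1, ← h _ (hw p h1 h2).2]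
    exact hx.arrows p h1 h2
  · intro p q a h1 h2
    rw [← h _ h1, ← h _ h2]
    exact hx.border p q a h1 h2
  · intro p s t h1 h2
    rw [← h _ h1, ← h _ h2]
    exact hx.horizontal p s t h1 h2
  · intro p s t h1 h2
    rw [← h _ h1, ← h _ h2]
    exact hx.vertical p s t h1 h2

theorem localRule_congr (τ : TileSet T) {x y : Cell → State T}
    (h : ∀ u, supNorm u ≤ 2 → x u = y u) : localRule τ x = localRule τ y := by
  have hN : NeighbourhoodForbidden τ x ↔ NeighbourhoodForbidden τ y := by
    unfold NeighbourhoodForbidden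
    refine exists_congr fun m => and_congr_right fun hm => not_congr ?_
    have hw : ∀ p ∈ window m, supNorm p ≤ 2 := by
      intro p hp
      simp only [window, Set.mem_ofPred_eq, supNorm_le_iff, Prod.fst_sub, Prod.snd_sub] at *
      push_cast at *
      omega
    exact ⟨AllowedAt.congr fun p hp => h p (hw p hp),
      AllowedAt.congr fun p hp => (h p (hw p hp)).symm⟩
  have hP : ∀ S : Set Cell, (∀ p ∈ S, supNorm p ≤ 2) →
      (PatternForbidden τ x S ↔ PatternForbidden τ y S) := by
    intro S hS
    unfold PatternForbidden
    refine not_congr (exists_congr fun m => exists_congr fun z => and_congr_right fun _ =>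
      and_congr_left fun _ => forall₂_congr fun p hp => ?_)
    rw [h p (hS p hp)]
  have hE : ∀ a, Eroded τ x a ↔ Eroded τ y a := by
    intro a
    unfold Eroded
    refine or_congr (hP _ fun p hp => hp.1.trans one_le_two)
      (exists_congr fun w => and_congr_right fun _ => and_congr_right fun hw => hP _ ?_)
    rintro p (rfl | rfl)
    · exact (by decide : supNorm (0, 0) ≤ 2)
    · exact hw
  have hM : ∀ P : RulePattern T, P.Matches x ↔ P.Matches y := by
    intro P
    unfold RulePattern.Matches
    refine forall₂_congr fun i j => ?_
    rw [h]
    rw [supNorm_le_iff]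
    have := i.isLt
    have := j.isLt
    push_cast
    omega
  unfold localRule
  rw [h 0 (by decide : supNorm (0, 0) ≤ 2)]
  simp only [hN, hE, hM]

theorem onionCA_isCellularAutomaton (τ : TileSet T) : IsCellularAutomaton (onionCA τ) := by
  refine ⟨Finset.Icc (-2) 2 ×ˢ Finset.Icc (-2) 2,
    fun p => localRule τ fun u => if hu : u ∈ Finset.Icc (-2) 2 ×ˢ Finset.Icc (-2) 2
      then p ⟨u, hu⟩ else .zero, fun x z => localRule_congr τ fun u hu => ?_⟩
  rw [supNorm_le_iff] at hu
  have hu' : u ∈ Finset.Icc (-2 : ℤ) 2 ×ˢ Finset.Icc (-2 : ℤ) 2 := by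
    simp only [Finset.mem_product, Finset.mem_Icc]
    exact_mod_cast hu
  simp only [hu', dite_true]

end Onion

end

/-! The solid states are designed to form obstacles: squares in which the arrows of each ring lead
one ring inwards and end at a single `⊥`. The inside region of a cell of such a square stays in the
square. Therefore a square whose tiles fit cannot be damaged from outside, and an infinite onion
over a valid tiling is an equicontinuous point (`iterate_eq_onion`): each of its balls survives
every change made at distance more than 2 from it.

Everything else follows from the dichotomy `exists_perturbation_or_filled`. Cut `x` off outside the
ball of radius `M`, filling up with `0`. Solid cells are never created or altered, only deleted, so
in the resulting `y` erosion stops. What is left are square onions with a liquid margin of width two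
(`Stable.settled`). Indeed, in a bounded stable configuration a path along the arrows ends at a `⊥`,
and going back along it one full ring after another is forced. Two different onions too close to
each other would contain border arrows pointing away from each other at distance at most two, which
is a forbidden pair.

Particles never move east, and no column can hold one for ever, so any given half-plane is
eventually free of them. Now let a cell of the ball of radius `N` be liquid. A pair, `U` above `D`,
moves west through free space. At an obstacle `U` runs counterclockwise and `D` clockwise around it,
and they meet on the western side at the height reflected in the centre. This can be traced
backwards, so some pair far in the east reaches the given cell. The pair can be inserted at time
`0`, since in the empty east it travels independently of the erosion. Thus `y` and `y` with the pair
differ at that cell at some time, so one of them differs there from `x`, although both agree with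
`x` on the ball of radius `M`. If no such liquid cell exists, the ball of radius `N` lies in a
single onion, which is already present in `x`.

Without a tiling, compactness gives an `N` for which the second alternative is impossible, hence
sensitivity. At an equicontinuous point the first alternative fails for suitable `M`, so every ball
lies in an onion with fitting tiles. This gives solidity, the unique `⊥` and the tiling. -/

namespace Onion
variable {T : Type*}

/-! ### The unbounded onion and its blocks -/

/-- The list of the allowed blocks, as quadruples north-west, north-east, south-west,
south-east. -/
def onionBlocks : List (Arrow × Arrow × Arrow × Arrow) :=
  (List.finRange 6).flatMap fun i => (List.finRange 6).filterMap fun j =>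
    match onionPicture i.castSucc j.castSucc, onionPicture i.castSucc j.succ,
      onionPicture i.succ j.castSucc, onionPicture i.succ j.succ with
    | some a, some b, some c, some d => some (a, b, c, d)
    | _, _, _, _ => none

/-- Makes the blocks an explicit finite list, so that claims about all blocks or all pairs of blocks
can be settled by `decide`. -/
theorem onionBlock_iff_mem {a b c d : Arrow} :
    OnionBlock a b c d ↔ (a, b, c, d) ∈ onionBlocks := by
  simp only [OnionBlock, onionBlocks, List.mem_flatMap, List.mem_finRange, true_and,
    List.mem_filterMap]
  refine exists_congr fun i => exists_congr fun j => ?_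
  constructor
  · rintro ⟨h1, h2, h3, h4⟩
    rw [h1, h2, h3, h4]
  · intro h
    split at h
    · next h1 h2 h3 h4 =>
      simp only [Option.some.injEq, Prod.mk.injEq] at h
      obtain ⟨rfl, rfl, rfl, rfl⟩ := h
      exact ⟨h1, h2, h3, h4⟩
    · simp at h

/-- The arrow at the position `u` relative to the cell with `⊥`, in an unbounded onion. -/
def onionArrow (u : Cell) : Arrow :=
  if -u.2 < u.1 ∧ u.1 < u.2 then .down
  else if u.2 < u.1 ∧ u.1 < -u.2 then .up
  else if -u.1 < u.2 ∧ u.2 < u.1 then .left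
  else if u.1 < u.2 ∧ u.2 < -u.1 then .right
  else if 0 < u.1 ∧ 0 < u.2 then .downLeft
  else if 0 < u.1 then .upLeft
  else if u.1 < 0 ∧ 0 < u.2 then .downRight
  else if u.1 < 0 then .upRight
  else .bot

/-- Four open sectors, four half-diagonals and the centre, each given by linear conditions that
`omega` can use. -/
theorem onionArrow_cases (u : Cell) :
    (onionArrow u = .down ∧ -u.2 < u.1 ∧ u.1 < u.2) ∨
    (onionArrow u = .up ∧ u.2 < u.1 ∧ u.1 < -u.2) ∨
    (onionArrow u = .left ∧ -u.1 < u.2 ∧ u.2 < u.1) ∨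
    (onionArrow u = .right ∧ u.1 < u.2 ∧ u.2 < -u.1) ∨
    (onionArrow u = .downLeft ∧ 0 < u.1 ∧ u.2 = u.1) ∨
    (onionArrow u = .upLeft ∧ 0 < u.1 ∧ u.2 = -u.1) ∨
    (onionArrow u = .downRight ∧ u.1 < 0 ∧ u.2 = -u.1) ∨
    (onionArrow u = .upRight ∧ u.1 < 0 ∧ u.2 = u.1) ∨
    (onionArrow u = .bot ∧ u.1 = 0 ∧ u.2 = 0) := by
  unfold onionArrow
  split_ifs <;> simp <;> omega

theorem onionBlock_onionArrow (u : Cell) :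
    OnionBlock (onionArrow u) (onionArrow (u + (1, 0))) (onionArrow (u + (0, -1)))
      (onionArrow (u + (1, -1))) := by
  rw [onionBlock_iff_mem]
  have h1 := onionArrow_cases u
  have h2 := onionArrow_cases (u + (1, 0))
  have h3 := onionArrow_cases (u + (0, -1))
  have h4 := onionArrow_cases (u + (1, -1))
  simp only [Prod.fst_add, Prod.snd_add] at h2 h3 h4
  rcases h1 with ⟨e1, h1⟩ | ⟨e1, h1⟩ | ⟨e1, h1⟩ | ⟨e1, h1⟩ | ⟨e1, h1⟩ | ⟨e1, h1⟩ | ⟨e1, h1⟩ |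
    ⟨e1, h1⟩ | ⟨e1, h1⟩ <;>
  rcases h2 with ⟨e2, h2⟩ | ⟨e2, h2⟩ | ⟨e2, h2⟩ | ⟨e2, h2⟩ | ⟨e2, h2⟩ | ⟨e2, h2⟩ | ⟨e2, h2⟩ |
    ⟨e2, h2⟩ | ⟨e2, h2⟩ <;> first | (exfalso; omega) | skip <;>
  rcases h3 with ⟨e3, h3⟩ | ⟨e3, h3⟩ | ⟨e3, h3⟩ | ⟨e3, h3⟩ | ⟨e3, h3⟩ | ⟨e3, h3⟩ | ⟨e3, h3⟩ |
    ⟨e3, h3⟩ | ⟨e3, h3⟩ <;> first | (exfalso; omega) | skip <;>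
  rcases h4 with ⟨e4, h4⟩ | ⟨e4, h4⟩ | ⟨e4, h4⟩ | ⟨e4, h4⟩ | ⟨e4, h4⟩ | ⟨e4, h4⟩ | ⟨e4, h4⟩ |
    ⟨e4, h4⟩ | ⟨e4, h4⟩ <;> first | (exfalso; omega) | (rw [e1, e2, e3, e4]; decide)

theorem onionArrow_zero : onionArrow 0 = .bot := by decide

theorem onionArrow_eq_bot {u : Cell} : onionArrow u = .bot ↔ u = 0 := by
  refine ⟨fun h => ?_, fun h => h ▸ onionArrow_zero⟩
  have := onionArrow_cases u
  simp only [h, reduceCtorEq, false_and, false_or, true_and] at this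
  exact Prod.ext this.1 this.2

/-- The step of an arrow. -/
def Arrow.dir (a : Arrow) : Cell := (a.dx, a.dy)

/-- Horizontally adjacent arrows of a block. -/
def HorAdj (a b : Arrow) : Prop := ∃ c d, OnionBlock a b c d ∨ OnionBlock c d a b

/-- Vertically adjacent arrows of a block, the northern one first. -/
def VertAdj (a b : Arrow) : Prop := ∃ c d, OnionBlock a c b d ∨ OnionBlock c a d b

theorem HorAdj.of_forall {P : Arrow → Arrow → Prop}
    (hP : ∀ q ∈ onionBlocks, P q.1 q.2.1 ∧ P q.2.2.1 q.2.2.2) {a b : Arrow}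
    (h : HorAdj a b) : P a b := by
  obtain ⟨c, d, h | h⟩ := h
  · exact (hP _ (onionBlock_iff_mem.1 h)).1
  · exact (hP _ (onionBlock_iff_mem.1 h)).2

theorem VertAdj.of_forall {P : Arrow → Arrow → Prop}
    (hP : ∀ q ∈ onionBlocks, P q.1 q.2.2.1 ∧ P q.2.1 q.2.2.2) {a b : Arrow}
    (h : VertAdj a b) : P a b := by
  obtain ⟨c, d, h | h⟩ := h
  · exact (hP _ (onionBlock_iff_mem.1 h)).1
  · exact (hP _ (onionBlock_iff_mem.1 h)).2

/-- This and the next five lemmas are rules for walking through an allowed pattern, used in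
`AllowedAt.not_facing_vertically` and `AllowedAt.not_facing_horizontally`. The extra alternatives
such as `.left` are needed because a row can leave the southward arrows through `↙` and continue
with `←`. -/
theorem VertAdj.dy_of_dy {a b : Arrow} (h : VertAdj a b) : b.dy = -1 → a.dy = -1 :=
  VertAdj.of_forall (P := fun a b => b.dy = -1 → a.dy = -1) (by decide) h

theorem HorAdj.dx_of_dx {a b : Arrow} (h : HorAdj a b) : a.dx = -1 → b.dx = -1 :=
  HorAdj.of_forall (P := fun a b => a.dx = -1 → b.dx = -1) (by decide) h

theorem HorAdj.east_of {a b : Arrow} (h : HorAdj a b) :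
    a.dy = -1 ∨ a = .left → b.dy = -1 ∨ b = .left :=
  HorAdj.of_forall (P := fun a b => a.dy = -1 ∨ a = .left → b.dy = -1 ∨ b = .left) (by decide) h

theorem HorAdj.west_of {a b : Arrow} (h : HorAdj a b) :
    b.dy = -1 ∨ b = .right → a.dy = -1 ∨ a = .right :=
  HorAdj.of_forall (P := fun a b => b.dy = -1 ∨ b = .right → a.dy = -1 ∨ a = .right) (by decide) h

theorem VertAdj.north_of {a b : Arrow} (h : VertAdj a b) :
    b.dx = -1 ∨ b = .down → a.dx = -1 ∨ a = .down :=
  VertAdj.of_forall (P := fun a b => b.dx = -1 ∨ b = .down → a.dx = -1 ∨ a = .down) (by decide) h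

theorem VertAdj.south_of {a b : Arrow} (h : VertAdj a b) :
    a.dx = -1 ∨ a = .up → b.dx = -1 ∨ b = .up :=
  VertAdj.of_forall (P := fun a b => a.dx = -1 ∨ a = .up → b.dx = -1 ∨ b = .up) (by decide) h

theorem State.isSolid_iff {s : State T} : s.IsSolid ↔ ∃ a, s.arrow = some a := by
  cases s <;> simp [State.IsSolid, State.arrow]

theorem State.isSolid_of_arrow {s : State T} {a : Arrow} (h : s.arrow = some a) : s.IsSolid :=
  State.isSolid_iff.2 ⟨a, h⟩

theorem State.isSolid_of_tile {s : State T} {t : T} (h : s.tile = some t) : s.IsSolid := by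
  cases s <;> simp_all [State.IsSolid, State.tile]

theorem State.IsLiquid.arrow {s : State T} (h : s.IsLiquid) : s.arrow = none := by
  cases s <;> simp_all [State.IsLiquid, State.IsSolid, State.arrow]

theorem State.IsLiquid.agreesWith {s : State T} (h : s.IsLiquid) (a : Arrow) :
    s.AgreesWith a := by
  intro b hb
  rw [h.arrow] at hb
  cases hb

theorem State.agreesWith_of_arrow {s : State T} {a : Arrow} (h : s.arrow = some a) :
    s.AgreesWith a := by
  intro b hb
  rw [h] at hb
  exact (Option.some.inj hb).symm

theorem State.AgreesWith.eq {s : State T} {a b : Arrow} (h : s.AgreesWith a)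
    (hb : s.arrow = some b) : a = b := (h b hb).symm

/-! ### Settled configurations and why all their patterns are allowed -/

/-- Adjacent solid cells carry tiles that fit together. -/
def TilesFit (τ : TileSet T) (x : Cell → State T) : Prop :=
  ∀ z s t, (x z).tile = some s →
    ((x (z + (1, 0))).tile = some t → τ.H s t) ∧ ((x (z + (0, 1))).tile = some t → τ.V s t)

/-- The solid square with centre `c` and radius `k` shows the arrows of an onion. -/
def Filled (x : Cell → State T) (c : Cell) (k : ℕ) : Prop :=
  ∀ u, supNorm u ≤ k → (x (c + u)).arrow = some (onionArrow u)

/-- An onion of radius `k` around `c`, separated from the other solid cells. -/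
structure IsObstacle (x : Cell → State T) (c : Cell) (k : ℕ) : Prop where
  one_le : 1 ≤ k
  filled : Filled x c k
  liquid : ∀ u, k < supNorm u → supNorm u ≤ k + 2 → (x (c + u)).IsLiquid

/-- All solid cells belong to separate onions, and all tiles fit. -/
structure Settled (τ : TileSet T) (x : Cell → State T) : Prop where
  tilesFit : TilesFit τ x
  obstacle : ∀ z, (x z).IsSolid → ∃ c k, IsObstacle x c k ∧ supNorm (z - c) ≤ k

theorem IsObstacle.isSolid_iff {x : Cell → State T} {c : Cell} {k : ℕ} (h : IsObstacle x c k)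
    {u : Cell} (hu : supNorm u ≤ k + 2) : (x (c + u)).IsSolid ↔ supNorm u ≤ k := by
  refine ⟨fun hs => ?_, fun hk => State.isSolid_of_arrow (h.filled u hk)⟩
  by_contra hk
  exact h.liquid u (not_le.1 hk) hu hs

theorem mem_window {m p : Cell} : p ∈ window m ↔
    (m.1 - 1 ≤ p.1 ∧ p.1 ≤ m.1 + 1) ∧ (m.2 - 1 ≤ p.2 ∧ p.2 ≤ m.2 + 1) := by
  simp only [window, Set.mem_ofPred_eq, supNorm_le_iff, Prod.fst_sub, Prod.snd_sub]
  push_cast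
  omega

theorem allowedAt_of_liquid (τ : TileSet T) {x : Cell → State T} {m : Cell}
    (h : ∀ p ∈ window m, (x p).IsLiquid) : AllowedAt τ x m := by
  -- A window centred five cells east of the centre of the `3 × 3` square misses the square.
  refine ⟨⟨(5, 0), fun u hu => ?_⟩, fun p h1 h2 => ?_, fun p q a h1 _ _ h3 => ?_,
    fun p s t h1 _ h2 => ?_, fun p s t h1 _ h2 => ?_⟩
  · have h1 : ¬ (x (m + u)).IsSolid := h _ (by simpa [window] using hu)
    rw [supNorm_le_iff] at hu
    simp only [h1, false_iff, supNorm_le_iff, Prod.fst_add, Prod.snd_add]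
    push_cast at *
    omega
  · refine ⟨_, _, _, _, onionBlock_onionArrow 0, (h _ h1).agreesWith _, (h _ ?_).agreesWith _,
      (h _ ?_).agreesWith _, (h _ h2).agreesWith _⟩ <;>
    · rw [mem_window] at *
      simp only [Prod.fst_add, Prod.snd_add] at *
      omega
  · exact absurd (State.isSolid_of_arrow h3) (h _ h1)
  · exact absurd (State.isSolid_of_tile h2) (h _ h1)
  · exact absurd (State.isSolid_of_tile h2) (h _ h1)

/-- Border arrows point inwards. Radius `0` has to be excluded, since nothing is outside for `⊥`. -/
theorem onionArrow_outside {u v : Cell} {k : ℕ} (hk : 1 ≤ k) (hu : supNorm u ≤ k)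
    (hv : ¬ supNorm v ≤ k) (huv : supNorm (v - u) ≤ 1) : (onionArrow u).Outside (v - u) := by
  simp only [supNorm_le_iff, Prod.fst_sub, Prod.snd_sub] at hu hv huv
  unfold Arrow.Outside
  simp only [Prod.fst_sub, Prod.snd_sub]
  rcases onionArrow_cases u with ⟨e, h⟩ | ⟨e, h⟩ | ⟨e, h⟩ | ⟨e, h⟩ | ⟨e, h⟩ | ⟨e, h⟩ | ⟨e, h⟩ |
    ⟨e, h⟩ | ⟨e, h⟩ <;> rw [e] <;> simp [Arrow.dx, Arrow.dy] <;> push_cast at * <;> omega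

/-- The reason why obstacles are immune: what a cell of the square inspects by its inside region
belongs to the square. -/
theorem onionArrow_inside {u w : Cell} {k : ℕ} (hu : supNorm u ≤ k)
    (hw : w ∈ insideRegion (onionArrow u)) (hk : 1 ≤ k) : supNorm (u + w) ≤ k := by
  by_contra h
  refine hw.2 ?_
  have := onionArrow_outside hk hu h (by simpa using hw.1)
  simpa using this

theorem allowedAt_of_obstacle {τ : TileSet T} {x : Cell → State T} {c m : Cell} {k : ℕ}
    (ht : TilesFit τ x) (ho : IsObstacle x c k) (hm : supNorm (m - c) ≤ k + 1) :
    AllowedAt τ x m := by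
  have hk := ho.one_le
  have hS : ∀ p ∈ window m, (x p).IsSolid ↔ supNorm (p - c) ≤ k := by
    intro p hp
    rw [mem_window] at hp
    have := ho.isSolid_iff (u := p - c) (by
      simp only [supNorm_le_iff, Prod.fst_sub, Prod.snd_sub] at *
      push_cast at *
      omega)
    rwa [add_sub_cancel] at this
  have hA : ∀ p ∈ window m, (x p).AgreesWith (onionArrow (p - c)) := by
    intro p hp
    by_cases h : supNorm (p - c) ≤ k
    · have := ho.filled (p - c) h
      rw [add_sub_cancel] at this
      exact State.agreesWith_of_arrow this
    · exact State.IsLiquid.agreesWith (mt (hS p hp).1 h) _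
  refine ⟨?_, fun p h1 h2 => ?_, fun p q a h1 h2 h3 h4 h5 => ?_,
    fun p s t h1 _ h2 h3 => (ht p s t h2).1 h3, fun p s t h1 _ h2 h3 => (ht p s t h2).2 h3⟩
  -- A `3 × 3` window sees a side of a large square just as it sees a side of the `3 × 3` square. In
  -- each coordinate, `f` turns the offset from a square of radius `k` into one from radius `1`,
  -- keeping the distance to the nearest side.
  · let f : ℤ → ℤ := fun d => if (k : ℤ) ≤ d then d - k + 1 else if d ≤ -k then d + k - 1 else 0
    have hf : ∀ d u : ℤ, -(k + 1) ≤ d → d ≤ k + 1 → -1 ≤ u → u ≤ 1 →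
        ((-(k : ℤ) ≤ d + u ∧ d + u ≤ k) ↔ (-1 ≤ f d + u ∧ f d + u ≤ 1)) := by
      intro d u
      simp only [f]
      split_ifs <;> omega
    refine ⟨(f (m - c).1, f (m - c).2), fun u hu => ?_⟩
    rw [hS _ (by simpa [window] using hu)]
    rw [supNorm_le_iff] at hm hu
    have h1 := hf (m - c).1 u.1 (by push_cast at *; omega) (by push_cast at *; omega)
      (by push_cast at *; omega) (by push_cast at *; omega)
    have h2 := hf (m - c).2 u.2 (by push_cast at *; omega) (by push_cast at *; omega)
      (by push_cast at *; omega) (by push_cast at *; omega)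
    rw [show m + u - c = (m - c) + u by abel]
    simp only [supNorm_le_iff, Prod.fst_add, Prod.snd_add]
    push_cast
    rw [h1, h2]
  · have h3 : p + (1, 0) ∈ window m := by
      rw [mem_window] at *
      simp only [Prod.fst_add, Prod.snd_add] at *
      omega
    have h4 : p + (0, -1) ∈ window m := by
      rw [mem_window] at *
      simp only [Prod.fst_add, Prod.snd_add] at *
      omega
    have h5 : ∀ v : Cell, p - c + v = p + v - c := fun v => by abel
    refine ⟨_, _, _, _, onionBlock_onionArrow (p - c), hA _ h1, ?_, ?_, ?_⟩
    · rw [h5]; exact hA _ h3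
    · rw [h5]; exact hA _ h4
    · rw [h5]; exact hA _ h2
  · have h6 := (hA p h1).eq h4
    subst h6
    have h7 := (hS p h1).1 (State.isSolid_of_arrow h4)
    have h8 := mt (hS q h2).2 h5
    have := onionArrow_outside hk h7 h8 (by simpa using h3)
    simpa using this

theorem Settled.allowedAt {τ : TileSet T} {x : Cell → State T} (h : Settled τ x) (m : Cell) :
    AllowedAt τ x m := by
  by_cases hm : ∃ p ∈ window m, (x p).IsSolid
  · obtain ⟨p, hp, hs⟩ := hm
    obtain ⟨c, k, ho, hc⟩ := h.obstacle p hs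
    refine allowedAt_of_obstacle h.tilesFit ho ?_
    rw [mem_window] at hp
    simp only [supNorm_le_iff, Prod.fst_sub, Prod.snd_sub] at *
    push_cast at *
    omega
  · push Not at hm
    exact allowedAt_of_liquid τ hm

/-! ### Local consequences of stability -/

/-- No solid cell is eroded. -/
def Stable (τ : TileSet T) (x : Cell → State T) : Prop :=
  ∀ z a, (x z).arrow = some a → ¬ Eroded τ (fun u => x (z + u)) a

theorem exists_allowedAt_of_not_eroded_inside {τ : TileSet T} {x : Cell → State T} {a : Arrow}
    (h : ¬ Eroded τ x a) : ∃ (m : Cell) (y : Cell → State T), insideRegion a ⊆ window m ∧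
      (∀ p ∈ insideRegion a, y p = x p) ∧ AllowedAt τ y m := by
  by_contra hc
  exact h (Or.inl hc)

theorem exists_allowedAt_of_not_eroded_pair {τ : TileSet T} {x : Cell → State T} {a : Arrow}
    (h : ¬ Eroded τ x a) {w : Cell} (hw : w ≠ 0) (hw2 : supNorm w ≤ 2) :
    ∃ (m : Cell) (y : Cell → State T), (0 ∈ window m ∧ w ∈ window m) ∧
      (y 0 = x 0 ∧ y w = x w) ∧ AllowedAt τ y m := by
  by_contra hc
  refine h (Or.inr ⟨w, hw, hw2, ?_⟩)
  rintro ⟨m, y, hS, hy, hA⟩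
  exact hc ⟨m, y, ⟨hS (by simp), hS (by simp)⟩, ⟨hy _ (by simp), hy _ (by simp)⟩, hA⟩

theorem zero_mem_insideRegion (a : Arrow) : (0 : Cell) ∈ insideRegion a := by
  refine ⟨by decide, ?_⟩
  cases a <;> simp [Arrow.Outside, Arrow.dx, Arrow.dy]

/-- The inside region is part of an allowed pattern, in which a liquid cell next to the centre would
have to be outside for it. -/
theorem Stable.inside_isSolid {τ : TileSet T} {x : Cell → State T} (hx : Stable τ x) {z w : Cell}
    {a : Arrow} (ha : (x z).arrow = some a) (hw : w ∈ insideRegion a) : (x (z + w)).IsSolid := by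
  obtain ⟨m, y, hS, hy, hA⟩ := exists_allowedAt_of_not_eroded_inside (hx z a ha)
  by_contra hl
  have h0 := zero_mem_insideRegion a
  have := hA.border 0 w a (hS h0) (hS hw) (by simpa using hw.1)
    (by rw [hy _ h0]; simpa using ha) (by rw [hy _ hw]; exact hl)
  exact hw.2 (by simpa using this)

theorem Stable.inside_block {τ : TileSet T} {x : Cell → State T} (hx : Stable τ x) {z p : Cell}
    {a : Arrow} (ha : (x z).arrow = some a) (h1 : p ∈ insideRegion a)
    (h2 : p + (1, 0) ∈ insideRegion a) (h3 : p + (0, -1) ∈ insideRegion a)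
    (h4 : p + (1, -1) ∈ insideRegion a) :
    ∃ b₁ b₂ b₃ b₄, OnionBlock b₁ b₂ b₃ b₄ ∧ (x (z + p)).arrow = some b₁ ∧
      (x (z + (p + (1, 0)))).arrow = some b₂ ∧ (x (z + (p + (0, -1)))).arrow = some b₃ ∧
      (x (z + (p + (1, -1)))).arrow = some b₄ := by
  obtain ⟨c₁, e₁⟩ := State.isSolid_iff.1 (hx.inside_isSolid ha h1)
  obtain ⟨c₂, e₂⟩ := State.isSolid_iff.1 (hx.inside_isSolid ha h2)
  obtain ⟨c₃, e₃⟩ := State.isSolid_iff.1 (hx.inside_isSolid ha h3)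
  obtain ⟨c₄, e₄⟩ := State.isSolid_iff.1 (hx.inside_isSolid ha h4)
  obtain ⟨m, y, hS, hy, hA⟩ := exists_allowedAt_of_not_eroded_inside (hx z a ha)
  obtain ⟨b₁, b₂, b₃, b₄, hb, f₁, f₂, f₃, f₄⟩ := hA.arrows p (hS h1) (hS h4)
  rw [hy _ h1] at f₁
  rw [hy _ h2] at f₂
  rw [hy _ h3] at f₃
  rw [hy _ h4] at f₄
  rw [← f₁.eq e₁, ← f₂.eq e₂, ← f₃.eq e₃, ← f₄.eq e₄] at *
  exact ⟨_, _, _, _, hb, e₁, e₂, e₃, e₄⟩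

theorem Stable.tilesFit {τ : TileSet T} {x : Cell → State T} (hx : Stable τ x) :
    TilesFit τ x := by
  intro z s t hs
  obtain ⟨a, ha⟩ := State.isSolid_iff.1 (State.isSolid_of_tile hs)
  constructor
  · intro ht
    obtain ⟨m, y, hS, hy, hA⟩ := exists_allowedAt_of_not_eroded_pair (hx z a ha)
      (w := (1, 0)) (by decide) (by decide)
    refine hA.horizontal 0 s t hS.1 (by simpa using hS.2) (by rw [hy.1]; simpa using hs) ?_
    rw [zero_add, hy.2]
    exact ht
  · intro ht
    obtain ⟨m, y, hS, hy, hA⟩ := exists_allowedAt_of_not_eroded_pair (hx z a ha)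
      (w := (0, 1)) (by decide) (by decide)
    refine hA.vertical 0 s t hS.1 (by simpa using hS.2) (by rw [hy.1]; simpa using hs) ?_
    rw [zero_add, hy.2]
    exact ht

theorem mem_insideRegion {a : Arrow} {u : Cell} : u ∈ insideRegion a ↔
    ((-1 ≤ u.1 ∧ u.1 ≤ 1) ∧ (-1 ≤ u.2 ∧ u.2 ≤ 1)) ∧
      ¬ ((a.dx ≠ 0 ∧ u.1 = -a.dx) ∨ (a.dy ≠ 0 ∧ u.2 = -a.dy)) := by
  simp only [insideRegion, Set.mem_ofPred_eq, supNorm_le_iff, Arrow.Outside]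
  push_cast
  rfl

/-- An arrow can only point to arrows of the same direction, or to `⊥`. -/
def Arrow.PointsTo (a b : Arrow) : Prop :=
  (a.dx ≠ 0 → b = .bot ∨ b.dx = a.dx) ∧ (a.dy ≠ 0 → b = .bot ∨ b.dy = a.dy)

instance (a b : Arrow) : Decidable (a.PointsTo b) := by unfold Arrow.PointsTo; infer_instance

theorem pointsTo_of_block : ∀ q ∈ onionBlocks,
    ((q.1 = .down → q.1.PointsTo q.2.2.1) ∧ (q.1 = .right → q.1.PointsTo q.2.1) ∧
      (q.1 = .downRight → q.1.PointsTo q.2.2.2)) ∧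
    ((q.2.1 = .left → q.2.1.PointsTo q.1) ∧ (q.2.1 = .downLeft → q.2.1.PointsTo q.2.2.1)) ∧
    ((q.2.2.1 = .up → q.2.2.1.PointsTo q.1) ∧ (q.2.2.1 = .upRight → q.2.2.1.PointsTo q.2.1)) ∧
    (q.2.2.2 = .upLeft → q.2.2.2.PointsTo q.1) := by
  decide

/-- For each arrow there is a block that contains the cell and the one pointed to and lies in the
inside region. Such a block is a block of the picture, where arrows behave this way. -/
theorem Stable.exists_pointsTo {τ : TileSet T} {x : Cell → State T} (hx : Stable τ x) {z : Cell}
    {a : Arrow} (ha : (x z).arrow = some a) :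
    a = .bot ∨ ∃ b, (x (z + a.dir)).arrow = some b ∧ a.PointsTo b := by
  have key : ∀ p : Cell, p ∈ insideRegion a → p + (1, 0) ∈ insideRegion a →
      p + (0, -1) ∈ insideRegion a → p + (1, -1) ∈ insideRegion a → _ :=
    fun p h1 h2 h3 h4 => hx.inside_block ha h1 h2 h3 h4
  have hz : (x (z + 0)).arrow = some a := by simpa using ha
  cases a
  case bot => exact Or.inl rfl
  all_goals right
  case down =>
    obtain ⟨b₁, b₂, b₃, b₄, hb, e₁, e₂, e₃, e₄⟩ :=
      key (0, 0) (by simp [mem_insideRegion, Arrow.dx, Arrow.dy])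
        (by simp [mem_insideRegion, Arrow.dx, Arrow.dy])
        (by simp [mem_insideRegion, Arrow.dx, Arrow.dy])
        (by simp [mem_insideRegion, Arrow.dx, Arrow.dy])
    obtain rfl := Option.some.inj (e₁.symm.trans hz)
    exact ⟨b₃, by simpa [Arrow.dir, Arrow.dx, Arrow.dy] using e₃,
      (pointsTo_of_block _ (onionBlock_iff_mem.1 hb)).1.1 rfl⟩
  case right =>
    obtain ⟨b₁, b₂, b₃, b₄, hb, e₁, e₂, e₃, e₄⟩ :=
      key (0, 0) (by simp [mem_insideRegion, Arrow.dx, Arrow.dy])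
        (by simp [mem_insideRegion, Arrow.dx, Arrow.dy])
        (by simp [mem_insideRegion, Arrow.dx, Arrow.dy])
        (by simp [mem_insideRegion, Arrow.dx, Arrow.dy])
    obtain rfl := Option.some.inj (e₁.symm.trans hz)
    exact ⟨b₂, by simpa [Arrow.dir, Arrow.dx, Arrow.dy] using e₂,
      (pointsTo_of_block _ (onionBlock_iff_mem.1 hb)).1.2.1 rfl⟩
  case downRight =>
    obtain ⟨b₁, b₂, b₃, b₄, hb, e₁, e₂, e₃, e₄⟩ :=
      key (0, 0) (by simp [mem_insideRegion, Arrow.dx, Arrow.dy])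
        (by simp [mem_insideRegion, Arrow.dx, Arrow.dy])
        (by simp [mem_insideRegion, Arrow.dx, Arrow.dy])
        (by simp [mem_insideRegion, Arrow.dx, Arrow.dy])
    obtain rfl := Option.some.inj (e₁.symm.trans hz)
    exact ⟨b₄, by simpa [Arrow.dir, Arrow.dx, Arrow.dy] using e₄,
      (pointsTo_of_block _ (onionBlock_iff_mem.1 hb)).1.2.2 rfl⟩
  case left =>
    obtain ⟨b₁, b₂, b₃, b₄, hb, e₁, e₂, e₃, e₄⟩ :=
      key (-1, 0) (by simp [mem_insideRegion, Arrow.dx, Arrow.dy])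
        (by simp [mem_insideRegion, Arrow.dx, Arrow.dy])
        (by simp [mem_insideRegion, Arrow.dx, Arrow.dy])
        (by simp [mem_insideRegion, Arrow.dx, Arrow.dy])
    simp only [Prod.mk_add_mk, Int.reduceAdd] at e₁ e₂ e₃ e₄
    obtain rfl := Option.some.inj (e₂.symm.trans hz)
    exact ⟨b₁, by simpa [Arrow.dir, Arrow.dx, Arrow.dy] using e₁,
      (pointsTo_of_block _ (onionBlock_iff_mem.1 hb)).2.1.1 rfl⟩
  case downLeft =>
    obtain ⟨b₁, b₂, b₃, b₄, hb, e₁, e₂, e₃, e₄⟩ :=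
      key (-1, 0) (by simp [mem_insideRegion, Arrow.dx, Arrow.dy])
        (by simp [mem_insideRegion, Arrow.dx, Arrow.dy])
        (by simp [mem_insideRegion, Arrow.dx, Arrow.dy])
        (by simp [mem_insideRegion, Arrow.dx, Arrow.dy])
    simp only [Prod.mk_add_mk, Int.reduceAdd] at e₁ e₂ e₃ e₄
    obtain rfl := Option.some.inj (e₂.symm.trans hz)
    exact ⟨b₃, by simpa [Arrow.dir, Arrow.dx, Arrow.dy] using e₃,
      (pointsTo_of_block _ (onionBlock_iff_mem.1 hb)).2.1.2 rfl⟩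
  case up =>
    obtain ⟨b₁, b₂, b₃, b₄, hb, e₁, e₂, e₃, e₄⟩ :=
      key (0, 1) (by simp [mem_insideRegion, Arrow.dx, Arrow.dy])
        (by simp [mem_insideRegion, Arrow.dx, Arrow.dy])
        (by simp [mem_insideRegion, Arrow.dx, Arrow.dy])
        (by simp [mem_insideRegion, Arrow.dx, Arrow.dy])
    simp only [Prod.mk_add_mk, Int.reduceAdd] at e₁ e₂ e₃ e₄
    obtain rfl := Option.some.inj (e₃.symm.trans hz)
    exact ⟨b₁, by simpa [Arrow.dir, Arrow.dx, Arrow.dy] using e₁,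
      (pointsTo_of_block _ (onionBlock_iff_mem.1 hb)).2.2.1.1 rfl⟩
  case upRight =>
    obtain ⟨b₁, b₂, b₃, b₄, hb, e₁, e₂, e₃, e₄⟩ :=
      key (0, 1) (by simp [mem_insideRegion, Arrow.dx, Arrow.dy])
        (by simp [mem_insideRegion, Arrow.dx, Arrow.dy])
        (by simp [mem_insideRegion, Arrow.dx, Arrow.dy])
        (by simp [mem_insideRegion, Arrow.dx, Arrow.dy])
    simp only [Prod.mk_add_mk, Int.reduceAdd] at e₁ e₂ e₃ e₄
    obtain rfl := Option.some.inj (e₃.symm.trans hz)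
    exact ⟨b₂, by simpa [Arrow.dir, Arrow.dx, Arrow.dy] using e₂,
      (pointsTo_of_block _ (onionBlock_iff_mem.1 hb)).2.2.1.2 rfl⟩
  case upLeft =>
    obtain ⟨b₁, b₂, b₃, b₄, hb, e₁, e₂, e₃, e₄⟩ :=
      key (-1, 1) (by simp [mem_insideRegion, Arrow.dx, Arrow.dy])
        (by simp [mem_insideRegion, Arrow.dx, Arrow.dy])
        (by simp [mem_insideRegion, Arrow.dx, Arrow.dy])
        (by simp [mem_insideRegion, Arrow.dx, Arrow.dy])
    simp only [Prod.mk_add_mk, Int.reduceAdd] at e₁ e₂ e₃ e₄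
    obtain rfl := Option.some.inj (e₄.symm.trans hz)
    exact ⟨b₁, by simpa [Arrow.dir, Arrow.dx, Arrow.dy] using e₁,
      (pointsTo_of_block _ (onionBlock_iff_mem.1 hb)).2.2.2 rfl⟩

/-! ### Filled squares grow ring by ring -/

set_option synthInstance.maxSize 2000 in
/-- A block is determined by an outer arrow and the two inner ones. -/
theorem block_eq_of_three : ∀ q ∈ onionBlocks, ∀ r ∈ onionBlocks,
    (q.2.2.1 = r.2.2.1 → q.2.2.2 = r.2.2.2 →
      (q.1 = .down ∧ r.1 = .down ∨ q.2.1 = .down ∧ r.2.1 = .down) → q = r) ∧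
    (q.1 = r.1 → q.2.1 = r.2.1 →
      (q.2.2.1 = .up ∧ r.2.2.1 = .up ∨ q.2.2.2 = .up ∧ r.2.2.2 = .up) → q = r) ∧
    (q.2.1 = r.2.1 → q.2.2.2 = r.2.2.2 →
      (q.1 = .right ∧ r.1 = .right ∨ q.2.2.1 = .right ∧ r.2.2.1 = .right) → q = r) ∧
    (q.1 = r.1 → q.2.2.1 = r.2.2.1 →
      (q.2.1 = .left ∧ r.2.1 = .left ∨ q.2.2.2 = .left ∧ r.2.2.2 = .left) → q = r) := by
  decide

-- For the blocks at the end of a northern or southern side of a ring: the diagonal arrow of the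
-- inner ring already tells that the corner comes next. The next lemma does the same for the other
-- two sides.
set_option synthInstance.maxSize 2000 in
theorem block_eq_of_column : ∀ q ∈ onionBlocks, ∀ r ∈ onionBlocks,
    (q.1 = r.1 → q.2.2.1 = r.2.2.1 →
      (r.1 = .down ∧ r.2.2.1 = .downLeft ∨ r.2.2.1 = .up ∧ r.1 = .upLeft) → q = r) ∧
    (q.2.1 = r.2.1 → q.2.2.2 = r.2.2.2 →
      (r.2.1 = .down ∧ r.2.2.2 = .downRight ∨ r.2.2.2 = .up ∧ r.2.1 = .upRight) →
      q = r) := by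
  decide

set_option synthInstance.maxSize 2000 in
theorem block_eq_of_row : ∀ q ∈ onionBlocks, ∀ r ∈ onionBlocks,
    (q.1 = r.1 → q.2.1 = r.2.1 →
      (r.1 = .right ∧ r.2.1 = .upRight ∨ r.2.1 = .left ∧ r.1 = .upLeft) → q = r) ∧
    (q.2.2.1 = r.2.2.1 → q.2.2.2 = r.2.2.2 →
      (r.2.2.1 = .right ∧ r.2.2.2 = .downRight ∨ r.2.2.2 = .left ∧ r.2.2.1 = .downLeft) →
      q = r) := by
  decide

-- For the corners of a ring: two equal diagonal arrows in a row fix the block.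
set_option synthInstance.maxSize 2000 in
theorem block_eq_of_diagonal : ∀ q ∈ onionBlocks, ∀ r ∈ onionBlocks,
    (q.1 = r.1 → q.2.2.2 = r.2.2.2 →
      (r.1 = .downRight ∧ r.2.2.2 = .downRight ∨ r.2.2.2 = .upLeft ∧ r.1 = .upLeft) →
      q = r) ∧
    (q.2.1 = r.2.1 → q.2.2.1 = r.2.2.1 →
      (r.2.1 = .downLeft ∧ r.2.2.1 = .downLeft ∨ r.2.2.1 = .upRight ∧ r.2.1 = .upRight) →
      q = r) := by
  decide

-- The picture contains `⊥` once, so its position in a block fixes the block.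
set_option synthInstance.maxSize 2000 in
theorem block_eq_of_bot : ∀ q ∈ onionBlocks, ∀ r ∈ onionBlocks,
    (q.1 = .bot → r.1 = .bot → q = r) ∧ (q.2.1 = .bot → r.2.1 = .bot → q = r) ∧
    (q.2.2.1 = .bot → r.2.2.1 = .bot → q = r) ∧
    (q.2.2.2 = .bot → r.2.2.2 = .bot → q = r) := by
  decide

theorem onionArrow_eq_of {u : Cell} :
    (-u.2 < u.1 ∧ u.1 < u.2 → onionArrow u = .down) ∧
    (u.2 < u.1 ∧ u.1 < -u.2 → onionArrow u = .up) ∧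
    (-u.1 < u.2 ∧ u.2 < u.1 → onionArrow u = .left) ∧
    (u.1 < u.2 ∧ u.2 < -u.1 → onionArrow u = .right) ∧
    (0 < u.1 ∧ u.2 = u.1 → onionArrow u = .downLeft) ∧
    (0 < u.1 ∧ u.2 = -u.1 → onionArrow u = .upLeft) ∧
    (u.1 < 0 ∧ u.2 = -u.1 → onionArrow u = .downRight) ∧
    (u.1 < 0 ∧ u.2 = u.1 → onionArrow u = .upRight) := by
  refine ⟨?_, ?_, ?_, ?_, ?_, ?_, ?_, ?_⟩ <;> intro h' <;>
  rcases onionArrow_cases u with ⟨e, h⟩ | ⟨e, h⟩ | ⟨e, h⟩ | ⟨e, h⟩ | ⟨e, h⟩ | ⟨e, h⟩ | ⟨e, h⟩ |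
    ⟨e, h⟩ | ⟨e, h⟩ <;> first | exact e | (exfalso; omega)

/-- Every block of the inside region of a cell just outside a filled square, which continues the
onion, continues the onion. -/
theorem Stable.ring_block {τ : TileSet T} {x : Cell → State T} (hx : Stable τ x) {c : Cell} {k : ℕ}
    (hk : 1 ≤ k) (hf : Filled x c k) {u p : Cell} (hu : supNorm u = k + 1)
    (hG : (x (c + u)).arrow = some (onionArrow u))
    (hp : u = p ∨ u = p + (1, 0) ∨ u = p + (0, -1) ∨ u = p + (1, -1))
    (h1 : p - u ∈ insideRegion (onionArrow u)) (h2 : p + (1, 0) - u ∈ insideRegion (onionArrow u))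
    (h3 : p + (0, -1) - u ∈ insideRegion (onionArrow u))
    (h4 : p + (1, -1) - u ∈ insideRegion (onionArrow u)) :
    (x (c + p)).arrow = some (onionArrow p) ∧
    (x (c + (p + (1, 0)))).arrow = some (onionArrow (p + (1, 0))) ∧
    (x (c + (p + (0, -1)))).arrow = some (onionArrow (p + (0, -1))) ∧
    (x (c + (p + (1, -1)))).arrow = some (onionArrow (p + (1, -1))) := by
  obtain ⟨b₁, b₂, b₃, b₄, hb, e₁, e₂, e₃, e₄⟩ := hx.inside_block hG h1
    (by rwa [sub_add_eq_add_sub]) (by rwa [sub_add_eq_add_sub]) (by rwa [sub_add_eq_add_sub])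
  rw [sub_add_eq_add_sub, add_assoc, add_sub_cancel] at e₂ e₃ e₄
  rw [add_assoc, add_sub_cancel] at e₁
  have hr := onionBlock_onionArrow p
  rw [onionBlock_iff_mem] at hb hr
  suffices hs : (b₁, b₂, b₃, b₄) = (onionArrow p, onionArrow (p + (1, 0)),
      onionArrow (p + (0, -1)), onionArrow (p + (1, -1))) by
    simp only [Prod.mk.injEq] at hs
    rw [e₁, e₂, e₃, e₄, hs.1, hs.2.1, hs.2.2.1, hs.2.2.2]
    exact ⟨rfl, rfl, rfl, rfl⟩
  have known : ∀ v b, supNorm v ≤ k → (x (c + v)).arrow = some b → b = onionArrow v :=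
    fun v b hv hb => Option.some.inj (hb.symm.trans (hf v hv))
  have hu' : supNorm u ≤ k + 1 := hu.le
  have hu'' : ¬ supNorm u ≤ k := by omega
  have k₁ := fun (_ : Unit) h => known _ _ h e₁
  have k₂ := fun (_ : Unit) h => known _ _ h e₂
  have k₃ := fun (_ : Unit) h => known _ _ h e₃
  have k₄ := fun (_ : Unit) h => known _ _ h e₄
  have o₁ := fun _ : Unit => @onionArrow_eq_of p
  have o₂ := fun _ : Unit => @onionArrow_eq_of (p + (1, 0))
  have o₃ := fun _ : Unit => @onionArrow_eq_of (p + (0, -1))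
  have o₄ := fun _ : Unit => @onionArrow_eq_of (p + (1, -1))
  simp only [supNorm_le_iff, mem_insideRegion, Prod.fst_add, Prod.snd_add, Prod.fst_sub,
    Prod.snd_sub] at h1 h2 h3 h4 hu' hu'' k₁ k₂ k₃ k₄ o₁ o₂ o₃ o₄
  push_cast at hu' hu''
  clear hx hf known
  rcases hp with rfl | rfl | rfl | rfl
  · obtain rfl := Option.some.inj (e₁.symm.trans hG)
    rcases onionArrow_cases u with ⟨e, h⟩ | ⟨e, h⟩ | ⟨e, h⟩ | ⟨e, h⟩ | ⟨e, h⟩ | ⟨e, h⟩ | ⟨e, h⟩ |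
      ⟨e, h⟩ | ⟨e, h⟩ <;> rw [e] at h1 h2 h3 h4 <;> simp only [Arrow.dx, Arrow.dy] at h1 h2 h3 h4 <;>
      try (exfalso; omega)
    -- Before the end of the side both inner cells of the block are known. At the end only the one
    -- below `u` is, and it is a corner of the inner square. The other sides are alike, and a corner
    -- `u` is handled by its diagonal.
    · have k₃ := k₃ () (by omega)
      by_cases h5 : u.1 + 1 ≤ k
      · exact (block_eq_of_three _ hb _ hr).1 k₃ (k₄ () (by omega)) (Or.inl ⟨e, e⟩)
      · exact (block_eq_of_column _ hb _ hr).1 rfl k₃ (Or.inl ⟨e, (o₃ ()).2.2.2.2.1 (by omega)⟩)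
    · have k₂ := k₂ () (by omega)
      by_cases h5 : -k ≤ u.2 - 1
      · exact (block_eq_of_three _ hb _ hr).2.2.1 k₂ (k₄ () (by omega)) (Or.inl ⟨e, e⟩)
      · exact (block_eq_of_row _ hb _ hr).1 rfl k₂ (Or.inl ⟨e, (o₂ ()).2.2.2.2.2.2.2 (by omega)⟩)
    · exact (block_eq_of_diagonal _ hb _ hr).1 rfl (k₄ () (by omega)) (Or.inl ⟨e, (o₄ ()).2.2.2.2.2.2.1 (by omega)⟩)
  · obtain rfl := Option.some.inj (e₂.symm.trans hG)
    rcases onionArrow_cases (p + (1, 0)) with ⟨e, h⟩ | ⟨e, h⟩ | ⟨e, h⟩ | ⟨e, h⟩ | ⟨e, h⟩ | ⟨e, h⟩ |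
      ⟨e, h⟩ | ⟨e, h⟩ | ⟨e, h⟩ <;> rw [e] at h1 h2 h3 h4 <;>
      simp only [Arrow.dx, Arrow.dy, Prod.fst_add, Prod.snd_add] at h h1 h2 h3 h4 hu' hu'' <;>
      try (exfalso; omega)
    · have k₄ := k₄ () (by omega)
      by_cases h5 : -k ≤ p.1
      · exact (block_eq_of_three _ hb _ hr).1 (k₃ () (by omega)) k₄ (Or.inr ⟨e, e⟩)
      · exact (block_eq_of_column _ hb _ hr).2 rfl k₄ (Or.inl ⟨e, (o₄ ()).2.2.2.2.2.2.1 (by omega)⟩)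
    · have k₁ := k₁ () (by omega)
      by_cases h5 : -k ≤ p.2 - 1
      · exact (block_eq_of_three _ hb _ hr).2.2.2 k₁ (k₃ () (by omega)) (Or.inl ⟨e, e⟩)
      · exact (block_eq_of_row _ hb _ hr).1 k₁ rfl (Or.inr ⟨e, (o₁ ()).2.2.2.2.2.1 (by omega)⟩)
    · exact (block_eq_of_diagonal _ hb _ hr).2 rfl (k₃ () (by omega)) (Or.inl ⟨e, (o₃ ()).2.2.2.2.1 (by omega)⟩)
  · obtain rfl := Option.some.inj (e₃.symm.trans hG)
    rcases onionArrow_cases (p + (0, -1)) with ⟨e, h⟩ | ⟨e, h⟩ | ⟨e, h⟩ | ⟨e, h⟩ | ⟨e, h⟩ |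
      ⟨e, h⟩ | ⟨e, h⟩ | ⟨e, h⟩ | ⟨e, h⟩ <;> rw [e] at h1 h2 h3 h4 <;>
      simp only [Arrow.dx, Arrow.dy, Prod.fst_add, Prod.snd_add] at h h1 h2 h3 h4 hu' hu'' <;>
      try (exfalso; omega)
    · have k₁ := k₁ () (by omega)
      by_cases h5 : p.1 + 1 ≤ k
      · exact (block_eq_of_three _ hb _ hr).2.1 k₁ (k₂ () (by omega)) (Or.inl ⟨e, e⟩)
      · exact (block_eq_of_column _ hb _ hr).1 k₁ rfl (Or.inr ⟨e, (o₁ ()).2.2.2.2.2.1 (by omega)⟩)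
    · have k₄ := k₄ () (by omega)
      by_cases h5 : p.2 ≤ k
      · exact (block_eq_of_three _ hb _ hr).2.2.1 (k₂ () (by omega)) k₄ (Or.inr ⟨e, e⟩)
      · exact (block_eq_of_row _ hb _ hr).2 rfl k₄ (Or.inl ⟨e, (o₄ ()).2.2.2.2.2.2.1 (by omega)⟩)
    · exact (block_eq_of_diagonal _ hb _ hr).2 (k₂ () (by omega)) rfl (Or.inr ⟨e, (o₂ ()).2.2.2.2.2.2.2 (by omega)⟩)
  · obtain rfl := Option.some.inj (e₄.symm.trans hG)
    rcases onionArrow_cases (p + (1, -1)) with ⟨e, h⟩ | ⟨e, h⟩ | ⟨e, h⟩ | ⟨e, h⟩ | ⟨e, h⟩ |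
      ⟨e, h⟩ | ⟨e, h⟩ | ⟨e, h⟩ | ⟨e, h⟩ <;> rw [e] at h1 h2 h3 h4 <;>
      simp only [Arrow.dx, Arrow.dy, Prod.fst_add, Prod.snd_add] at h h1 h2 h3 h4 hu' hu'' <;>
      try (exfalso; omega)
    · have k₂ := k₂ () (by omega)
      by_cases h5 : -k ≤ p.1
      · exact (block_eq_of_three _ hb _ hr).2.1 (k₁ () (by omega)) k₂ (Or.inr ⟨e, e⟩)
      · exact (block_eq_of_column _ hb _ hr).2 k₂ rfl (Or.inr ⟨e, (o₂ ()).2.2.2.2.2.2.2 (by omega)⟩)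
    · have k₃ := k₃ () (by omega)
      by_cases h5 : p.2 ≤ k
      · exact (block_eq_of_three _ hb _ hr).2.2.2 (k₁ () (by omega)) k₃ (Or.inr ⟨e, e⟩)
      · exact (block_eq_of_row _ hb _ hr).2 k₃ rfl (Or.inr ⟨e, (o₃ ()).2.2.2.2.1 (by omega)⟩)
    · exact (block_eq_of_diagonal _ hb _ hr).1 (k₁ () (by omega)) rfl (Or.inr ⟨e, (o₁ ()).2.2.2.2.2.1 (by omega)⟩)

theorem interval_connected {P : ℤ → Prop} {K : ℤ}
    (h : ∀ i, -K ≤ i → i < K → (P i ↔ P (i + 1))) {i j : ℤ} (hi : -K ≤ i ∧ i ≤ K)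
    (hj : -K ≤ j ∧ j ≤ K) (hP : P i) : P j := by
  have key : ∀ n : ℕ, -K + n ≤ K → (P (-K) ↔ P (-K + n)) := by
    intro n
    induction n with
    | zero => simp
    | succ n ih =>
      intro hn
      push_cast at hn ⊢
      rw [ih (by omega), h _ (by omega) (by omega), add_assoc]
  have h1 := key (i + K).toNat (by omega)
  have h2 := key (j + K).toNat (by omega)
  rw [show -K + ((i + K).toNat : ℤ) = i by omega] at h1
  rw [show -K + ((j + K).toNat : ℤ) = j by omega] at h2
  exact h2.1 (h1.2 hP)

/-- A filled square extends to a larger one as soon as one more cell continues the onion. -/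
theorem Stable.filled_succ {τ : TileSet T} {x : Cell → State T} (hx : Stable τ x) {c : Cell} {k : ℕ}
    (hk : 1 ≤ k) (hf : Filled x c k) {u : Cell} (hu : supNorm u = k + 1)
    (hG : (x (c + u)).arrow = some (onionArrow u)) : Filled x c (k + 1) := by
  let G : Cell → Prop := fun u => (x (c + u)).arrow = some (onionArrow u)
  have hn : ∀ v : Cell, ((-(k + 1 : ℤ) ≤ v.1 ∧ v.1 ≤ k + 1) ∧ (-(k + 1 : ℤ) ≤ v.2 ∧ v.2 ≤ k + 1)) →
      ¬ ((-(k : ℤ) ≤ v.1 ∧ v.1 ≤ k) ∧ (-(k : ℤ) ≤ v.2 ∧ v.2 ≤ k)) → supNorm v = k + 1 := by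
    intro v h1 h2
    have h3 := (supNorm_le_iff v (k + 1)).2 (by push_cast; omega)
    have h4 := mt (supNorm_le_iff v k).1 h2
    omega
  have step : ∀ v p : Cell, supNorm v = k + 1 → G v →
      (v = p ∨ v = p + (1, 0) ∨ v = p + (0, -1) ∨ v = p + (1, -1)) →
      supNorm (p - v) ≤ 1 → supNorm (p + (1, -1) - v) ≤ 1 →
      (∀ e : Cell, (e = p ∨ e = p + (1, 0) ∨ e = p + (0, -1) ∨ e = p + (1, -1)) →
        ¬ (onionArrow v).Outside (e - v)) →
      G p ∧ G (p + (1, 0)) ∧ G (p + (0, -1)) ∧ G (p + (1, -1)) := by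
    intro v p h1 h2 h3 h4 h5 h6
    refine hx.ring_block hk hf h1 h2 h3 ⟨?_, h6 _ (by simp)⟩ ⟨?_, h6 _ (by simp)⟩
      ⟨?_, h6 _ (by simp)⟩ ⟨?_, h6 _ (by simp)⟩ <;>
    · simp only [supNorm_le_iff, Prod.fst_add, Prod.snd_add, Prod.fst_sub, Prod.snd_sub] at *
      push_cast at *
      omega
  -- Neighbours on a side of the ring share a block with the inner ring that lies in the inside
  -- region of either of them, so `G` passes from one to the other.
  have top : ∀ i : ℤ, -(k + 1 : ℤ) ≤ i → i < k + 1 → (G (i, k + 1) ↔ G (i + 1, k + 1)) := by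
    intro i h1 h2
    constructor
    · intro h
      have := (step (i, k + 1) (i, k + 1) (hn _ (by dsimp; omega) (by dsimp; omega)) h (by simp)
        (by simp [supNorm]) (by simp [supNorm]) ?_).2.1
      · simpa using this
      · rintro e (rfl | rfl | rfl | rfl) <;>
        rcases onionArrow_cases (i, k + 1) with ⟨e, h⟩ | ⟨e, h⟩ | ⟨e, h⟩ | ⟨e, h⟩ | ⟨e, h⟩ |
          ⟨e, h⟩ | ⟨e, h⟩ | ⟨e, h⟩ | ⟨e, h⟩ <;> rw [e] <;>
        simp [Arrow.Outside, Arrow.dx, Arrow.dy] at h ⊢ <;> omega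
    · intro h
      have := (step (i + 1, k + 1) (i, k + 1) (hn _ (by dsimp; omega) (by dsimp; omega)) h (by simp)
        (by simp [supNorm]) (by simp [supNorm]) ?_).1
      · simpa using this
      · rintro e (rfl | rfl | rfl | rfl) <;>
        rcases onionArrow_cases (i + 1, k + 1) with ⟨e, h⟩ | ⟨e, h⟩ | ⟨e, h⟩ | ⟨e, h⟩ | ⟨e, h⟩ |
          ⟨e, h⟩ | ⟨e, h⟩ | ⟨e, h⟩ | ⟨e, h⟩ <;> rw [e] <;>
        simp [Arrow.Outside, Arrow.dx, Arrow.dy] at h ⊢ <;> omega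
  have bottom : ∀ i : ℤ, -(k + 1 : ℤ) ≤ i → i < k + 1 →
      (G (i, -(k + 1)) ↔ G (i + 1, -(k + 1))) := by
    intro i h1 h2
    constructor
    · intro h
      have := (step (i, -(k + 1)) (i, -k) (hn _ (by dsimp; omega) (by dsimp; omega)) h
        (by simp; omega) (by simp [supNorm]) (by simp [supNorm]; omega) ?_).2.2.2
      · simpa [neg_add, -neg_add_rev] using this
      · rintro e (rfl | rfl | rfl | rfl) <;>
        rcases onionArrow_cases (i, -(k + 1)) with ⟨e, h⟩ | ⟨e, h⟩ | ⟨e, h⟩ | ⟨e, h⟩ | ⟨e, h⟩ |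
          ⟨e, h⟩ | ⟨e, h⟩ | ⟨e, h⟩ | ⟨e, h⟩ <;> rw [e] <;>
        simp [Arrow.Outside, Arrow.dx, Arrow.dy] at h ⊢ <;> omega
    · intro h
      have := (step (i + 1, -(k + 1)) (i, -k) (hn _ (by dsimp; omega) (by dsimp; omega)) h
        (by simp; omega) (by simp [supNorm]) (by simp [supNorm]; omega) ?_).2.2.1
      · simpa [neg_add, -neg_add_rev] using this
      · rintro e (rfl | rfl | rfl | rfl) <;>
        rcases onionArrow_cases (i + 1, -(k + 1)) with ⟨e, h⟩ | ⟨e, h⟩ | ⟨e, h⟩ | ⟨e, h⟩ | ⟨e, h⟩ |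
          ⟨e, h⟩ | ⟨e, h⟩ | ⟨e, h⟩ | ⟨e, h⟩ <;> rw [e] <;>
        simp [Arrow.Outside, Arrow.dx, Arrow.dy] at h ⊢ <;> omega
  have west : ∀ i : ℤ, -(k + 1 : ℤ) ≤ i → i < k + 1 → (G (-(k + 1), i) ↔ G (-(k + 1), i + 1)) := by
    intro i h1 h2
    constructor
    · intro h
      have := (step (-(k + 1), i) (-(k + 1), i + 1) (hn _ (by dsimp; omega) (by dsimp; omega)) h
        (by simp) (by simp [supNorm]) (by simp [supNorm]) ?_).1
      · exact this
      · rintro e (rfl | rfl | rfl | rfl) <;>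
        rcases onionArrow_cases (-(k + 1), i) with ⟨e, h⟩ | ⟨e, h⟩ | ⟨e, h⟩ | ⟨e, h⟩ | ⟨e, h⟩ |
          ⟨e, h⟩ | ⟨e, h⟩ | ⟨e, h⟩ | ⟨e, h⟩ <;> rw [e] <;>
        simp [Arrow.Outside, Arrow.dx, Arrow.dy] at h ⊢ <;> omega
    · intro h
      have := (step (-(k + 1), i + 1) (-(k + 1), i + 1) (hn _ (by dsimp; omega) (by dsimp; omega)) h
        (by simp) (by simp [supNorm]) (by simp [supNorm]) ?_).2.2.1
      · simpa using this
      · rintro e (rfl | rfl | rfl | rfl) <;>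
        rcases onionArrow_cases (-(k + 1), i + 1) with ⟨e, h⟩ | ⟨e, h⟩ | ⟨e, h⟩ | ⟨e, h⟩ | ⟨e, h⟩ |
          ⟨e, h⟩ | ⟨e, h⟩ | ⟨e, h⟩ | ⟨e, h⟩ <;> rw [e] <;>
        simp [Arrow.Outside, Arrow.dx, Arrow.dy] at h ⊢ <;> omega
  have east : ∀ i : ℤ, -(k + 1 : ℤ) ≤ i → i < k + 1 → (G (k + 1, i) ↔ G (k + 1, i + 1)) := by
    intro i h1 h2
    constructor
    · intro h
      have := (step (k + 1, i) (k, i + 1) (hn _ (by dsimp; omega) (by dsimp; omega)) h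
        (by simp) (by simp [supNorm]) (by simp [supNorm]) ?_).2.1
      · simpa using this
      · rintro e (rfl | rfl | rfl | rfl) <;>
        rcases onionArrow_cases (k + 1, i) with ⟨e, h⟩ | ⟨e, h⟩ | ⟨e, h⟩ | ⟨e, h⟩ | ⟨e, h⟩ |
          ⟨e, h⟩ | ⟨e, h⟩ | ⟨e, h⟩ | ⟨e, h⟩ <;> rw [e] <;>
        simp [Arrow.Outside, Arrow.dx, Arrow.dy] at h ⊢ <;> omega
    · intro h
      have := (step (k + 1, i + 1) (k, i + 1) (hn _ (by dsimp; omega) (by dsimp; omega)) h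
        (by simp) (by simp [supNorm]) (by simp [supNorm]) ?_).2.2.2
      · simpa using this
      · rintro e (rfl | rfl | rfl | rfl) <;>
        rcases onionArrow_cases (k + 1, i + 1) with ⟨e, h⟩ | ⟨e, h⟩ | ⟨e, h⟩ | ⟨e, h⟩ | ⟨e, h⟩ |
          ⟨e, h⟩ | ⟨e, h⟩ | ⟨e, h⟩ | ⟨e, h⟩ <;> rw [e] <;>
        simp [Arrow.Outside, Arrow.dx, Arrow.dy] at h ⊢ <;> omega
  have ht := fun {i j : ℤ} => interval_connected (P := fun i => G (i, k + 1)) top (i := i) (j := j)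
  have hb := fun {i j : ℤ} =>
    interval_connected (P := fun i => G (i, -(k + 1))) bottom (i := i) (j := j)
  have hw := fun {i j : ℤ} =>
    interval_connected (P := fun i => G (-(k + 1), i)) west (i := i) (j := j)
  have he := fun {i j : ℤ} => interval_connected (P := fun i => G (k + 1, i)) east (i := i) (j := j)
  have m1 : -(k + 1 : ℤ) ≤ k + 1 ∧ (k + 1 : ℤ) ≤ k + 1 := by omega
  have m2 : -(k + 1 : ℤ) ≤ -(k + 1) ∧ -(k + 1 : ℤ) ≤ k + 1 := by omega
  have hu1 := (supNorm_le_iff u (k + 1)).1 hu.le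
  have hu2 := mt (supNorm_le_iff u k).2 (by omega)
  have hGu : G (u.1, u.2) := hG
  push_cast at hu1
  -- The four sides share their corners, so `G` spreads from `u` to this corner and from there to
  -- the entire ring.
  have corner : G (k + 1, k + 1) := by
    have : u.2 = k + 1 ∨ u.2 = -(k + 1) ∨ u.1 = -(k + 1) ∨ u.1 = k + 1 := by omega
    rcases this with h | h | h | h <;> rw [h] at hGu
    · exact ht hu1.1 m1 hGu
    · exact he m2 m1 (hb hu1.1 m1 hGu)
    · exact ht m2 m1 (hw hu1.2 m1 hGu)
    · exact he hu1.2 m1 hGu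
  intro v hv
  by_cases hv' : supNorm v ≤ k
  · exact hf v hv'
  have hv1 := (supNorm_le_iff v (k + 1)).1 hv
  have hv2 := mt (supNorm_le_iff v k).2 hv'
  push_cast at hv1
  have : v.2 = k + 1 ∨ v.2 = -(k + 1) ∨ v.1 = -(k + 1) ∨ v.1 = k + 1 := by omega
  change G (v.1, v.2)
  rcases this with h | h | h | h <;> rw [h]
  · exact ht m1 hv1.1 corner
  · exact hb m1 hv1.1 (he m1 m2 corner)
  · exact hw m1 hv1.2 (ht m1 m2 corner)
  · exact he m1 hv1.2 corner

/-- The inside region of `⊥` is the full window, and each of its four blocks contains the `⊥` in a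
known position. -/
theorem Stable.filled_one {τ : TileSet T} {x : Cell → State T} (hx : Stable τ x) {z : Cell}
    (hz : (x z).arrow = some .bot) : Filled x z 1 := by
  have key : ∀ p : Cell, (-1 ≤ p.1 ∧ p.1 ≤ 0) → (0 ≤ p.2 ∧ p.2 ≤ 1) →
      (x (z + p)).arrow = some (onionArrow p) ∧
      (x (z + (p + (1, 0)))).arrow = some (onionArrow (p + (1, 0))) ∧
      (x (z + (p + (0, -1)))).arrow = some (onionArrow (p + (0, -1))) ∧
      (x (z + (p + (1, -1)))).arrow = some (onionArrow (p + (1, -1))) := by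
    intro p h1 h2
    have hi : ∀ u : Cell, (-1 ≤ u.1 ∧ u.1 ≤ 1) → (-1 ≤ u.2 ∧ u.2 ≤ 1) →
        u ∈ insideRegion .bot := by
      intro u h1 h2
      simp [mem_insideRegion, Arrow.dx, Arrow.dy, h1, h2]
    obtain ⟨b₁, b₂, b₃, b₄, hb, e₁, e₂, e₃, e₄⟩ := hx.inside_block (p := p) hz
      (hi _ (by omega) (by omega)) (hi _ (by simp; omega) (by simp; omega))
      (hi _ (by simp; omega) (by simp; omega)) (hi _ (by simp; omega) (by simp; omega))
    have hr := onionBlock_onionArrow p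
    rw [onionBlock_iff_mem] at hb hr
    have hbot := block_eq_of_bot _ hb _ hr
    have : (b₁, b₂, b₃, b₄) = (onionArrow p, onionArrow (p + (1, 0)),
        onionArrow (p + (0, -1)), onionArrow (p + (1, -1))) := by
      have hq : ∀ {q : Cell} {b : Arrow}, (x (z + q)).arrow = some b → q = 0 → b = .bot := by
        rintro q b hq rfl
        rw [add_zero, hz] at hq
        exact (Option.some.inj hq).symm
      have h0 : p = 0 ∨ p + (1, 0) = 0 ∨ p + (0, -1) = 0 ∨ p + (1, -1) = 0 := by
        simp only [Prod.ext_iff, Prod.fst_add, Prod.snd_add, Prod.fst_zero, Prod.snd_zero]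
        omega
      rcases h0 with h0 | h0 | h0 | h0
      · exact hbot.1 (hq e₁ h0) (onionArrow_eq_bot.2 h0)
      · exact hbot.2.1 (hq e₂ h0) (onionArrow_eq_bot.2 h0)
      · exact hbot.2.2.1 (hq e₃ h0) (onionArrow_eq_bot.2 h0)
      · exact hbot.2.2.2 (hq e₄ h0) (onionArrow_eq_bot.2 h0)
    simp only [Prod.mk.injEq] at this
    rw [e₁, e₂, e₃, e₄, this.1, this.2.1, this.2.2.1, this.2.2.2]
    exact ⟨rfl, rfl, rfl, rfl⟩
  rintro ⟨a, b⟩ hu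
  simp only [supNorm_le_iff] at hu
  push_cast at hu
  rcases lt_or_ge a 1 with ha | ha <;> rcases lt_or_ge b 0 with hb | hb
  · simpa using (key (a, b + 1) (by simp; omega) (by simp; omega)).2.2.1
  · exact (key (a, b) (by simp; omega) (by simp; omega)).1
  · simpa using (key (a - 1, b + 1) (by simp; omega) (by simp; omega)).2.2.2
  · simpa using (key (a - 1, b) (by simp; omega) (by simp; omega)).2.1

/-- One step back along an arrow. If the cell pointed to lies on the border of a filled square, then
`Arrow.PointsTo` forces `z` into the next ring, with just the arrow the onion has there, and
`Stable.filled_succ` fills that ring. -/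
theorem Stable.filled_of_pointsTo {τ : TileSet T} {x : Cell → State T} (hx : Stable τ x)
    {z c : Cell} {a b : Arrow} (ha : (x z).arrow = some a) (hb : (x (z + a.dir)).arrow = some b)
    (hab : a.PointsTo b) (hne : a ≠ .bot) (hf : Filled x c (supNorm (z + a.dir - c))) :
    Filled x c (supNorm (z - c)) := by
  obtain ⟨v, hv⟩ : ∃ v, v = z + a.dir - c := ⟨_, rfl⟩
  rw [← hv] at hf
  have hz : z - c = v - a.dir := by rw [hv]; abel
  rw [hz]
  by_cases hv0 : v = 0
  · subst hv0
    have : supNorm (0 - a.dir) = 1 := by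
      clear hv hz hf hb ha hab
      cases a <;> first | exact absurd rfl hne | decide
    rw [this]
    refine hx.filled_one ?_
    have := hf 0 le_rfl
    rwa [add_zero, onionArrow_zero] at this
  have hbv : b = onionArrow v := by
    have := hf v le_rfl
    rw [show c + v = z + a.dir by rw [hv]; abel, hb] at this
    exact Option.some.inj this
  have hv1 : 1 ≤ supNorm v := by
    by_contra h
    have h0 := (supNorm_le_iff v 0).1 (by omega)
    exact hv0 (Prod.ext (by simp; omega) (by simp; omega))
  have key : supNorm (v - a.dir) = supNorm v + 1 ∧ onionArrow (v - a.dir) = a := by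
    have ho := @onionArrow_eq_of (v - a.dir)
    unfold Arrow.PointsTo at hab
    clear hv hz hf hb ha hx
    rw [hbv] at hab
    clear hbv
    have hv0' : v.1 ≠ 0 ∨ v.2 ≠ 0 := by
      by_contra h
      push Not at h
      exact hv0 (Prod.ext h.1 h.2)
    cases a <;> first | exact absurd rfl hne | skip
    all_goals
      simp only [Arrow.dir, Arrow.dx, Arrow.dy, Prod.fst_sub, Prod.snd_sub, supNorm] at *
      rcases onionArrow_cases v with ⟨e, h⟩ | ⟨e, h⟩ | ⟨e, h⟩ | ⟨e, h⟩ | ⟨e, h⟩ | ⟨e, h⟩ |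
        ⟨e, h⟩ | ⟨e, h⟩ | ⟨e, h⟩ <;> rw [e] at hab <;> simp at hab <;>
      first
        | (exfalso; clear ho; omega)
        | (refine ⟨by clear ho; omega, ?_⟩
           first
            | exact ho.1 (by clear ho; omega)
            | exact ho.2.1 (by clear ho; omega)
            | exact ho.2.2.1 (by clear ho; omega)
            | exact ho.2.2.2.1 (by clear ho; omega)
            | exact ho.2.2.2.2.1 (by clear ho; omega)
            | exact ho.2.2.2.2.2.1 (by clear ho; omega)
            | exact ho.2.2.2.2.2.2.1 (by clear ho; omega)
            | exact ho.2.2.2.2.2.2.2 (by clear ho; omega))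
  rw [key.1]
  refine hx.filled_succ hv1 hf key.1 ?_
  rw [key.2, show c + (v - a.dir) = z by rw [hv]; abel, ha]

/-- Following the arrows, a nonzero component `f` (which will be `dx` or `dy`) is kept until `⊥`
appears, and the coordinate `g` moves by one each time. Since `g` is bounded on the solid cells, `B
- f a * g z` bounds the number of steps left. -/
theorem Stable.exists_filled_of_functional {τ : TileSet T} {x : Cell → State T} (hx : Stable τ x)
    (f : Arrow → ℤ) (g : Cell → ℤ) (B : ℤ) (hfg : ∀ z a, g (z + a.dir) = g z + f a)
    (hf : ∀ a b : Arrow, a.PointsTo b → f a ≠ 0 → b = .bot ∨ f b = f a)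
    (hf1 : ∀ a, f a ≠ 0 → f a = 1 ∨ f a = -1) (hB : ∀ z, (x z).IsSolid → |g z| ≤ B) (n : ℕ) :
    ∀ z a, (x z).arrow = some a → f a ≠ 0 → a ≠ .bot → B - f a * g z ≤ n →
      ∃ c, Filled x c (supNorm (z - c)) := by
  induction n with
  | zero =>
    intro z a ha hfa hbot hn
    obtain h | ⟨b, hb, hab⟩ := hx.exists_pointsTo ha
    · exact absurd h hbot
    have h1 := hB _ (State.isSolid_of_arrow hb)
    rw [hfg, abs_le] at h1
    rcases hf1 a hfa with h | h <;> rw [h] at h1 hn <;> push_cast at hn <;> omega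
  | succ n ih =>
    intro z a ha hfa hbot hn
    obtain h | ⟨b, hb, hab⟩ := hx.exists_pointsTo ha
    · exact absurd h hbot
    suffices h : ∃ c, Filled x c (supNorm (z + a.dir - c)) from
      h.imp fun c hc => hx.filled_of_pointsTo ha hb hab hbot hc
    by_cases hb' : b = .bot
    · refine ⟨z + a.dir, ?_⟩
      rw [sub_self]
      intro u hu
      have h0 := (supNorm_le_iff u 0).1 hu
      obtain rfl : u = 0 := Prod.ext (by simp; omega) (by simp; omega)
      rw [add_zero, onionArrow_zero, hb, hb']
    · have hfb := (hf a b hab hfa).resolve_left hb'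
      refine ih _ b hb (hfb ▸ hfa) hb' ?_
      rw [hfb, hfg]
      rcases hf1 a hfa with h | h <;> rw [h] at hn ⊢ <;> push_cast at hn <;> omega

theorem Stable.exists_filled {τ : TileSet T} {x : Cell → State T} (hx : Stable τ x) {B : ℕ}
    (hB : ∀ z, (x z).IsSolid → supNorm z ≤ B) {z : Cell} (hz : (x z).IsSolid) :
    ∃ c, Filled x c (supNorm (z - c)) := by
  obtain ⟨a, ha⟩ := State.isSolid_iff.1 hz
  have hB' : ∀ z, (x z).IsSolid → |z.1| ≤ B ∧ |z.2| ≤ B := by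
    intro z hz
    have := (supNorm_le_iff z B).1 (hB z hz)
    rwa [abs_le, abs_le]
  by_cases hbot : a = .bot
  · refine ⟨z, ?_⟩
    rw [sub_self]
    intro u hu
    exact hx.filled_one (hbot ▸ ha) u (hu.trans (by decide))
  by_cases hdx : a.dx = 0
  · refine hx.exists_filled_of_functional (fun a => a.dy) (fun z => z.2) B (fun _ _ => rfl)
      (fun a b h => h.2) (fun a => by cases a <;> simp [Arrow.dy]) (fun z h => (hB' z h).2)
      (B - a.dy * z.2).toNat z a ha ?_ hbot (by omega)
    cases a <;> simp_all [Arrow.dx, Arrow.dy]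
  · exact hx.exists_filled_of_functional (fun a => a.dx) (fun z => z.1) B (fun _ _ => rfl)
      (fun a b h => h.1) (fun a => by cases a <;> simp [Arrow.dx]) (fun z h => (hB' z h).1)
      (B - a.dx * z.1).toNat z a ha hdx hbot (by omega)

/-! ### Different onions keep their distance -/

theorem supNorm_add_dir_onionArrow {u : Cell} (hu : u ≠ 0) :
    supNorm (u + (onionArrow u).dir) + 1 = supNorm u := by
  rcases onionArrow_cases u with ⟨e, h⟩ | ⟨e, h⟩ | ⟨e, h⟩ | ⟨e, h⟩ | ⟨e, h⟩ | ⟨e, h⟩ | ⟨e, h⟩ |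
    ⟨e, h⟩ | ⟨e, h⟩ <;> rw [e] <;>
  simp only [Arrow.dir, Arrow.dx, Arrow.dy, supNorm, Prod.fst_add, Prod.snd_add] <;>
  first
    | omega
    | exact absurd (Prod.ext h.1 h.2) hu

/-- The path along the arrows from a common cell stays in both squares and ends at the centre of
both. -/
theorem Filled.eq_of_mem {x : Cell → State T} {c c' : Cell} {k k' : ℕ} (h : Filled x c k)
    (h' : Filled x c' k') : ∀ {v : Cell}, supNorm (v - c) ≤ k → supNorm (v - c') ≤ k' → c = c' := by
  suffices H : ∀ n v, supNorm (v - c) = n → supNorm (v - c) ≤ k → supNorm (v - c') ≤ k' → c = c'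
    from fun {v} => H _ v rfl
  intro n
  induction n with
  | zero =>
    intro v hn h1 h2
    have h0 := (supNorm_le_iff (v - c) 0).1 hn.le
    have hv : v - c = 0 := Prod.ext (by simp at h0 ⊢; omega) (by simp at h0 ⊢; omega)
    have e := h _ h1
    have e' := h' _ h2
    rw [add_sub_cancel] at e e'
    rw [e, hv, onionArrow_zero] at e'
    have := onionArrow_eq_bot.1 (Option.some.inj e').symm
    exact (sub_eq_zero.1 hv).symm.trans (sub_eq_zero.1 this)
  | succ n ih =>
    intro v hn h1 h2
    have e := h _ h1
    have e' := h' _ h2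
    rw [add_sub_cancel] at e e'
    rw [e] at e'
    have e' := Option.some.inj e'
    have hv : v - c ≠ 0 := fun h => by rw [h] at hn; simp [supNorm] at hn
    have hv' : v - c' ≠ 0 := fun h => by
      rw [h, onionArrow_zero] at e'
      exact hv (onionArrow_eq_bot.1 e')
    have g := supNorm_add_dir_onionArrow hv
    have g' := supNorm_add_dir_onionArrow hv'
    rw [← e'] at g'
    rw [sub_add_eq_add_sub] at g g'
    exact ih (v + (onionArrow (v - c)).dir) (by omega) (by omega) (by omega)

section Allowed

variable {τ : TileSet T} {y : Cell → State T} {m : Cell}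

/-- By `shape`, the solid part of an allowed window is the intersection of two boxes. -/
theorem AllowedAt.isSolid_between (h : AllowedAt τ y m) {p q r : Cell} (hp : p ∈ window m)
    (hq : q ∈ window m) (hps : (y p).IsSolid) (hqs : (y q).IsSolid)
    (h1 : (p.1 ≤ r.1 ∧ r.1 ≤ q.1) ∨ (q.1 ≤ r.1 ∧ r.1 ≤ p.1))
    (h2 : (p.2 ≤ r.2 ∧ r.2 ≤ q.2) ∨ (q.2 ≤ r.2 ∧ r.2 ≤ p.2)) :
    r ∈ window m ∧ (y r).IsSolid := by
  obtain ⟨s, hs⟩ := h.shape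
  have hr : r ∈ window m := by
    rw [mem_window] at *
    omega
  refine ⟨hr, ?_⟩
  have e : ∀ v, v ∈ window m → ((y v).IsSolid ↔ supNorm (s + (v - m)) ≤ 1) := by
    intro v hv
    rw [← hs (v - m) hv, add_sub_cancel]
  rw [e _ hp] at hps
  rw [e _ hq] at hqs
  rw [e _ hr]
  simp only [supNorm_le_iff, Prod.fst_add, Prod.snd_add, Prod.fst_sub, Prod.snd_sub] at *
  omega

theorem AllowedAt.horAdj (h : AllowedAt τ y m) {r : Cell} {a b : Arrow} (h1 : r ∈ window m)
    (h2 : r + (1, 0) ∈ window m) (ha : (y r).arrow = some a)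
    (hb : (y (r + (1, 0))).arrow = some b) : HorAdj a b := by
  by_cases hr : m.2 ≤ r.2
  · obtain ⟨a', b', c, d, hB, ea, eb, -, -⟩ := h.arrows r h1 (by
      rw [mem_window] at *
      simp only [Prod.fst_add, Prod.snd_add] at *
      omega)
    rw [ea.eq ha, eb.eq hb] at hB
    exact ⟨c, d, Or.inl hB⟩
  · obtain ⟨a', b', c, d, hB, -, -, ea, eb⟩ := h.arrows (r + (0, 1)) (by
        rw [mem_window] at *
        simp only [Prod.fst_add, Prod.snd_add] at *
        omega) (by
      rw [mem_window] at *
      simp only [Prod.fst_add, Prod.snd_add] at *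
      omega)
    rw [add_assoc] at ea eb
    simp only [Prod.mk_add_mk, Int.reduceAdd] at ea eb
    rw [show r + (0, 0) = r from add_zero r] at ea
    rw [ea.eq ha, eb.eq hb] at hB
    exact ⟨a', b', Or.inr hB⟩

theorem AllowedAt.vertAdj (h : AllowedAt τ y m) {r : Cell} {a b : Arrow} (h1 : r ∈ window m)
    (h2 : r + (0, 1) ∈ window m) (ha : (y (r + (0, 1))).arrow = some a)
    (hb : (y r).arrow = some b) : VertAdj a b := by
  by_cases hr : r.1 ≤ m.1
  · obtain ⟨a', c, b', d, hB, ea, -, eb, -⟩ := h.arrows (r + (0, 1)) h2 (by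
      rw [mem_window] at *
      simp only [Prod.fst_add, Prod.snd_add] at *
      omega)
    rw [add_assoc] at eb
    simp only [Prod.mk_add_mk, Int.reduceAdd] at eb
    rw [show r + (0, 0) = r from add_zero r] at eb
    rw [ea.eq ha, eb.eq hb] at hB
    exact ⟨c, d, Or.inl hB⟩
  · obtain ⟨c, a', d, b', hB, -, ea, -, eb⟩ := h.arrows (r + (-1, 1)) (by
        rw [mem_window] at *
        simp only [Prod.fst_add, Prod.snd_add] at *
        omega) (by
      rw [mem_window] at *
      simp only [Prod.fst_add, Prod.snd_add] at *
      omega)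
    rw [add_assoc] at ea eb
    simp only [Prod.mk_add_mk, Int.reduceAdd] at ea eb
    rw [show r + (0, 0) = r from add_zero r] at eb
    rw [ea.eq ha, eb.eq hb] at hB
    exact ⟨c, d, Or.inr hB⟩

/-- A property of arrows that is inherited by solid neighbours in direction `e` passes from `p`
to the solid cell `p + n • e`. -/
theorem AllowedAt.propagate (h : AllowedAt τ y m) {P : Arrow → Prop} {e : Cell}
    (he : e = (1, 0) ∨ e = (-1, 0) ∨ e = (0, 1) ∨ e = (0, -1))
    (hP : ∀ r a b, r ∈ window m → r + e ∈ window m → (y r).arrow = some a →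
      (y (r + e)).arrow = some b → P a → P b) {p : Cell} {a : Arrow} (hp : p ∈ window m)
    (ha : (y p).arrow = some a) (hPa : P a) (n : ℕ) : ∀ b,
    p + (n : ℤ) • e ∈ window m → (y (p + (n : ℤ) • e)).arrow = some b → P b := by
  induction n with
  | zero =>
    intro b _ hb
    simp only [Nat.cast_zero, zero_smul, add_zero, ha] at hb
    exact Option.some.inj hb ▸ hPa
  | succ n ih =>
    intro b hw hb
    have e1 : p + ((n + 1 : ℕ) : ℤ) • e = p + (n : ℤ) • e + e := by
      push_cast
      rw [add_smul, one_smul, add_assoc]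
    obtain ⟨hw', hs'⟩ := h.isSolid_between (r := p + (n : ℤ) • e) hp hw
      (State.isSolid_of_arrow ha) (State.isSolid_of_arrow hb)
      (by rcases he with rfl | rfl | rfl | rfl <;> simp <;> omega)
      (by rcases he with rfl | rfl | rfl | rfl <;> simp <;> omega)
    obtain ⟨a', ha'⟩ := State.isSolid_iff.1 hs'
    rw [e1] at hw hb
    exact hP _ _ _ hw' hw ha' hb (ih _ hw' ha')

/-- Walk from `p` north to the row of `q`, then along that row to `q`, through solid cells only. The
southward component persists on the first leg, and on the second it can at most give way to a
horizontal arrow. -/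
theorem AllowedAt.not_facing_vertically (h : AllowedAt τ y m) {p q : Cell} {a b : Arrow}
    (hp : p ∈ window m) (hq : q ∈ window m) (ha : (y p).arrow = some a)
    (hb : (y q).arrow = some b) (hpq : p.2 ≤ q.2) (hda : a.dy = -1) : b.dy ≠ 1 := by
  obtain ⟨hw, hs⟩ := h.isSolid_between (r := (p.1, q.2)) hp hq (State.isSolid_of_arrow ha)
    (State.isSolid_of_arrow hb) (by simp; omega) (by simp; omega)
  obtain ⟨c, hc⟩ := State.isSolid_iff.1 hs
  have e1 : p + (((q.2 - p.2).toNat : ℕ) : ℤ) • ((0, 1) : Cell) = (p.1, q.2) := by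
    ext <;> simp
    omega
  have hdc : c.dy = -1 := by
    refine h.propagate (P := fun a => a.dy = -1) (e := (0, 1)) (by simp)
      (fun r a b h1 h2 h3 h4 => (h.vertAdj h1 h2 h4 h3).dy_of_dy) hp ha hda (q.2 - p.2).toNat c
      (e1 ▸ hw) (e1 ▸ hc)
  rcases le_total p.1 q.1 with hle | hle
  · have e2 : (p.1, q.2) + (((q.1 - p.1).toNat : ℕ) : ℤ) • ((1, 0) : Cell) = q := by
      ext <;> simp
      omega
    have := h.propagate (P := fun a => a.dy = -1 ∨ a = .left) (e := (1, 0)) (by simp)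
      (fun r a b h1 h2 h3 h4 => (h.horAdj h1 h2 h3 h4).east_of) hw hc (Or.inl hdc)
      (q.1 - p.1).toNat b (by rw [e2]; exact hq) (by rw [e2]; exact hb)
    rcases this with h | rfl
    · omega
    · decide
  · have e2 : (p.1, q.2) + (((p.1 - q.1).toNat : ℕ) : ℤ) • ((-1, 0) : Cell) = q := by
      ext <;> simp
      omega
    have hr0 : ∀ r : Cell, r + ((-1, 0) + (1, 0)) = r := fun r => add_zero r
    have := h.propagate (P := fun a => a.dy = -1 ∨ a = .right) (e := (-1, 0)) (by simp)
      (fun r a b h1 h2 h3 h4 => (h.horAdj (r := r + (-1, 0)) h2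
        (by rwa [add_assoc, hr0]) h4 (by rwa [add_assoc, hr0])).west_of) hw hc
      (Or.inl hdc) (p.1 - q.1).toNat b (by rw [e2]; exact hq) (by rw [e2]; exact hb)
    rcases this with h | rfl
    · omega
    · decide

theorem AllowedAt.not_facing_horizontally (h : AllowedAt τ y m) {p q : Cell} {a b : Arrow}
    (hp : p ∈ window m) (hq : q ∈ window m) (ha : (y p).arrow = some a)
    (hb : (y q).arrow = some b) (hpq : p.1 ≤ q.1) (hda : a.dx = -1) : b.dx ≠ 1 := by
  obtain ⟨hw, hs⟩ := h.isSolid_between (r := (q.1, p.2)) hp hq (State.isSolid_of_arrow ha)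
    (State.isSolid_of_arrow hb) (by simp; omega) (by simp; omega)
  obtain ⟨c, hc⟩ := State.isSolid_iff.1 hs
  have e1 : p + (((q.1 - p.1).toNat : ℕ) : ℤ) • ((1, 0) : Cell) = (q.1, p.2) := by
    ext <;> simp
    omega
  have hdc : c.dx = -1 := by
    refine h.propagate (P := fun a => a.dx = -1) (e := (1, 0)) (by simp)
      (fun r a b h1 h2 h3 h4 => (h.horAdj h1 h2 h3 h4).dx_of_dx) hp ha hda (q.1 - p.1).toNat c
      (e1 ▸ hw) (e1 ▸ hc)
  rcases le_total p.2 q.2 with hle | hle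
  · have e2 : (q.1, p.2) + (((q.2 - p.2).toNat : ℕ) : ℤ) • ((0, 1) : Cell) = q := by
      ext <;> simp
      omega
    have := h.propagate (P := fun a => a.dx = -1 ∨ a = .down) (e := (0, 1)) (by simp)
      (fun r a b h1 h2 h3 h4 => (h.vertAdj h1 h2 h4 h3).north_of) hw hc (Or.inl hdc)
      (q.2 - p.2).toNat b (by rw [e2]; exact hq) (by rw [e2]; exact hb)
    rcases this with h | rfl
    · omega
    · decide
  · have e2 : (q.1, p.2) + (((p.2 - q.2).toNat : ℕ) : ℤ) • ((0, -1) : Cell) = q := by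
      ext <;> simp
      omega
    have hr0 : ∀ r : Cell, r + ((0, -1) + (0, 1)) = r := fun r => add_zero r
    have := h.propagate (P := fun a => a.dx = -1 ∨ a = .up) (e := (0, -1)) (by simp)
      (fun r a b h1 h2 h3 h4 => (h.vertAdj (r := r + (0, -1)) h2
        (by rwa [add_assoc, hr0]) (by rwa [add_assoc, hr0]) h4).south_of) hw hc
      (Or.inl hdc) (p.2 - q.2).toNat b (by rw [e2]; exact hq) (by rw [e2]; exact hb)
    rcases this with h | rfl
    · omega
    · decide

end Allowed

theorem onionArrow_border {u : Cell} {k : ℕ} (hk : 1 ≤ k) (hu : supNorm u ≤ k) :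
    (u.1 = k → (onionArrow u).dx = -1) ∧ (u.1 = -k → (onionArrow u).dx = 1) ∧
    (u.2 = k → (onionArrow u).dy = -1) ∧ (u.2 = -k → (onionArrow u).dy = 1) := by
  rw [supNorm_le_iff] at hu
  rcases onionArrow_cases u with ⟨e, h⟩ | ⟨e, h⟩ | ⟨e, h⟩ | ⟨e, h⟩ | ⟨e, h⟩ | ⟨e, h⟩ | ⟨e, h⟩ |
    ⟨e, h⟩ | ⟨e, h⟩ <;> rw [e] <;> simp [Arrow.dx, Arrow.dy] <;> omega

theorem Filled.arrow {x : Cell → State T} {c : Cell} {k : ℕ} (h : Filled x c k) {v : Cell}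
    (hv : supNorm (v - c) ≤ k) : (x v).arrow = some (onionArrow (v - c)) := by
  simpa using h _ hv

/-- Otherwise project `v` to the northern side of the lower square and `v'` to the southern side of
the upper one. These cells are still at distance at most two and their arrows point away from each
other, so they form a forbidden pair. -/
theorem Stable.not_above {τ : TileSet T} {x : Cell → State T} (hx : Stable τ x) {c c' : Cell}
    {k k' : ℕ} (hk : 1 ≤ k) (hk' : 1 ≤ k') (h : Filled x c k) (h' : Filled x c' k') {v v' : Cell}
    (hv : supNorm (v - c) ≤ k) (hv' : supNorm (v' - c') ≤ k') (hvv : supNorm (v' - v) ≤ 2) :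
    ¬ c.2 + k < c'.2 - k' := by
  intro hlt
  simp only [supNorm_le_iff, Prod.fst_sub, Prod.snd_sub] at hv hv' hvv
  push_cast at hvv
  have hz : supNorm ((v.1, c.2 + k) - c) ≤ k := by simp [supNorm_le_iff]; omega
  have hw : supNorm ((v'.1, c'.2 - k') - c') ≤ k' := by simp [supNorm_le_iff]; omega
  have ez := h.arrow hz
  have ew := h'.arrow hw
  obtain ⟨m, y, hS, hy, hA⟩ := exists_allowedAt_of_not_eroded_pair (hx _ _ ez)
    (w := (v'.1, c'.2 - k') - (v.1, c.2 + k)) (fun h0 => by simp [Prod.ext_iff] at h0; omega)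
    (by simp [supNorm_le_iff]; omega)
  refine hA.not_facing_vertically hS.1 hS.2 (by rw [hy.1, add_zero]; exact ez)
    (by rw [hy.2, add_sub_cancel]; exact ew) (by simp; omega)
    ((onionArrow_border hk hz).2.2.1 (by simp)) ((onionArrow_border hk' hw).2.2.2 (by simp))

theorem Stable.not_east {τ : TileSet T} {x : Cell → State T} (hx : Stable τ x) {c c' : Cell}
    {k k' : ℕ} (hk : 1 ≤ k) (hk' : 1 ≤ k') (h : Filled x c k) (h' : Filled x c' k') {v v' : Cell}
    (hv : supNorm (v - c) ≤ k) (hv' : supNorm (v' - c') ≤ k') (hvv : supNorm (v' - v) ≤ 2) :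
    ¬ c.1 + k < c'.1 - k' := by
  intro hlt
  simp only [supNorm_le_iff, Prod.fst_sub, Prod.snd_sub] at hv hv' hvv
  push_cast at hvv
  have hz : supNorm ((c.1 + k, v.2) - c) ≤ k := by simp [supNorm_le_iff]; omega
  have hw : supNorm ((c'.1 - k', v'.2) - c') ≤ k' := by simp [supNorm_le_iff]; omega
  have ez := h.arrow hz
  have ew := h'.arrow hw
  obtain ⟨m, y, hS, hy, hA⟩ := exists_allowedAt_of_not_eroded_pair (hx _ _ ez)
    (w := (c'.1 - k', v'.2) - (c.1 + k, v.2)) (fun h0 => by simp [Prod.ext_iff] at h0; omega)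
    (by simp [supNorm_le_iff]; omega)
  refine hA.not_facing_horizontally hS.1 hS.2 (by rw [hy.1, add_zero]; exact ez)
    (by rw [hy.2, add_sub_cancel]; exact ew) (by simp; omega)
    ((onionArrow_border hk hz).1 (by simp)) ((onionArrow_border hk' hw).2.1 (by simp))

theorem supNorm_sub_comm (u v : Cell) : supNorm (u - v) = supNorm (v - u) := by
  simp only [supNorm, Prod.fst_sub, Prod.snd_sub]
  omega

theorem Stable.centre_eq {τ : TileSet T} {x : Cell → State T} (hx : Stable τ x) {c c' : Cell}
    {k k' : ℕ} (hk : 1 ≤ k) (hk' : 1 ≤ k') (h : Filled x c k) (h' : Filled x c' k') {v v' : Cell}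
    (hv : supNorm (v - c) ≤ k) (hv' : supNorm (v' - c') ≤ k') (hvv : supNorm (v' - v) ≤ 2) :
    c = c' := by
  have hvv' : supNorm (v - v') ≤ 2 := by rwa [supNorm_sub_comm]
  have h1 := hx.not_above hk hk' h h' hv hv' hvv
  have h2 := hx.not_above hk' hk h' h hv' hv hvv'
  have h3 := hx.not_east hk hk' h h' hv hv' hvv
  have h4 := hx.not_east hk' hk h' h hv' hv hvv'
  -- With no gap in either direction the squares overlap, and this is the south-western corner of
  -- the intersection.
  exact h.eq_of_mem h' (v := (max (c.1 - k) (c'.1 - k'), max (c.2 - k) (c'.2 - k')))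
    (by simp only [supNorm_le_iff, Prod.fst_sub, Prod.snd_sub]; omega)
    (by simp only [supNorm_le_iff, Prod.fst_sub, Prod.snd_sub]; omega)

/-- If no solid cell is eroded and the solid cells form a bounded set, they form separate
onions. -/
theorem Stable.settled {τ : TileSet T} {x : Cell → State T} (hx : Stable τ x) {B : ℕ}
    (hB : ∀ z, (x z).IsSolid → supNorm z ≤ B) : Settled τ x := by
  have hfill : ∀ z, (x z).IsSolid → ∃ c k, 1 ≤ k ∧ Filled x c k ∧ supNorm (z - c) ≤ k := by
    intro z hz
    obtain ⟨c, hc⟩ := hx.exists_filled hB hz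
    rcases Nat.eq_zero_or_pos (supNorm (z - c)) with h0 | h0
    · rw [h0] at hc
      have := hc 0 le_rfl
      rw [add_zero, onionArrow_zero] at this
      exact ⟨c, 1, le_rfl, hx.filled_one this, by omega⟩
    · exact ⟨c, _, h0, hc, le_rfl⟩
  refine ⟨hx.tilesFit, fun z hz => ?_⟩
  obtain ⟨c, k, hk, hf, hzc⟩ := hfill z hz
  -- The centre and the cell `j` columns east of it both lie in the ball of radius `B`. Hence a
  -- largest filled radius exists.
  have hbound : ∀ j, Filled x c j → j ≤ 2 * B := by
    intro j hj
    have h1 := (supNorm_le_iff _ _).1 (hB _ (State.isSolid_of_arrow (hj (j, 0) (by simp [supNorm]))))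
    have h2 := (supNorm_le_iff _ _).1 (hB _ (State.isSolid_of_arrow (hj 0 (by simp [supNorm]))))
    simp at h1 h2
    omega
  classical
  have hmax := Nat.findGreatest_spec (P := Filled x c) (hbound k hf) hf
  have hle : k ≤ Nat.findGreatest (Filled x c) (2 * B) := Nat.le_findGreatest (hbound k hf) hf
  refine ⟨c, _, ⟨hk.trans hle, hmax, fun u hu hu2 hs => ?_⟩, hzc.trans hle⟩
  obtain ⟨c', hc'⟩ := hx.exists_filled hB hs
  obtain ⟨k', hk', hf', hle', hk2⟩ : ∃ k', 1 ≤ k' ∧ Filled x c' k' ∧ supNorm (c + u - c') ≤ k' ∧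
      (k' = supNorm (c + u - c') ∨ c + u = c') := by
    rcases Nat.eq_zero_or_pos (supNorm (c + u - c')) with h0 | h0
    · have h00 := (supNorm_le_iff (c + u - c') 0).1 h0.le
      rw [h0] at hc'
      have := hc' 0 le_rfl
      rw [add_zero, onionArrow_zero] at this
      refine ⟨1, le_rfl, hx.filled_one this, by omega, Or.inr ?_⟩
      rw [← sub_eq_zero]
      exact Prod.ext (by simp at h00 ⊢; omega) (by simp at h00 ⊢; omega)
    · exact ⟨_, h0, hc', le_rfl, Or.inl rfl⟩
  generalize hK : Nat.findGreatest (Filled x c) (2 * B) = K at *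
  have hcc : c = c' := by
    -- A solid cell in the margin belongs to an onion too. Here `v` is the cell of the maximal
    -- square closest to it. The centres agree, and then the other onion contradicts maximality.
    refine hx.centre_eq (hk.trans hle) hk' hmax hf'
      (v := c + (max (-K : ℤ) (min u.1 K), max (-K : ℤ) (min u.2 K))) (v' := c + u) ?_ hle' ?_
    · simp only [supNorm_le_iff, Prod.fst_sub, Prod.snd_sub, Prod.fst_add, Prod.snd_add]
      omega
    · simp only [supNorm_le_iff, Prod.fst_sub, Prod.snd_sub, Prod.fst_add, Prod.snd_add] at *
      push_cast at *
      omega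
  subst hcc
  rw [add_sub_cancel_left] at hk2
  rcases hk2 with rfl | h0
  · have := Nat.le_findGreatest (hbound _ hf') hf'
    omega
  · rw [add_eq_left] at h0
    subst h0
    simp [supNorm] at hu

/-! ### One step of the automaton at a solid and at a liquid cell -/

theorem AllowedAt.shift {τ : TileSet T} {x : Cell → State T} {z m : Cell}
    (h : AllowedAt τ x (z + m)) : AllowedAt τ (fun u => x (z + u)) m := by
  have hw : ∀ p, p ∈ window m → z + p ∈ window (z + m) := by
    intro p hp
    rw [mem_window] at *
    simp only [Prod.fst_add, Prod.snd_add]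
    omega
  refine ⟨?_, fun p h1 h2 => ?_, fun p q a h1 h2 h3 h4 h5 => ?_, fun p s t h1 h2 h3 h4 => ?_,
    fun p s t h1 h2 h3 h4 => ?_⟩
  · simpa only [add_assoc] using h.shape
  · simpa only [add_assoc] using h.arrows (z + p) (hw p h1) (by rw [add_assoc]; exact hw _ h2)
  · simpa using h.border (z + p) (z + q) a (hw p h1) (hw q h2) (by simpa using h3) h4 h5
  · exact h.horizontal (z + p) s t (hw p h1) (by rw [add_assoc]; exact hw _ h2) h3
      (by rw [add_assoc]; exact h4)
  · exact h.vertical (z + p) s t (hw p h1) (by rw [add_assoc]; exact hw _ h2) h3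
      (by rw [add_assoc]; exact h4)

/-- An allowed window of `x` itself would complete the pattern: the central one contains the inside
region, and the one centred at `w` clamped to the central window contains both `0` and `w`. So at
solid cells `Eroded` alone decides. -/
theorem neighbourhoodForbidden_of_eroded {τ : TileSet T} {x : Cell → State T} {a : Arrow}
    (h : Eroded τ x a) : NeighbourhoodForbidden τ x := by
  rcases h with h | ⟨w, -, hw, h⟩
  · refine ⟨0, by decide, fun hA => h ⟨0, x, fun p hp => ?_, fun _ _ => rfl, hA⟩⟩
    simpa [window] using hp.1
  · rw [supNorm_le_iff] at hw
    push_cast at hw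
    refine ⟨(max (-1) (min w.1 1), max (-1) (min w.2 1)), ?_, fun hA =>
      h ⟨_, x, ?_, fun _ _ => rfl, hA⟩⟩
    · rw [supNorm_le_iff]
      push_cast
      omega
    · rintro p (rfl | rfl)
      · rw [mem_window]
        simp only [Prod.fst_zero, Prod.snd_zero]
        omega
      · rw [mem_window]
        omega

theorem localRule_of_solid {τ : TileSet T} {x : Cell → State T} {t : T} {a : Arrow}
    (h : x 0 = .solid t a) :
    (Eroded τ x a → localRule τ x = .zero) ∧ (¬ Eroded τ x a → localRule τ x = .solid t a) := by
  unfold localRule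
  rw [h]
  dsimp only
  split_ifs with hc
  · exact ⟨fun _ => rfl, fun h => absurd hc.2 h⟩
  · exact ⟨fun h => absurd ⟨neighbourhoodForbidden_of_eroded h, h⟩ hc, fun _ => rfl⟩

theorem localRule_of_liquid {τ : TileSet T} {x : Cell → State T} (h : (x 0).IsLiquid) :
    (localRule τ x).IsLiquid ∧
    (localRule τ x = .U ↔ ¬ NeighbourhoodForbidden τ x ∧ ∃ P ∈ upRules T, P.Matches x) ∧
    (localRule τ x = .D ↔ ¬ NeighbourhoodForbidden τ x ∧ (¬ ∃ P ∈ upRules T, P.Matches x) ∧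
      ∃ P ∈ downRules T, P.Matches x) := by
  unfold localRule
  match hx : x 0 with
  | .solid t a => exact absurd ⟨t, a, hx⟩ h
  | .U | .D | .zero =>
    dsimp only
    split_ifs with h1 h2 h3 <;> simp [State.IsLiquid, State.IsSolid, *]

/-- A rule producing `U` applies at `z`. -/
def UpAt (x : Cell → State T) (z : Cell) : Prop :=
  ∃ P ∈ upRules T, P.Matches fun u => x (z + u)

/-- A rule producing `D` applies at `z`. -/
def DownAt (x : Cell → State T) (z : Cell) : Prop :=
  ∃ P ∈ downRules T, P.Matches fun u => x (z + u)

section onionCA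

variable {τ : TileSet T} {x : Cell → State T} {z : Cell}

theorem onionCA_isLiquid (h : (x z).IsLiquid) : (onionCA τ x z).IsLiquid :=
  (localRule_of_liquid (τ := τ) (x := fun u => x (z + u)) (by simpa using h)).1

theorem onionCA_eq_of_isSolid (h : (onionCA τ x z).IsSolid) : onionCA τ x z = x z := by
  have hx : (x z).IsSolid := by
    by_contra hl
    exact onionCA_isLiquid (τ := τ) hl h
  obtain ⟨t, a, hta⟩ := hx
  have hr := localRule_of_solid (τ := τ) (x := fun u => x (z + u)) (by simpa using hta)
  change (localRule τ fun u => x (z + u)).IsSolid at h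
  change (localRule τ fun u => x (z + u)) = _
  by_cases he : Eroded τ (fun u => x (z + u)) a
  · rw [hr.1 he] at h
    simp [State.IsSolid] at h
  · rw [hr.2 he, hta]

theorem onionCA_eq_of_not_eroded {a : Arrow} (ha : (x z).arrow = some a)
    (h : ¬ Eroded τ (fun u => x (z + u)) a) : onionCA τ x z = x z := by
  match hx : x z with
  | .solid t b =>
    have hr := localRule_of_solid (τ := τ) (x := fun u => x (z + u)) (by simpa using hx)
    rw [hx] at ha
    obtain rfl : b = a := by simpa [State.arrow] using ha
    exact hr.2 h
  | .U | .D | .zero => simp [hx, State.arrow] at ha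

theorem stable_of_forall_isSolid (h : ∀ z, (x z).IsSolid → (onionCA τ x z).IsSolid) :
    Stable τ x := by
  intro z a ha he
  obtain ⟨t, b, hx⟩ := State.isSolid_of_arrow ha
  have hr := localRule_of_solid (τ := τ) (x := fun u => x (z + u)) (by simpa using hx)
  rw [hx] at ha
  obtain rfl : b = a := by simpa [State.arrow] using ha
  have := h z ⟨t, b, hx⟩
  change (localRule τ fun u => x (z + u)).IsSolid at this
  rw [hr.1 he] at this
  simp [State.IsSolid] at this

theorem not_neighbourhoodForbidden (h : ∀ m, supNorm (m - z) ≤ 1 → AllowedAt τ x m) :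
    ¬ NeighbourhoodForbidden τ fun u => x (z + u) := by
  rintro ⟨m, hm, hA⟩
  exact hA (AllowedAt.shift (h _ (by simpa using hm)))

theorem onionCA_eq_of_allowedAt (h : ∀ m, supNorm (m - z) ≤ 1 → AllowedAt τ x m)
    (hz : (x z).IsSolid) : onionCA τ x z = x z := by
  obtain ⟨a, ha⟩ := State.isSolid_iff.1 hz
  exact onionCA_eq_of_not_eroded ha
    fun he => not_neighbourhoodForbidden h (neighbourhoodForbidden_of_eroded he)

theorem State.isLiquid_of_eq_U {s : State T} (h : s = .U) : s.IsLiquid := by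
  rintro ⟨t, a, h'⟩
  rw [h] at h'
  cases h'

theorem State.isLiquid_of_eq_D {s : State T} (h : s = .D) : s.IsLiquid := by
  rintro ⟨t, a, h'⟩
  rw [h] at h'
  cases h'

theorem State.isLiquid_of_eq_zero {s : State T} (h : s = .zero) : s.IsLiquid := by
  rintro ⟨t, a, h'⟩
  rw [h] at h'
  cases h'

theorem State.eq_zero_of_isLiquid {s : State T} (h : s.IsLiquid) (hU : s ≠ .U) (hD : s ≠ .D) :
    s = .zero := by
  cases s <;> simp_all [State.IsLiquid, State.IsSolid]

theorem zero_of_matches {P : RulePattern T} {x : Cell → State T} (h : P.Matches x) :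
    x 0 ∈ P 1 1 := by
  exact h 1 1

theorem upAt_centre (h : UpAt x z) : x z = .zero := by
  obtain ⟨P, hP, hm⟩ := h
  have := zero_of_matches hm
  rw [add_zero] at this
  simp only [upRules, List.mem_cons, List.not_mem_nil, or_false] at hP
  rcases hP with rfl | rfl | rfl | rfl | rfl | rfl | rfl <;> simpa using this

theorem downAt_centre (h : DownAt x z) : x z = .zero := by
  obtain ⟨P, hP, hm⟩ := h
  have := zero_of_matches hm
  rw [add_zero] at this
  simp only [downRules, List.mem_cons, List.not_mem_nil, or_false] at hP
  rcases hP with rfl | rfl | rfl | rfl | rfl | rfl | rfl <;> simpa using this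

theorem upAt_of_onionCA (h : onionCA τ x z = .U) (hz : (x z).IsLiquid) : UpAt x z :=
  ((localRule_of_liquid (τ := τ) (x := fun u => x (z + u)) (by simpa using hz)).2.1.1 h).2

theorem downAt_of_onionCA (h : onionCA τ x z = .D) (hz : (x z).IsLiquid) : DownAt x z :=
  ((localRule_of_liquid (τ := τ) (x := fun u => x (z + u)) (by simpa using hz)).2.2.1 h).2.2

theorem onionCA_eq_U (h : ∀ m, supNorm (m - z) ≤ 1 → AllowedAt τ x m) (hU : UpAt x z) :
    onionCA τ x z = .U :=
  (localRule_of_liquid (τ := τ) (x := fun u => x (z + u)) (by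
    simpa using State.isLiquid_of_eq_zero (upAt_centre hU))).2.1.2
    ⟨not_neighbourhoodForbidden h, hU⟩

theorem onionCA_eq_D (h : ∀ m, supNorm (m - z) ≤ 1 → AllowedAt τ x m) (hU : ¬ UpAt x z)
    (hD : DownAt x z) : onionCA τ x z = .D :=
  (localRule_of_liquid (τ := τ) (x := fun u => x (z + u)) (by
    simpa using State.isLiquid_of_eq_zero (downAt_centre hD))).2.2.2
    ⟨not_neighbourhoodForbidden h, hU, hD⟩

end onionCA

/-! ### Moves of single particles, and the symmetry between `U` and `D` -/

/-- The mirror image of a configuration in the horizontal axis, with `U` and `D` exchanged. -/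
def State.flip : State T → State T
  | .U => .D
  | .D => .U
  | .zero => .zero
  | .solid t a => .solid t a

/-- Arrows and tiles need no reflection, because the movement rules only ask whether a cell is
solid. -/
def mirror (x : Cell → State T) : Cell → State T := fun u => (x (u.1, -u.2)).flip

theorem State.flip_isSolid {s : State T} : s.flip.IsSolid ↔ s.IsSolid := by
  cases s <;> simp [State.flip, State.IsSolid]

theorem State.flip_eq {s : State T} : (s.flip = .U ↔ s = .D) ∧ (s.flip = .D ↔ s = .U) ∧
    (s.flip = .zero ↔ s = .zero) := by
  cases s <;> simp [State.flip]

/-- Spelling out the rules that produce `U`. -/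
theorem upAt_iff {x : Cell → State T} {i j : ℤ} : UpAt x (i, j) ↔
    x (i, j) = .zero ∧
    (((x (i - 1, j + 1) = .zero ∨ (x (i - 1, j + 1)).IsSolid) ∧ x (i, j + 1) = .zero ∧
      x (i + 1, j + 1) = .zero ∧ (x (i - 1, j)).IsSolid ∧ x (i + 1, j) = .zero ∧
      (x (i - 1, j - 1)).IsSolid ∧ x (i, j - 1) = .U ∧ x (i + 1, j - 1) = .zero) ∨
    (x (i - 1, j + 1) = .zero ∧ x (i, j + 1) = .zero ∧ x (i + 1, j + 1) = .zero ∧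
      x (i - 1, j) = .zero ∧ x (i + 1, j) = .zero ∧
      (x (i - 1, j - 1)).IsSolid ∧ x (i, j - 1) = .U ∧ x (i + 1, j - 1) = .zero) ∨
    (x (i - 1, j + 1) = .zero ∧ x (i, j + 1) = .zero ∧ x (i + 1, j + 1) = .zero ∧
      x (i - 1, j) = .zero ∧ x (i + 1, j) = .U ∧
      (x (i - 1, j - 1)).IsSolid ∧ (x (i, j - 1)).IsSolid ∧ (x (i + 1, j - 1) = .zero ∨
        x (i + 1, j - 1) = .D ∨ (x (i + 1, j - 1)).IsSolid)) ∨
    (x (i - 1, j + 1) = .zero ∧ x (i, j + 1) = .zero ∧ x (i + 1, j + 1) = .zero ∧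
      x (i - 1, j) = .zero ∧ x (i + 1, j) = .U ∧
      x (i - 1, j - 1) = .zero ∧ (x (i, j - 1) = .zero ∨ (x (i, j - 1)).IsSolid) ∧
      (x (i + 1, j - 1)).IsSolid) ∨
    (x (i - 1, j + 1) = .zero ∧ x (i, j + 1) = .U ∧
      (x (i + 1, j + 1) = .zero ∨ (x (i + 1, j + 1)).IsSolid) ∧
      x (i - 1, j) = .zero ∧ (x (i + 1, j)).IsSolid ∧
      x (i - 1, j - 1) = .zero ∧ x (i, j - 1) = .zero ∧ (x (i + 1, j - 1)).IsSolid) ∨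
    (x (i - 1, j + 1) = .zero ∧ x (i, j + 1) = .U ∧ (x (i + 1, j + 1)).IsSolid ∧
      x (i - 1, j) = .zero ∧ (x (i + 1, j)).IsSolid ∧
      x (i - 1, j - 1) = .zero ∧ x (i, j - 1) = .zero ∧ x (i + 1, j - 1) = .D) ∨
    ((x (i - 1, j + 1) = .zero ∨ (x (i - 1, j + 1)).IsSolid) ∧
      (x (i, j + 1) = .zero ∨ (x (i, j + 1)).IsSolid) ∧
      (x (i + 1, j + 1) = .zero ∨ (x (i + 1, j + 1)).IsSolid) ∧
      (x (i - 1, j) = .zero ∨ (x (i - 1, j)).IsSolid) ∧ x (i + 1, j) = .U ∧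
      (x (i - 1, j - 1) = .zero ∨ (x (i - 1, j - 1)).IsSolid) ∧
      (x (i, j - 1) = .zero ∨ (x (i, j - 1)).IsSolid) ∧ x (i + 1, j - 1) = .D)) := by
  simp only [UpAt, upRules, RulePattern.Matches, List.mem_cons, List.not_mem_nil, or_false,
    exists_eq_or_imp, exists_eq_left, Fin.forall_fin_succ, Fin.forall_fin_zero]
  simp [← sub_eq_add_neg]
  constructor
  · rintro (h | h | h | h | h | h | h) <;> simp [h, or_comm, or_left_comm, or_assoc]
    tauto
  · rintro ⟨h0, h | h | h | h | h | h | h⟩ <;> simp [h0, h, or_comm, or_left_comm]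
    tauto

/-- The rules for `D` are the mirror images of those for `U`, so every statement about `U` yields
one about `D`. -/
theorem downAt_iff {x : Cell → State T} {i j : ℤ} : DownAt x (i, j) ↔ UpAt (mirror x) (i, -j) := by
  have hc : ∀ a b : ℤ, mirror x (a, b) = (x (a, -b)).flip := fun _ _ => rfl
  have e1 : -(-j + 1) = j - 1 := by ring
  have e2 : -(-j - 1) = j + 1 := by ring
  rw [upAt_iff]
  simp only [hc, e1, e2, neg_neg, State.flip_eq, State.flip_isSolid]
  simp only [DownAt, downRules, RulePattern.Matches, List.mem_cons, List.not_mem_nil, or_false,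
    exists_eq_or_imp, exists_eq_left, Fin.forall_fin_succ, Fin.forall_fin_zero]
  simp [← sub_eq_add_neg]
  constructor
  · rintro (h | h | h | h | h | h | h) <;> simp [h, or_comm, or_left_comm, or_assoc]
    tauto
  · rintro ⟨h0, h | h | h | h | h | h | h⟩ <;> simp [h0, h, or_comm, or_left_comm]
    tauto

/-- The particle `U` at `(a, b)` may move to `v`: conditions that exclude each other for different
cells `v`. -/
def UpMove (x : Cell → State T) (p v : Cell) : Prop :=
  x p = .U ∧ x v = .zero ∧
  ((v = (p.1, p.2 + 1) ∧ (x (p.1 - 1, p.2)).IsSolid) ∨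
   (v = (p.1 - 1, p.2) ∧ ((x (p.1 - 1, p.2 - 1)).IsSolid ∨ (x (p.1, p.2 - 1)).IsSolid ∨
      x (p.1, p.2 - 1) = .D)) ∨
   (v = (p.1, p.2 - 1) ∧ x (p.1 - 1, p.2) = .zero ∧ x (p.1 - 1, p.2 - 1) = .zero ∧
      (x (p.1 + 1, p.2 - 1)).IsSolid))

/-- Each rule shows exactly one `U`, the one that moves in: north along an eastern side, west, or
south along a western side. -/
theorem UpAt.exists_upMove {x : Cell → State T} {v : Cell} (h : UpAt x v) :
    ∃ p, UpMove x p v := by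
  obtain ⟨i, j⟩ := v
  rw [upAt_iff] at h
  obtain ⟨h0, h | h | h | h | h | h | h⟩ := h
  · exact ⟨(i, j - 1), h.2.2.2.2.2.2.1, h0, Or.inl ⟨by simp, h.2.2.2.2.2.1⟩⟩
  · exact ⟨(i, j - 1), h.2.2.2.2.2.2.1, h0, Or.inl ⟨by simp, h.2.2.2.2.2.1⟩⟩
  · exact ⟨(i + 1, j), h.2.2.2.2.1, h0, Or.inr (Or.inl ⟨by simp, Or.inl (by simpa using
      h.2.2.2.2.2.2.1)⟩)⟩
  · exact ⟨(i + 1, j), h.2.2.2.2.1, h0, Or.inr (Or.inl ⟨by simp, Or.inr (Or.inl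
      h.2.2.2.2.2.2.2)⟩)⟩
  · exact ⟨(i, j + 1), h.2.1, h0, Or.inr (Or.inr ⟨by simp, h.1, by simpa using h.2.2.2.1,
      by simpa using h.2.2.2.2.1⟩)⟩
  · exact ⟨(i, j + 1), h.2.1, h0, Or.inr (Or.inr ⟨by simp, h.1, by simpa using h.2.2.2.1,
      by simpa using h.2.2.2.2.1⟩)⟩
  · exact ⟨(i + 1, j), h.2.2.2.2.1, h0, Or.inr (Or.inl ⟨by simp, Or.inr (Or.inr
      h.2.2.2.2.2.2.2)⟩)⟩

theorem State.IsSolid.ne_zero {s : State T} (h : s.IsSolid) : s ≠ .zero :=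
  fun h0 => State.isLiquid_of_eq_zero h0 h

/-- Particles do not split, so one `U` leaves at most one `U` behind. -/
theorem UpMove.unique {x : Cell → State T} {p v v' : Cell} (h : UpMove x p v)
    (h' : UpMove x p v') : v = v' := by
  obtain ⟨-, hv, h⟩ := h
  obtain ⟨-, hv', h'⟩ := h'
  have key : ∀ {v v' : Cell}, x v = .zero → x v' = .zero →
      (v = (p.1 - 1, p.2) ∧ ((x (p.1 - 1, p.2 - 1)).IsSolid ∨ (x (p.1, p.2 - 1)).IsSolid ∨
      x (p.1, p.2 - 1) = .D)) → (v' = (p.1, p.2 - 1) ∧ x (p.1 - 1, p.2) = .zero ∧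
      x (p.1 - 1, p.2 - 1) = .zero ∧ (x (p.1 + 1, p.2 - 1)).IsSolid) → False := by
    rintro v v' - h0 ⟨rfl, h⟩ ⟨rfl, h1, h2, h3⟩
    rcases h with h | h | h
    · exact h.ne_zero h2
    · exact h.ne_zero h0
    · rw [h] at h0
      cases h0
  rcases h with h | h | h <;> rcases h' with h' | h' | h'
  · exact h.1.trans h'.1.symm
  · rw [h'.1] at hv'
    exact absurd hv' h.2.ne_zero
  · exact absurd h'.2.1 h.2.ne_zero
  · rw [h.1] at hv
    exact absurd hv h'.2.ne_zero
  · exact h.1.trans h'.1.symm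
  · exact (key hv hv' h h').elim
  · exact absurd h.2.1 h'.2.ne_zero
  · exact (key hv' hv h' h).elim
  · exact h.1.trans h'.1.symm

theorem UpMove.fst_le {x : Cell → State T} {p v : Cell} (h : UpMove x p v) : v.1 ≤ p.1 := by
  obtain ⟨-, -, ⟨rfl, -⟩ | ⟨rfl, -⟩ | ⟨rfl, -⟩⟩ := h <;> simp

theorem upAt_of_onionCA_eq_U {τ : TileSet T} {x : Cell → State T} {z : Cell}
    (h : onionCA τ x z = .U) : UpAt x z := by
  refine upAt_of_onionCA h ?_
  intro hs
  obtain ⟨t, b, hx⟩ := hs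
  have hr := localRule_of_solid (τ := τ) (x := fun u => x (z + u)) (by simpa using hx)
  change (localRule τ fun u => x (z + u)) = .U at h
  by_cases he : Eroded τ (fun u => x (z + u)) b
  · rw [hr.1 he] at h
    cases h
  · rw [hr.2 he] at h
    cases h

theorem downAt_of_onionCA_eq_D {τ : TileSet T} {x : Cell → State T} {z : Cell}
    (h : onionCA τ x z = .D) : DownAt x z := by
  refine downAt_of_onionCA h ?_
  intro hs
  obtain ⟨t, b, hx⟩ := hs
  have hr := localRule_of_solid (τ := τ) (x := fun u => x (z + u)) (by simpa using hx)
  change (localRule τ fun u => x (z + u)) = .D at h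
  by_cases he : Eroded τ (fun u => x (z + u)) b
  · rw [hr.1 he] at h
    cases h
  · rw [hr.2 he] at h
    cases h

/-- The mirror image of a cell. -/
def Cell.flip (u : Cell) : Cell := (u.1, -u.2)

theorem Cell.flip_flip (u : Cell) : Cell.flip (Cell.flip u) = u := by simp [Cell.flip]

theorem Cell.flip_inj {u v : Cell} : Cell.flip u = Cell.flip v ↔ u = v := by
  simp [Cell.flip, Prod.ext_iff]

theorem mirror_apply (x : Cell → State T) (u : Cell) : mirror x u = (x (Cell.flip u)).flip := rfl

theorem downAt_iff_mirror {x : Cell → State T} {v : Cell} :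
    DownAt x v ↔ UpAt (mirror x) (Cell.flip v) := downAt_iff

/-- The free movement of a pair of particles. -/
theorem upAt_of_pair {x : Cell → State T} {i j : ℤ} (h0 : x (i, j) = .zero)
    (hU : x (i + 1, j) = .U) (hD : x (i + 1, j - 1) = .D)
    (h1 : x (i, j - 1) = .zero) (h : ∀ a b, (i - 1 ≤ a ∧ a ≤ i + 1) → (j - 1 ≤ b ∧ b ≤ j + 1) →
      (a, b) ≠ (i + 1, j) → (a, b) ≠ (i + 1, j - 1) → x (a, b) = .zero ∨ (x (a, b)).IsSolid) :
    UpAt x (i, j) := by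
  rw [upAt_iff]
  refine ⟨h0, Or.inr (Or.inr (Or.inr (Or.inr (Or.inr (Or.inr
    ⟨h _ _ ?_ ?_ ?_ ?_, h _ _ ?_ ?_ ?_ ?_, h _ _ ?_ ?_ ?_ ?_, h _ _ ?_ ?_ ?_ ?_, hU,
      h _ _ ?_ ?_ ?_ ?_, Or.inl h1, hD⟩)))))⟩ <;>
  simp <;> omega

/-! ### Configurations with a single pair of particles -/

/-- The only particles of `x` in the columns from `L` on are `U` at `p` and `D` at `q`. -/
def ParticlesAt (x : Cell → State T) (L : ℤ) (p q : Cell) : Prop :=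
  ∀ a : Cell, L ≤ a.1 → (x a = .U ↔ a = p) ∧ (x a = .D ↔ a = q)

/-- There are no particles in the columns from `L` on. -/
def VacantFrom (x : Cell → State T) (L : ℤ) : Prop :=
  ∀ a : Cell, L ≤ a.1 → x a ≠ .U ∧ x a ≠ .D

theorem particlesAt_mirror {x : Cell → State T} {L : ℤ} {p q : Cell} (h : ParticlesAt x L p q) :
    ParticlesAt (mirror x) L (Cell.flip q) (Cell.flip p) := by
  intro a ha
  rw [mirror_apply, State.flip_eq.1, State.flip_eq.2.1, (h (Cell.flip a) ha).1,
    (h (Cell.flip a) ha).2, ← Cell.flip_inj, Cell.flip_flip, ← Cell.flip_inj (u := Cell.flip a),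
    Cell.flip_flip]
  exact ⟨Iff.rfl, Iff.rfl⟩

theorem ParticlesAt.eq_of_upAt {x : Cell → State T} {L : ℤ} {p q v w : Cell}
    (h : ParticlesAt x L p q) (hv : UpAt x v) (hw : UpAt x w) (hvL : L ≤ v.1) (hwL : L ≤ w.1) :
    v = w := by
  obtain ⟨p₁, h₁⟩ := hv.exists_upMove
  obtain ⟨p₂, h₂⟩ := hw.exists_upMove
  obtain rfl := ((h p₁ (hvL.trans h₁.fst_le)).1.1 h₁.1)
  obtain rfl := ((h p₂ (hwL.trans h₂.fst_le)).1.1 h₂.1)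
  exact h₁.unique h₂

theorem ParticlesAt.eq_of_downAt {x : Cell → State T} {L : ℤ} {p q v w : Cell}
    (h : ParticlesAt x L p q) (hv : DownAt x v) (hw : DownAt x w) (hvL : L ≤ v.1)
    (hwL : L ≤ w.1) : v = w :=
  Cell.flip_inj.1 ((particlesAt_mirror h).eq_of_upAt (downAt_iff_mirror.1 hv)
    (downAt_iff_mirror.1 hw) hvL hwL)

/-- It suffices to find one place for each particle: moves are unique and nothing enters from the
west. The places must differ since the rules for `U` take precedence. -/
theorem ParticlesAt.step {τ : TileSet T} {x : Cell → State T} {L : ℤ} {p q v w : Cell}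
    (h : ParticlesAt x L p q) (hA : ∀ m : Cell, L - 1 ≤ m.1 → AllowedAt τ x m) (hv : UpAt x v)
    (hw : DownAt x w) (hvL : L ≤ v.1) (hwL : L ≤ w.1) (hvw : v ≠ w) :
    ParticlesAt (onionCA τ x) L v w := by
  have hA' : ∀ a : Cell, L ≤ a.1 → ∀ m, supNorm (m - a) ≤ 1 → AllowedAt τ x m := by
    intro a ha m hm
    simp only [supNorm_le_iff, Prod.fst_sub, Prod.snd_sub] at hm
    exact hA m (by omega)
  refine fun a ha => ⟨⟨fun hU => ?_, ?_⟩, ⟨fun hD => ?_, ?_⟩⟩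
  · exact h.eq_of_upAt (upAt_of_onionCA_eq_U hU) hv ha hvL
  · rintro rfl
    exact onionCA_eq_U (hA' _ ha) hv
  · exact h.eq_of_downAt (downAt_of_onionCA_eq_D hD) hw ha hwL
  · rintro rfl
    exact onionCA_eq_D (hA' _ ha) (fun hU => hvw (h.eq_of_upAt hv hU hvL ha)) hw

theorem VacantFrom.step {τ : TileSet T} {x : Cell → State T} {L : ℤ} (h : VacantFrom x L) :
    VacantFrom (onionCA τ x) L := by
  refine fun a ha => ⟨fun hU => ?_, fun hD => ?_⟩
  · obtain ⟨p, hp⟩ := (upAt_of_onionCA_eq_U hU).exists_upMove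
    exact (h p (ha.trans hp.fst_le)).1 hp.1
  · obtain ⟨p, hp⟩ := (downAt_iff_mirror.1 (downAt_of_onionCA_eq_D hD)).exists_upMove
    have h1 := hp.1
    rw [mirror_apply, State.flip_eq.1] at h1
    exact (h (Cell.flip p) (le_trans (b := p.1) (ha.trans hp.fst_le) le_rfl)).2 h1

/-- The configuration `x` with a pair of particles added. -/
def addPair (x : Cell → State T) (i j : ℤ) : Cell → State T := fun a =>
  if a = (i, j) then .U else if a = (i, j - 1) then .D else x a

theorem particlesAt_addPair {x : Cell → State T} {L i j : ℤ} (h : VacantFrom x L) :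
    ParticlesAt (addPair x i j) L (i, j) (i, j - 1) := by
  intro a ha
  have := h a ha
  unfold addPair
  split_ifs with h1 h2
  · simp [h1]
    omega
  · simp [h2]
  · simp [h1, h2, this]

theorem addPair_eq {x : Cell → State T} {i j : ℤ} {a : Cell} (h : a.1 ≠ i) :
    addPair x i j a = x a := by
  unfold addPair
  rw [if_neg, if_neg] <;> rintro rfl <;> exact h rfl

theorem addPair_U (x : Cell → State T) (i j : ℤ) : addPair x i j (i, j) = .U := by
  simp [addPair]

theorem addPair_D (x : Cell → State T) (i j : ℤ) : addPair x i j (i, j - 1) = .D := by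
  simp [addPair]

/-- No stability is assumed: whatever still happens in the west, a pair in the empty half-plane
advances without influencing it. -/
theorem onionCA_addPair {τ : TileSet T} {x : Cell → State T} {B i j : ℤ}
    (h : ∀ a : Cell, B ≤ a.1 → x a = .zero) (hi : B + 3 ≤ i) :
    onionCA τ (addPair x (i + 1) j) = addPair (onionCA τ x) i j := by
  have hvac : VacantFrom x (B + 2) := fun a ha => by simp [h a (by omega)]
  have hliq : ∀ a : Cell, B ≤ a.1 → (addPair x (i + 1) j a).IsLiquid := by
    intro a ha
    unfold addPair
    split_ifs
    · exact State.isLiquid_of_eq_U rfl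
    · exact State.isLiquid_of_eq_D rfl
    · exact State.isLiquid_of_eq_zero (h a ha)
  have hpart := particlesAt_addPair (i := i + 1) (j := j) hvac
  have hA : ∀ m : Cell, B + 2 - 1 ≤ m.1 → AllowedAt τ (addPair x (i + 1) j) m := by
    intro m hm
    refine allowedAt_of_liquid τ fun p hp => hliq p ?_
    rw [mem_window] at hp
    omega
  have hz : ∀ a b, B ≤ a → (a, b) ≠ (i + 1, j) → (a, b) ≠ (i + 1, j - 1) →
      addPair x (i + 1) j (a, b) = .zero := by
    intro a b ha h1 h2
    unfold addPair
    rw [if_neg h1, if_neg h2, h _ ha]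
  have hv : UpAt (addPair x (i + 1) j) (i, j) :=
    upAt_of_pair (hz _ _ (by omega) (by simp) (by simp)) (addPair_U _ _ _) (addPair_D _ _ _)
      (hz _ _ (by omega) (by simp) (by simp)) fun a b h1 h2 h3 h4 =>
      Or.inl (hz _ _ (by omega) h3 h4)
  have hw : DownAt (addPair x (i + 1) j) (i, j - 1) := by
    rw [downAt_iff_mirror]
    have hz' : ∀ a b, B ≤ a → (a, b) ≠ (i + 1, -(j - 1)) → (a, b) ≠ (i + 1, -(j - 1) - 1) →
        mirror (addPair x (i + 1) j) (a, b) = .zero := by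
      intro a b ha h1 h2
      rw [mirror_apply, State.flip_eq.2.2]
      refine hz _ _ ha ?_ ?_ <;> simp at h1 h2 ⊢ <;> omega
    refine upAt_of_pair (hz' _ _ (by omega) (by simp) (by simp)) ?_ ?_
      (hz' _ _ (by omega) (by simp) (by simp)) fun a b h1 h2 h3 h4 =>
      Or.inl (hz' _ _ (by omega) h3 h4)
    · rw [mirror_apply, State.flip_eq.1]
      simp [Cell.flip, addPair]
    · rw [mirror_apply, State.flip_eq.2.1]
      simp [Cell.flip, addPair]
  have hstep := hpart.step hA hv hw (by dsimp; omega) (by dsimp; omega) (by simp; omega)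
  have hvac' : VacantFrom (onionCA τ x) (B + 2) := hvac.step
  have hpart' := particlesAt_addPair (i := i) (j := j) hvac'
  funext a
  by_cases ha : B + 2 ≤ a.1
  · have h1 := hstep a ha
    have h2 := hpart' a ha
    have l1 : (onionCA τ (addPair x (i + 1) j) a).IsLiquid :=
      onionCA_isLiquid (hliq a (by omega))
    have l2 : (addPair (onionCA τ x) i j a).IsLiquid := by
      unfold addPair
      split_ifs
      · exact State.isLiquid_of_eq_U rfl
      · exact State.isLiquid_of_eq_D rfl
      · exact onionCA_isLiquid (State.isLiquid_of_eq_zero (h a (by omega)))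
    by_cases c1 : a = (i, j)
    · rw [h1.1.2 c1, h2.1.2 c1]
    by_cases c2 : a = (i, j - 1)
    · rw [h1.2.2 c2, h2.2.2 c2]
    rw [State.eq_zero_of_isLiquid l1 (mt h1.1.1 c1) (mt h1.2.1 c2),
      State.eq_zero_of_isLiquid l2 (mt h2.1.1 c1) (mt h2.2.1 c2)]
  -- Columns west of `B + 2` do not yet see the pair, which stands at `i + 1 ≥ B + 4`, beyond the
  -- radius 2 of the rule.
  · rw [addPair_eq (by omega)]
    refine localRule_congr τ fun u hu => ?_
    rw [supNorm_le_iff] at hu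
    push_cast at hu
    exact addPair_eq (by simp only [Prod.fst_add]; omega)

/-! ### Erosion ends and the particles disappear to the west -/

/-- Over a fixed set of solid cells that is bounded in the vertical direction, a column is
eventually left by the particles `U`, if none comes in from the east. -/
theorem exists_column_vacant {y : ℕ → Cell → State T} {sol : Cell → Prop} {B : ℕ}
    (hB : ∀ v, sol v → |v.2| ≤ B) (hsol : ∀ n v, (y n v).IsSolid ↔ sol v)
    (hstep : ∀ n v, y (n + 1) v = .U → ∃ p, UpMove (y n) p v) {c : ℤ}
    (hc : ∀ n (v : Cell), c + 1 ≤ v.1 → y n v ≠ .U) :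
    ∃ N, ∀ n, N ≤ n → ∀ v : Cell, c ≤ v.1 → y n v ≠ .U := by
  have hz : ∀ {n v}, y n v = .zero → ¬ sol v := fun h hs =>
    State.isLiquid_of_eq_zero h ((hsol _ _).2 hs)
  -- A `U` that is in column `c` at time `n` has been there all the time, climbing along solid cells
  -- to its west or descending along solid cells to its east. It cannot turn round: climbing needs a
  -- solid cell to the west, descending needs the western cells free. So a long stay requires a long
  -- column of solid cells.
  have key : ∀ n b, y n (c, b) = .U →
      (∀ j : ℕ, 1 ≤ j → j ≤ n → sol (c - 1, b - j)) ∨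
      ((∀ j : ℕ, j < n → sol (c + 1, b + j)) ∧ ¬ sol (c - 1, b)) := by
    intro n
    induction n with
    | zero => exact fun b _ => Or.inl fun j h1 h2 => by omega
    | succ n ih =>
      intro b hb
      obtain ⟨⟨p1, p2⟩, hp, hv, h | h | h⟩ := hstep n _ hb <;>
      simp only [Prod.mk.injEq] at h
      · obtain ⟨⟨rfl, rfl⟩, h⟩ := h
        rw [hsol] at h
        left
        have h' := (ih _ hp).resolve_right fun h' => h'.2 h
        intro j h1 h2
        rcases h1.eq_or_lt with rfl | h1
        · simpa using h
        · have := h' (j - 1) (by omega) (by omega)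
          rwa [show p2 - ((j - 1 : ℕ) : ℤ) = p2 + 1 - j by omega] at this
      · exact absurd hp (hc n _ (by dsimp; omega))
      · obtain ⟨⟨rfl, rfl⟩, h1, h2, h3⟩ := h
        rw [hsol] at h3
        right
        refine ⟨fun j hj => ?_, hz h2⟩
        rcases Nat.eq_zero_or_pos j with rfl | hj0
        · simpa using h3
        · rcases ih _ hp with h' | h'
          · exact absurd (h' 1 le_rfl (by omega)) (by simpa using hz h2)
          · have := h'.1 (j - 1) (by omega)
            rwa [show p2 + ((j - 1 : ℕ) : ℤ) = p2 - 1 + j by omega] at this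
  refine ⟨2 * B + 2, fun n hn v hv hU => ?_⟩
  obtain ⟨a, b⟩ := v
  rcases (show c = a ∨ c + 1 ≤ a by dsimp at hv; omega) with rfl | h
  · rcases key n b hU with h | ⟨h, -⟩
    · have h1 := hB _ (h 1 le_rfl (by omega))
      have h2 := hB _ (h n (by omega) le_rfl)
      rw [abs_le] at h1 h2
      push_cast at h1
      dsimp only at h1 h2
      omega
    · have h1 := hB _ (h 0 (by omega))
      have h2 := hB _ (h (n - 1) (by omega))
      rw [abs_le] at h1 h2
      push_cast at h1
      dsimp only at h1 h2
      omega
  · exact hc n _ h hU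

theorem exists_columns_vacant {y : ℕ → Cell → State T} {sol : Cell → Prop} {B : ℕ}
    (hB : ∀ v, sol v → |v.2| ≤ B) (hsol : ∀ n v, (y n v).IsSolid ↔ sol v)
    (hstep : ∀ n v, y (n + 1) v = .U → ∃ p, UpMove (y n) p v) {c : ℤ}
    (hc : ∀ n (v : Cell), c ≤ v.1 → y n v ≠ .U) (L : ℤ) :
    ∃ N, ∀ n, N ≤ n → ∀ v : Cell, L ≤ v.1 → y n v ≠ .U := by
  have key : ∀ k : ℕ, ∃ N, ∀ n, N ≤ n → ∀ v : Cell, c - k ≤ v.1 → y n v ≠ .U := by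
    intro k
    induction k with
    | zero => exact ⟨0, fun n _ v hv => hc n v (by simpa using hv)⟩
    | succ k ih =>
      obtain ⟨N, hN⟩ := ih
      obtain ⟨N', hN'⟩ := exists_column_vacant (y := fun n => y (N + n)) hB
        (fun n v => hsol _ v) (fun n v h => hstep _ v h) (c := c - (k + 1 : ℕ))
        (fun n v hv => hN _ (by omega) v (by push_cast at hv; omega))
      refine ⟨N + N', fun n hn v hv => ?_⟩
      have := hN' (n - N) (by omega) v hv
      rwa [show N + (n - N) = n by omega] at this
  obtain ⟨N, hN⟩ := key (c - L).toNat
  exact ⟨N, fun n hn v hv => hN n hn v (by omega)⟩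

theorem Filled.congr {x y : Cell → State T} (h : ∀ p, (x p).arrow = (y p).arrow) {c : Cell}
    {k : ℕ} (hf : Filled x c k) : Filled y c k :=
  fun u hu => (h _).symm.trans (hf u hu)

theorem Settled.of_solid_eq {τ : TileSet T} {x y : Cell → State T}
    (ha : ∀ p, (x p).arrow = (y p).arrow) (ht : ∀ p, (x p).tile = (y p).tile)
    (h : Settled τ x) : Settled τ y := by
  have hs : ∀ p, (x p).IsSolid ↔ (y p).IsSolid := fun p => by
    rw [State.isSolid_iff, State.isSolid_iff, ha]
  refine ⟨fun z s t h1 => ?_, fun z hz => ?_⟩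
  · rw [← ht] at h1
    simpa only [ht] using h.tilesFit z s t h1
  · obtain ⟨c, k, ho, hc⟩ := h.obstacle z ((hs z).2 hz)
    exact ⟨c, k, ⟨ho.one_le, ho.filled.congr ha, fun u h1 h2 => (mt (hs _).2 (ho.liquid u h1 h2))⟩,
      hc⟩

theorem Settled.onionCA_isSolid_iff {τ : TileSet T} {x : Cell → State T} (h : Settled τ x)
    {z : Cell} : (onionCA τ x z).IsSolid ↔ (x z).IsSolid := by
  refine ⟨fun hs => ?_, fun hs => ?_⟩
  · rwa [onionCA_eq_of_isSolid hs] at hs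
  · rwa [onionCA_eq_of_allowedAt (fun m _ => h.allowedAt m) hs]

theorem State.IsLiquid.tile {s : State T} (h : s.IsLiquid) : s.tile = none := by
  cases s <;> simp_all [State.IsLiquid, State.IsSolid, State.tile]

theorem Settled.step {τ : TileSet T} {x : Cell → State T} (h : Settled τ x) :
    Settled τ (onionCA τ x) := by
  refine h.of_solid_eq (fun p => ?_) (fun p => ?_) <;>
  by_cases hs : (x p).IsSolid
  · rw [onionCA_eq_of_allowedAt (fun m _ => h.allowedAt m) hs]
  · rw [State.IsLiquid.arrow hs, State.IsLiquid.arrow (onionCA_isLiquid hs)]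
  · rw [onionCA_eq_of_allowedAt (fun m _ => h.allowedAt m) hs]
  · rw [State.IsLiquid.tile hs, State.IsLiquid.tile (onionCA_isLiquid hs)]

theorem Settled.iterate {τ : TileSet T} {x : Cell → State T} (h : Settled τ x) (n : ℕ) :
    Settled τ ((onionCA τ)^[n] x) ∧
      ∀ z, (((onionCA τ)^[n] x) z).IsSolid ↔ (x z).IsSolid := by
  induction n with
  | zero => exact ⟨h, fun _ => Iff.rfl⟩
  | succ n ih =>
    rw [Function.iterate_succ_apply']
    exact ⟨ih.1.step, fun z => ih.1.onionCA_isSolid_iff.trans (ih.2 z)⟩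

theorem iterate_eq_of_isSolid {τ : TileSet T} {x : Cell → State T} {n : ℕ} {z : Cell}
    (h : ((onionCA τ)^[n] x z).IsSolid) : (onionCA τ)^[n] x z = x z := by
  induction n with
  | zero => rfl
  | succ n ih =>
    rw [Function.iterate_succ_apply'] at h ⊢
    have := onionCA_eq_of_isSolid h
    rw [this] at h ⊢
    exact ih h

theorem finite_supNorm_le (M : ℕ) : {v : Cell | supNorm v ≤ M}.Finite := by
  refine ((Set.finite_Icc (-(M : ℤ)) M).prod (Set.finite_Icc (-(M : ℤ)) M)).subset fun v hv => ?_
  rw [Set.mem_ofPred_eq, supNorm_le_iff] at hv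
  exact ⟨hv.1, hv.2⟩

/-- Erosion comes to an end in a bounded configuration. -/
theorem exists_iterate_settled {τ : TileSet T} {x : Cell → State T} {M : ℕ}
    (hM : ∀ v, (x v).IsSolid → supNorm v ≤ M) : ∃ t, Settled τ ((onionCA τ)^[t] x) := by
  by_contra! hc
  let S : ℕ → Set Cell := fun n => {v | ((onionCA τ)^[n] x v).IsSolid}
  have hS : ∀ n, S n ⊆ {v | supNorm v ≤ M} := by
    intro n v hv
    refine hM v ?_
    rw [Set.mem_ofPred_eq] at hv
    rwa [iterate_eq_of_isSolid hv] at hv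
  have hlt : ∀ n, (S (n + 1)).ncard < (S n).ncard := by
    intro n
    refine Set.ncard_lt_ncard ?_ ((finite_supNorm_le M).subset (hS n))
    have hsub : S (n + 1) ⊆ S n := by
      intro v hv
      rw [Set.mem_ofPred_eq, Function.iterate_succ_apply'] at hv
      rw [onionCA_eq_of_isSolid hv] at hv
      exact hv
    -- If a step erodes nothing, the configuration is stable and hence settled.
    refine hsub.ssubset_of_ne fun he => hc n ?_
    refine Stable.settled (stable_of_forall_isSolid fun z hz => ?_) (hS n)
    have : z ∈ S (n + 1) := he ▸ hz
    rwa [Set.mem_ofPred_eq, Function.iterate_succ_apply'] at this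
  have key : ∀ n, (S n).ncard + n ≤ (S 0).ncard := by
    intro n
    induction n with
    | zero => simp
    | succ n ih => have := hlt n; omega
  have := key ((S 0).ncard + 1)
  omega

/-- After erosion the solid set is fixed, so the columns become vacant one after the other from the
east. The particles `D` are treated in the mirror image. -/
theorem exists_iterate_vacant {τ : TileSet T} {x : Cell → State T} {M : ℕ}
    (hM : ∀ v, M < supNorm v → x v = .zero) (L : ℤ) :
    ∃ t, Settled τ ((onionCA τ)^[t] x) ∧ ∀ n, t ≤ n → VacantFrom ((onionCA τ)^[n] x) L := by
  have hM' : ∀ v, (x v).IsSolid → supNorm v ≤ M := fun v hv =>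
    not_lt.1 fun h => hv.ne_zero (hM v h)
  obtain ⟨t, ht⟩ := exists_iterate_settled (τ := τ) hM'
  have hvac : ∀ n, VacantFrom ((onionCA τ)^[n] x) (M + 1) := by
    intro n
    induction n with
    | zero =>
      intro a ha
      have : x a = .zero := hM a (not_le.1 fun h => by
        rw [supNorm_le_iff] at h
        omega)
      simp [this]
    | succ n ih =>
      rw [Function.iterate_succ_apply']
      exact ih.step
  let y : ℕ → Cell → State T := fun n => (onionCA τ)^[t + n] x
  have hy : ∀ n, y (n + 1) = onionCA τ (y n) := fun n => Function.iterate_succ_apply' _ _ _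
  have hsol : ∀ n v, (y n v).IsSolid ↔ (y 0 v).IsSolid := by
    intro n v
    have := (ht.iterate n).2 v
    rwa [← Function.iterate_add_apply, add_comm n t] at this
  have hB : ∀ v, (y 0 v).IsSolid → |v.2| ≤ M := by
    intro v hv
    change ((onionCA τ)^[t] x v).IsSolid at hv
    rw [iterate_eq_of_isSolid hv] at hv
    have := (supNorm_le_iff v M).1 (hM' v hv)
    rw [abs_le]
    exact this.2
  obtain ⟨N₁, h₁⟩ := exists_columns_vacant hB hsol
    (fun n v h => (upAt_of_onionCA_eq_U (τ := τ) (by rw [← hy, h])).exists_upMove)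
    (fun n v hv => (hvac (t + n) v hv).1) L
  obtain ⟨N₂, h₂⟩ := exists_columns_vacant (y := fun n => mirror (y n))
    (sol := fun v => (y 0 (Cell.flip v)).IsSolid) (B := M)
    (fun v h => by simpa [Cell.flip] using hB _ h)
    (fun n v => by rw [mirror_apply, State.flip_isSolid, hsol])
    (fun n v h => by
      rw [mirror_apply, State.flip_eq.1, hy] at h
      have := downAt_iff_mirror.1 (downAt_of_onionCA_eq_D h)
      rw [Cell.flip_flip] at this
      exact this.exists_upMove)
    (fun n v hv h => by
      rw [mirror_apply, State.flip_eq.1] at h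
      exact (hvac (t + n) (Cell.flip v) hv).2 h) L
  refine ⟨t + (N₁ + N₂), ?_, fun n hn a ha => ⟨fun h => ?_, fun h => ?_⟩⟩
  · rw [add_comm, Function.iterate_add_apply]
    exact (ht.iterate _).1
  · refine h₁ (n - t) (by omega) a ha ?_
    simp only [y]
    rwa [show t + (n - t) = n by omega]
  · refine h₂ (n - t) (by omega) (Cell.flip a) ha ?_
    rw [mirror_apply, State.flip_eq.1, Cell.flip_flip]
    simp only [y]
    rwa [show t + (n - t) = n by omega]

/-! ### A pair of particles passes an obstacle -/

/-- The positions of a particle that runs counterclockwise along a square of radius `K`, starting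
on its eastern side at height `j`. -/
def ringPos (K j : ℤ) : Cell :=
  if j ≤ K then (K, j) else if j ≤ 3 * K then (2 * K - j, K) else (-K, 4 * K - j)

theorem ringPos_cases (K j : ℤ) :
    (j ≤ K ∧ (ringPos K j).1 = K ∧ (ringPos K j).2 = j) ∨
    (K < j ∧ j ≤ 3 * K ∧ (ringPos K j).1 = 2 * K - j ∧ (ringPos K j).2 = K) ∨
    (K < j ∧ 3 * K < j ∧ (ringPos K j).1 = -K ∧ (ringPos K j).2 = 4 * K - j) := by
  unfold ringPos
  split_ifs <;> simp <;> omega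

/-- A set of cells shows a square with centre `c` and radius `k`, separated from its other
cells. -/
def IsSquare (sol : Cell → Prop) (c : Cell) (k : ℕ) : Prop :=
  1 ≤ k ∧ ∀ u, supNorm u ≤ k + 2 → (sol (c + u) ↔ supNorm u ≤ k)

theorem IsSquare.flip {sol : Cell → Prop} {c : Cell} {k : ℕ} (h : IsSquare sol c k) :
    IsSquare (fun v => sol (Cell.flip v)) (Cell.flip c) k := by
  have hn : ∀ u, supNorm (Cell.flip u) = supNorm u := fun u => by simp [supNorm, Cell.flip]
  refine ⟨h.1, fun u hu => ?_⟩
  have := h.2 (Cell.flip u) (by rwa [hn])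
  rw [hn] at this
  have e : Cell.flip (Cell.flip c + u) = c + Cell.flip u := by
    simp [Cell.flip, Prod.ext_iff, add_comm]
  change sol (Cell.flip (Cell.flip c + u)) ↔ _
  rw [e, this]

-- The pair arrives at the eastern side with `U` at relative height `y` and `D` at `y - 1`, and `i`
-- counts the steps since then. The particles run on the ring of radius `k + 1`, with `D` on the
-- mirror image of the route that starts at height `1 - y`. The range of `y` says that at least one
-- of them touches the square. Each stretch of the route has its own rule.
set_option maxHeartbeats 2000000 in
theorem upAt_ringPos {x : Cell → State T} {c : Cell} {k : ℕ} {L y i : ℤ}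
    (hsq : IsSquare (fun v => (x v).IsSolid) c k) (hL : L ≤ c.1 - k - 2)
    (hy : -(k : ℤ) ≤ y ∧ y ≤ k + 1) (hi : 0 ≤ i ∧ i < 4 * k + 3)
    (hx : ParticlesAt x L (c + ringPos (k + 1) (y + i))
      (c + Cell.flip (ringPos (k + 1) (1 - y + i)))) :
    UpAt x (c + ringPos (k + 1) (y + i + 1)) := by
  obtain ⟨hk, hsq⟩ := hsq
  have hp := ringPos_cases (k + 1) (y + i)
  have hp' := ringPos_cases (k + 1) (y + i + 1)
  have hq := ringPos_cases (k + 1) (1 - y + i)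
  obtain ⟨⟨p1, p2⟩, ep⟩ : ∃ p, p = ringPos (k + 1) (y + i) := ⟨_, rfl⟩
  obtain ⟨⟨v1, v2⟩, ev⟩ : ∃ p, p = ringPos (k + 1) (y + i + 1) := ⟨_, rfl⟩
  obtain ⟨⟨q1, q2⟩, eq⟩ : ∃ p, p = ringPos (k + 1) (1 - y + i) := ⟨_, rfl⟩
  rw [← ep] at hp hx
  rw [← ev] at hp' ⊢
  rw [← eq] at hq hx
  obtain ⟨c1, c2⟩ := c
  simp only [Cell.flip, Prod.mk_add_mk] at hx hp hp' hq hL ⊢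
  clear ep ev eq
  have solid_of : ∀ a b : ℤ, ((-k ≤ a - c1 ∧ a - c1 ≤ k) ∧ (-k ≤ b - c2 ∧ b - c2 ≤ k)) →
      (x (a, b)).IsSolid := by
    intro a b h
    have := (hsq (a - c1, b - c2) ((supNorm_le_iff _ _).2 (by push_cast; omega))).2
      ((supNorm_le_iff _ _).2 h)
    simpa using this
  have zero_of : ∀ a b : ℤ, ((-(k + 2) ≤ a - c1 ∧ a - c1 ≤ k + 2) ∧
      (-(k + 2) ≤ b - c2 ∧ b - c2 ≤ k + 2)) ∧
      ¬ ((-k ≤ a - c1 ∧ a - c1 ≤ k) ∧ (-k ≤ b - c2 ∧ b - c2 ≤ k)) ∧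
      (a ≠ c1 + p1 ∨ b ≠ c2 + p2) ∧ (a ≠ c1 + q1 ∨ b ≠ c2 + -q2) → x (a, b) = .zero := by
    intro a b ⟨h1, h2, h3, h4⟩
    have := (hsq (a - c1, b - c2) ((supNorm_le_iff _ _).2 (by push_cast; omega))).1.mt
      (mt (supNorm_le_iff _ _).1 h2)
    have hl : (x (a, b)).IsLiquid := by simpa [State.IsLiquid] using this
    have hxa := hx (a, b) (by dsimp only; omega)
    refine State.eq_zero_of_isLiquid hl (mt hxa.1.1 ?_) (mt hxa.2.1 ?_) <;>
    · simp only [Prod.mk.injEq]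
      omega
  have hU : ∀ a b : ℤ, (a = c1 + p1 ∧ b = c2 + p2) → x (a, b) = .U := by
    rintro a b ⟨rfl, rfl⟩
    exact (hx _ (by dsimp only; omega)).1.2 rfl
  have hD : ∀ a b : ℤ, (a = c1 + q1 ∧ b = c2 + -q2) → x (a, b) = .D := by
    rintro a b ⟨rfl, rfl⟩
    exact (hx _ (by dsimp only; omega)).2.2 rfl
  clear hx hsq
  rw [upAt_iff]
  rcases hp with ⟨hj, rfl, rfl⟩ | ⟨hj, hj', rfl, rfl⟩ | ⟨hj, hj', rfl, rfl⟩
  · by_cases h1 : y + i + 1 ≤ k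
    · obtain ⟨rfl, rfl⟩ : v1 = k + 1 ∧ v2 = y + i + 1 := by omega
      clear hp'
      refine ⟨zero_of _ _ (by omega), ?_⟩
      left
      refine ⟨?_, zero_of _ _ (by omega), zero_of _ _ (by omega), solid_of _ _ (by omega),
        zero_of _ _ (by omega), solid_of _ _ (by omega), hU _ _ (by omega), zero_of _ _ (by omega)⟩
      by_cases h2 : y + i + 2 ≤ k
      · exact Or.inr (solid_of _ _ (by omega))
      · exact Or.inl (zero_of _ _ (by omega))
    by_cases h2 : y + i + 1 ≤ k + 1
    · obtain ⟨rfl, rfl⟩ : v1 = k + 1 ∧ v2 = y + i + 1 := by omega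
      clear hp'
      refine ⟨zero_of _ _ (by omega), ?_⟩
      right; left
      exact ⟨zero_of _ _ (by omega), zero_of _ _ (by omega), zero_of _ _ (by omega),
        zero_of _ _ (by omega), zero_of _ _ (by omega), solid_of _ _ (by omega), hU _ _ (by omega),
        zero_of _ _ (by omega)⟩
    · obtain ⟨rfl, rfl⟩ : v1 = 2 * (k + 1) - (y + i + 1) ∧ v2 = k + 1 := by omega
      clear hp'
      refine ⟨zero_of _ _ (by omega), ?_⟩
      right; right; left
      refine ⟨zero_of _ _ (by omega), zero_of _ _ (by omega), zero_of _ _ (by omega),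
        zero_of _ _ (by omega), hU _ _ (by omega), solid_of _ _ (by omega), solid_of _ _ (by omega),
        ?_⟩
      -- For `i = 0` we have `y = k + 1`: the pair has just arrived and `D` still stands directly
      -- below `U`.
      by_cases h3 : i = 0
      · exact Or.inr (Or.inl (hD _ _ (by omega)))
      · exact Or.inl (zero_of _ _ (by omega))
  · by_cases h1 : y + i + 1 < 3 * k + 2
    · obtain ⟨rfl, rfl⟩ : v1 = 2 * (k + 1) - (y + i + 1) ∧ v2 = k + 1 := by omega
      clear hp'
      refine ⟨zero_of _ _ (by omega), ?_⟩
      right; right; left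
      exact ⟨zero_of _ _ (by omega), zero_of _ _ (by omega), zero_of _ _ (by omega),
        zero_of _ _ (by omega), hU _ _ (by omega), solid_of _ _ (by omega), solid_of _ _ (by omega),
        Or.inr (Or.inr (solid_of _ _ (by omega)))⟩
    by_cases h2 : y + i + 1 ≤ 3 * k + 3
    · obtain ⟨rfl, rfl⟩ : v1 = 2 * (k + 1) - (y + i + 1) ∧ v2 = k + 1 := by omega
      clear hp'
      refine ⟨zero_of _ _ (by omega), ?_⟩
      right; right; right; left
      refine ⟨zero_of _ _ (by omega), zero_of _ _ (by omega), zero_of _ _ (by omega),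
        zero_of _ _ (by omega), hU _ _ (by omega), zero_of _ _ (by omega), ?_,
        solid_of _ _ (by omega)⟩
      by_cases h3 : y + i + 1 = 3 * k + 2
      · exact Or.inr (solid_of _ _ (by omega))
      · exact Or.inl (zero_of _ _ (by omega))
    · obtain ⟨rfl, rfl⟩ : v1 = -(k + 1) ∧ v2 = 4 * (k + 1) - (y + i + 1) := by omega
      clear hp'
      refine ⟨zero_of _ _ (by omega), ?_⟩
      right; right; right; right; left
      exact ⟨zero_of _ _ (by omega), hU _ _ (by omega), Or.inl (zero_of _ _ (by omega)),
        zero_of _ _ (by omega), solid_of _ _ (by omega), zero_of _ _ (by omega),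
        zero_of _ _ (by omega), solid_of _ _ (by omega)⟩
  · by_cases h1 : y + i + 1 < 5 * k + 4
    · obtain ⟨rfl, rfl⟩ : v1 = -(k + 1) ∧ v2 = 4 * (k + 1) - (y + i + 1) := by omega
      clear hp'
      refine ⟨zero_of _ _ (by omega), ?_⟩
      right; right; right; right; left
      exact ⟨zero_of _ _ (by omega), hU _ _ (by omega), Or.inr (solid_of _ _ (by omega)),
        zero_of _ _ (by omega), solid_of _ _ (by omega), zero_of _ _ (by omega),
        zero_of _ _ (by omega), solid_of _ _ (by omega)⟩
    -- Only `y = k + 1` and the last step `i = 4 * k + 2` remain, when `D` is just below the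
    -- south-western cell of the square.
    · obtain ⟨rfl, rfl⟩ : v1 = -(k + 1) ∧ v2 = 4 * (k + 1) - (y + i + 1) := by omega
      clear hp'
      refine ⟨zero_of _ _ (by omega), ?_⟩
      right; right; right; right; right; left
      exact ⟨zero_of _ _ (by omega), hU _ _ (by omega), solid_of _ _ (by omega),
        zero_of _ _ (by omega), solid_of _ _ (by omega), zero_of _ _ (by omega),
        zero_of _ _ (by omega), hD _ _ (by omega)⟩

theorem Settled.ringPos_step {τ : TileSet T} {x : Cell → State T} (h : Settled τ x) {c : Cell}
    {k : ℕ} {L y i : ℤ} (hsq : IsSquare (fun v => (x v).IsSolid) c k) (hL : L ≤ c.1 - k - 2)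
    (hy : -(k : ℤ) ≤ y ∧ y ≤ k + 1) (hi : 0 ≤ i ∧ i < 4 * k + 3)
    (hx : ParticlesAt x L (c + ringPos (k + 1) (y + i))
      (c + Cell.flip (ringPos (k + 1) (1 - y + i)))) :
    ParticlesAt (onionCA τ x) L (c + ringPos (k + 1) (y + (i + 1)))
      (c + Cell.flip (ringPos (k + 1) (1 - y + (i + 1)))) := by
  have hv := upAt_ringPos hsq hL hy hi hx
  have hflip : ∀ u, Cell.flip (c + u) = Cell.flip c + Cell.flip u := fun u => by
    simp [Cell.flip, add_comm]
  have hw : DownAt x (c + Cell.flip (ringPos (k + 1) (1 - y + i + 1))) := by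
    rw [downAt_iff_mirror, hflip, Cell.flip_flip]
    refine upAt_ringPos (L := L) (y := 1 - y) ?_ hL (by omega) hi ?_
    · have := hsq.flip
      simpa only [mirror_apply, State.flip_isSolid] using this
    · have := particlesAt_mirror hx
      rw [hflip, hflip, Cell.flip_flip] at this
      rwa [sub_sub_cancel]
  rw [← add_assoc, ← add_assoc]
  have hp := ringPos_cases (k + 1) (y + i + 1)
  have hq := ringPos_cases (k + 1) (1 - y + i + 1)
  refine hx.step (fun m _ => h.allowedAt m) hv hw ?_ ?_ fun he => ?_
  · simp only [Prod.fst_add]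
    omega
  · simp only [Prod.fst_add, Cell.flip]
    omega
  · have := add_left_cancel he
    simp only [Cell.flip, Prod.ext_iff] at this
    omega

/-- The pair is reunited after the same time for every `y`, at the reflected heights and again with
`U` above `D`. -/
theorem Settled.ringPos_iterate {τ : TileSet T} {x : Cell → State T} (h : Settled τ x) {c : Cell}
    {k : ℕ} {L y : ℤ} (hsq : IsSquare (fun v => (x v).IsSolid) c k) (hL : L ≤ c.1 - k - 2)
    (hy : -(k : ℤ) ≤ y ∧ y ≤ k + 1)
    (hx : ParticlesAt x L (c + ((k : ℤ) + 1, y)) (c + ((k : ℤ) + 1, y - 1))) :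
    ParticlesAt ((onionCA τ)^[4 * k + 3] x) L (c + (-((k : ℤ) + 1), 1 - y))
      (c + (-((k : ℤ) + 1), -y)) := by
  have key : ∀ n : ℕ, n ≤ 4 * k + 3 → ParticlesAt ((onionCA τ)^[n] x) L
      (c + ringPos (k + 1) (y + n)) (c + Cell.flip (ringPos (k + 1) (1 - y + n))) := by
    intro n
    induction n with
    | zero =>
      intro _
      have hp := ringPos_cases (k + 1) y
      have hq := ringPos_cases (k + 1) (1 - y)
      have e1 : ringPos (k + 1) (y + (0 : ℕ)) = ((k : ℤ) + 1, y) := by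
        simp only [Prod.ext_iff, Nat.cast_zero, add_zero]
        omega
      have e2 : Cell.flip (ringPos (k + 1) (1 - y + (0 : ℕ))) = ((k : ℤ) + 1, y - 1) := by
        simp only [Prod.ext_iff, Nat.cast_zero, add_zero, Cell.flip]
        omega
      rw [e1, e2]
      exact hx
    | succ n ih =>
      intro hn
      rw [Function.iterate_succ_apply']
      have hs := h.iterate n
      push_cast
      refine hs.1.ringPos_step ?_ hL hy (by omega) (ih (by omega))
      simpa only [hs.2] using hsq
  have := key _ le_rfl
  have hp := ringPos_cases (k + 1) (y + (4 * k + 3 : ℕ))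
  have hq := ringPos_cases (k + 1) (1 - y + (4 * k + 3 : ℕ))
  have e1 : ringPos (k + 1) (y + (4 * k + 3 : ℕ)) = (-((k : ℤ) + 1), 1 - y) := by
    simp only [Prod.ext_iff]
    push_cast at *
    omega
  have e2 : Cell.flip (ringPos (k + 1) (1 - y + (4 * k + 3 : ℕ))) = (-((k : ℤ) + 1), -y) := by
    simp only [Prod.ext_iff, Cell.flip]
    push_cast at *
    omega
  rwa [e1, e2] at this

theorem Settled.pair_step {τ : TileSet T} {x : Cell → State T} (h : Settled τ x) {L i j : ℤ}
    (hL : L < i) (hU : (x (i, j)).IsLiquid) (hD : (x (i, j - 1)).IsLiquid)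
    (hx : ParticlesAt x L (i + 1, j) (i + 1, j - 1)) :
    ParticlesAt (onionCA τ x) L (i, j) (i, j - 1) := by
  have hz : ∀ a b, L ≤ a → (a, b) ≠ (i + 1, j) → (a, b) ≠ (i + 1, j - 1) →
      (x (a, b)).IsLiquid → x (a, b) = .zero := fun a b ha h1 h2 hl =>
    State.eq_zero_of_isLiquid hl (mt (hx (a, b) ha).1.1 h1) (mt (hx (a, b) ha).2.1 h2)
  have hz' : ∀ a b, L ≤ a → (a, b) ≠ (i + 1, j) → (a, b) ≠ (i + 1, j - 1) →
      x (a, b) = .zero ∨ (x (a, b)).IsSolid := fun a b ha h1 h2 =>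
    or_iff_not_imp_right.2 (hz a b ha h1 h2)
  have eU := (hx (i + 1, j) (by dsimp only; omega)).1.2 rfl
  have eD := (hx (i + 1, j - 1) (by dsimp only; omega)).2.2 rfl
  have zU := hz i j (by omega) (by simp) (by simp) hU
  have zD := hz i (j - 1) (by omega) (by simp) (by simp) hD
  refine hx.step (fun m _ => h.allowedAt m)
    (upAt_of_pair zU eU eD zD fun a b h1 h2 h3 h4 => hz' a b (by omega) h3 h4) ?_
    (by dsimp only; omega) (by dsimp only; omega) (by simp; omega)
  rw [downAt_iff_mirror]
  have hm : ∀ a b : ℤ, mirror x (a, b) = (x (a, -b)).flip := fun _ _ => rfl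
  refine upAt_of_pair ?_ ?_ ?_ ?_ fun a b h1 h2 h3 h4 => ?_
  · rw [hm, State.flip_eq.2.2, neg_neg, zD]
  · rw [hm, State.flip_eq.1, neg_neg, eD]
  · rw [hm, State.flip_eq.2.1, show -(-(j - 1) - 1) = j by ring, eU]
  · rw [hm, State.flip_eq.2.2, show -(-(j - 1) - 1) = j by ring, zU]
  · rw [hm, State.flip_eq.2.2, State.flip_isSolid]
    refine hz' a (-b) (by omega) ?_ ?_ <;>
    · simp only [ne_eq, Prod.mk.injEq] at h3 h4 ⊢
      omega

theorem Settled.exists_isSquare {τ : TileSet T} {x : Cell → State T} (h : Settled τ x) {v : Cell}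
    (hv : (x v).IsSolid) :
    ∃ c k, IsSquare (fun v => (x v).IsSolid) c k ∧ supNorm (v - c) ≤ k := by
  obtain ⟨c, k, ho, hc⟩ := h.obstacle v hv
  exact ⟨c, k, ⟨ho.one_le, fun u hu => ho.isSolid_iff hu⟩, hc⟩

/-! ### Sending a pair to a prescribed cell -/

/-- Every free place for a pair of particles is reached by a pair that comes from the column
`B`. -/
theorem exists_pair_reaching {τ : TileSet T} {sol : Cell → Prop} {L B : ℤ}
    (hsq : ∀ v, sol v → ∃ c k, IsSquare sol c k ∧ supNorm (v - c) ≤ k)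
    (hB : ∀ v, sol v → v.1 < B) {i j : ℤ} (hL : L < i) (hiB : i ≤ B) (hU : ¬ sol (i, j))
    (hD : ¬ sol (i, j - 1)) :
    ∃ r n, ∀ x : Cell → State T, Settled τ x → (∀ v, (x v).IsSolid ↔ sol v) →
      ParticlesAt x L (B, r) (B, r - 1) →
      ParticlesAt ((onionCA τ)^[n] x) L (i, j) (i, j - 1) := by
  obtain ⟨d, hd⟩ : ∃ d : ℕ, B - i ≤ d := ⟨(B - i).toNat, by omega⟩
  induction d generalizing i j with
  | zero =>
    obtain rfl : i = B := by push_cast at hd; omega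
    exact ⟨j, 0, fun x _ _ hx => hx⟩
  | succ d ih =>
    rcases hiB.eq_or_lt with rfl | hiB'
    · exact ⟨j, 0, fun x _ _ hx => hx⟩
    push_cast at hd
    -- The pair is traced back: to the eastern neighbours if these are free, otherwise to the far
    -- side of the obstacle that stands there.
    by_cases hfree : sol (i + 1, j) ∨ sol (i + 1, j - 1)
    · obtain ⟨j', hj', hs, hns⟩ :
          ∃ j', (j' = j ∨ j' = j - 1) ∧ sol (i + 1, j') ∧ ¬ sol (i, j') := by
        rcases hfree with h | h
        · exact ⟨j, Or.inl rfl, h, hU⟩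
        · exact ⟨j - 1, Or.inr rfl, h, hD⟩
      obtain ⟨⟨c1, c2⟩, k, hsc, hc⟩ := hsq _ hs
      have hiff : ∀ a b, (-(k + 2) ≤ a - c1 ∧ a - c1 ≤ k + 2) ∧
          (-(k + 2) ≤ b - c2 ∧ b - c2 ≤ k + 2) → (sol (a, b) ↔
          (-(k : ℤ) ≤ a - c1 ∧ a - c1 ≤ k) ∧ (-(k : ℤ) ≤ b - c2 ∧ b - c2 ≤ k)) := by
        intro a b hab
        have := hsc.2 (a - c1, b - c2) ((supNorm_le_iff _ _).2 (by push_cast; exact hab))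
        rw [supNorm_le_iff] at this
        simpa using this
      rw [supNorm_le_iff] at hc
      simp only [Prod.mk_sub_mk] at hc
      have h1 : i = c1 - (k + 1) := by
        have := mt (hiff i j' (by omega)).2 hns
        omega
      have h2 : c1 + k < B :=
        hB (c1 + k, c2) ((hiff _ _ (by omega)).2 (by omega))
      -- The reflection of heights is an involution, so the place of entry has the reflected height.
      -- It is free because it lies in the margin of the obstacle.
      obtain ⟨r, n, hrn⟩ := ih (i := c1 + (k + 1)) (j := c2 + (1 - (j - c2))) (by omega) (by omega)
        (by rw [hiff _ _ (by omega)]; omega) (by rw [hiff _ _ (by omega)]; omega) (by omega)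
      refine ⟨r, 4 * k + 3 + n, fun x hx hxs hxp => ?_⟩
      have hstart := hrn x hx hxs hxp
      have hit := hx.iterate n
      have := hit.1.ringPos_iterate (c := (c1, c2)) (k := k) (L := L) (y := 1 - (j - c2))
        (by simpa only [hit.2, hxs] using hsc) (by dsimp only; omega) (by omega)
        (by simpa [add_sub_assoc] using hstart)
      have e1 : ((c1, c2) + (-((k : ℤ) + 1), 1 - (1 - (j - c2))) : Cell) = (i, j) := by
        simp only [Prod.ext_iff, Prod.fst_add, Prod.snd_add]
        omega
      have e2 : ((c1, c2) + (-((k : ℤ) + 1), -(1 - (j - c2))) : Cell) = (i, j - 1) := by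
        simp only [Prod.ext_iff, Prod.fst_add, Prod.snd_add]
        omega
      rw [Function.iterate_add_apply, ← e1, ← e2]
      exact this
    · push Not at hfree
      obtain ⟨r, n, hrn⟩ := ih (i := i + 1) (j := j) (by omega) (by omega) hfree.1 hfree.2
        (by omega)
      refine ⟨r, n + 1, fun x hx hxs hxp => ?_⟩
      have hit := hx.iterate n
      rw [Function.iterate_succ_apply']
      refine hit.1.pair_step hL ?_ ?_ (hrn x hx hxs hxp) <;>
      · rw [State.IsLiquid, hit.2, hxs]
        assumption

theorem onionCA_iterate_zeroFrom {τ : TileSet T} {x : Cell → State T} {B : ℤ}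
    (h : ∀ a : Cell, B ≤ a.1 → x a = .zero) (n : ℕ) :
    ∀ a : Cell, B ≤ a.1 → (onionCA τ)^[n] x a = .zero := by
  induction n with
  | zero => exact h
  | succ n ih =>
    intro a ha
    rw [Function.iterate_succ_apply']
    have hvac : VacantFrom ((onionCA τ)^[n] x) B := fun a ha => by simp [ih a ha]
    have := hvac.step (τ := τ) a ha
    exact State.eq_zero_of_isLiquid (onionCA_isLiquid (State.isLiquid_of_eq_zero (ih a ha)))
      this.1 this.2

theorem iterate_addPair {τ : TileSet T} {x : Cell → State T} {B : ℤ}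
    (h : ∀ a : Cell, B ≤ a.1 → x a = .zero) (j : ℤ) (n : ℕ) :
    ∀ i : ℤ, B + 3 ≤ i →
      (onionCA τ)^[n] (addPair x (i + n) j) = addPair ((onionCA τ)^[n] x) i j := by
  induction n with
  | zero => simp
  | succ n ih =>
    intro i hi
    rw [Function.iterate_succ_apply', Function.iterate_succ_apply',
      ← onionCA_addPair (onionCA_iterate_zeroFrom h n) hi, ← ih (i + 1) (by omega)]
    push_cast
    rw [add_assoc, add_comm (n : ℤ) 1]

theorem Settled.addPair {τ : TileSet T} {x : Cell → State T} (h : Settled τ x) {i j : ℤ}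
    (hi : ∀ b, x (i, b) = .zero) : Settled τ (addPair x i j) := by
  refine h.of_solid_eq (fun p => ?_) (fun p => ?_) <;>
  · unfold Onion.addPair
    split_ifs with h1 h2
    · rw [h1, hi]
      rfl
    · rw [h2, hi]
      rfl
    · rfl

/-- Either a perturbation of `x` outside the ball of radius `M` becomes visible in the ball of
radius `N`, or the latter belongs to an onion that is contained in `x`. -/
theorem exists_perturbation_or_filled (τ : TileSet T) (x : Cell → State T) (N M : ℕ) :
    (∃ (y : Cell → State T) (n : ℕ) (p : Cell), (∀ v, supNorm v ≤ M → x v = y v) ∧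
      supNorm p ≤ N ∧ (onionCA τ)^[n] x p ≠ (onionCA τ)^[n] y p) ∨
    ∃ (w : Cell → State T) (c : Cell) (k : ℕ), TilesFit τ w ∧ Filled x c k ∧
      ∀ v, supNorm v ≤ N → supNorm (v - c) ≤ k ∧ (x v).IsSolid ∧ w v = x v := by
  let y : Cell → State T := fun v => if supNorm v ≤ M then x v else .zero
  have hyM : ∀ v, supNorm v ≤ M → x v = y v := fun v hv => (if_pos hv).symm
  have hy0 : ∀ v, M < supNorm v → y v = .zero := fun v hv => if_neg (not_le.2 hv)
  obtain ⟨t, ht, hvac⟩ := exists_iterate_vacant (τ := τ) hy0 (-N - 1)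
  have hW : ∀ v, ((onionCA τ)^[t] y v).IsSolid → (onionCA τ)^[t] y v = x v ∧ supNorm v ≤ M := by
    intro v hv
    have he := iterate_eq_of_isSolid hv
    rw [he] at hv ⊢
    have : supNorm v ≤ M := not_lt.1 fun h => hv.ne_zero (hy0 v h)
    exact ⟨(hyM v this).symm, this⟩
  have hsq := fun v => ht.exists_isSquare (v := v)
  by_cases hl : ∃ p, supNorm p ≤ N ∧ ¬ ((onionCA τ)^[t] y p).IsSolid
  · left
    obtain ⟨⟨i, j₀⟩, hp, hpl⟩ := hl
    have hpN := (supNorm_le_iff _ _).1 hp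
    -- A free place for a pair that covers the liquid cell. If the cell below is solid, the cell
    -- above is liquid, as margins have width two.
    obtain ⟨j, hj, hjU, hjD⟩ : ∃ j, (j₀ = j ∨ j₀ = j - 1) ∧
        ¬ ((onionCA τ)^[t] y (i, j)).IsSolid ∧ ¬ ((onionCA τ)^[t] y (i, j - 1)).IsSolid := by
      by_cases hs : ((onionCA τ)^[t] y (i, j₀ - 1)).IsSolid
      · refine ⟨j₀ + 1, Or.inr (by ring), ?_, by rwa [add_sub_cancel_right]⟩
        obtain ⟨⟨c1, c2⟩, k, hsc, hc⟩ := hsq _ hs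
        have hiff : ∀ a b, (-(k + 2) ≤ a - c1 ∧ a - c1 ≤ k + 2) ∧
            (-(k + 2) ≤ b - c2 ∧ b - c2 ≤ k + 2) → (((onionCA τ)^[t] y (a, b)).IsSolid ↔
            (-(k : ℤ) ≤ a - c1 ∧ a - c1 ≤ k) ∧ (-(k : ℤ) ≤ b - c2 ∧ b - c2 ≤ k)) := by
          intro a b hab
          have := hsc.2 (a - c1, b - c2) ((supNorm_le_iff _ _).2 (by push_cast; exact hab))
          rw [supNorm_le_iff] at this
          simpa using this
        rw [supNorm_le_iff] at hc
        simp only [Prod.mk_sub_mk] at hc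
        rw [hiff _ _ (by omega)] at hpl ⊢
        omega
      · exact ⟨j₀, Or.inl rfl, hpl, hs⟩
    have hzero : ∀ a : Cell, (M + 1 : ℤ) ≤ a.1 → y a = .zero := fun a ha =>
      hy0 a (not_le.1 fun h => by rw [supNorm_le_iff] at h; omega)
    have hzero' := onionCA_iterate_zeroFrom (τ := τ) hzero t
    -- The row `r` and the time `n` depend on the solid cells only, so the pair can be added
    -- afterwards. Column `M + N + 4` is east of the target and far enough from column `M + 1` for
    -- `iterate_addPair`, which moves the insertion back to time `0`.
    obtain ⟨r, n, hrn⟩ := exists_pair_reaching (τ := τ)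
      (sol := fun v => ((onionCA τ)^[t] y v).IsSolid) (L := -N - 1) (B := M + N + 4) (i := i)
      (j := j) hsq (fun v hv => by
        have := (supNorm_le_iff _ _).1 (hW v hv).2
        omega) (by dsimp only at hpN; omega) (by dsimp only at hpN; omega) hjU hjD
    have hcol : ∀ b, (onionCA τ)^[t] y ((M + N + 4 : ℤ), b) = .zero := fun b =>
      hzero' _ (by dsimp only; omega)
    have hsolid : ∀ v, (Onion.addPair ((onionCA τ)^[t] y) (M + N + 4) r v).IsSolid ↔
        ((onionCA τ)^[t] y v).IsSolid := by
      intro v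
      unfold Onion.addPair
      split_ifs with h1 h2
      · rw [h1, hcol]
        simp [State.IsSolid]
      · rw [h2, hcol]
        simp [State.IsSolid]
      · rfl
    have hfin := hrn _ (ht.addPair hcol) hsolid (particlesAt_addPair (hvac t le_rfl))
    rw [← iterate_addPair hzero r t (M + N + 4) (by omega), ← Function.iterate_add_apply] at hfin
    have h1 : (onionCA τ)^[n + t] (Onion.addPair y (M + N + 4 + t) r) (i, j₀) ≠
        (onionCA τ)^[n + t] y (i, j₀) := by
      have hv := hvac (n + t) (by omega) (i, j₀) (by dsimp only at hpN ⊢; omega)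
      have hf := hfin (i, j₀) (by dsimp only at hpN ⊢; omega)
      rcases hj with rfl | rfl
      · rw [hf.1.2 rfl]
        exact hv.1.symm
      · rw [hf.2.2 rfl]
        exact hv.2.symm
    by_cases h2 : (onionCA τ)^[n + t] x (i, j₀) = (onionCA τ)^[n + t] y (i, j₀)
    · refine ⟨_, n + t, (i, j₀), fun v hv => ?_, hp, fun h3 => h1 (h3.symm.trans h2)⟩
      have := (supNorm_le_iff _ _).1 hv
      rw [addPair_eq (by omega), hyM v hv]
    · exact ⟨y, n + t, (i, j₀), hyM, hp, h2⟩
  · right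
    push Not at hl
    obtain ⟨⟨c1, c2⟩, k, ho, hc⟩ := ht.obstacle 0 (hl 0 (by simp [supNorm]))
    refine ⟨_, (c1, c2), k, ht.tilesFit, fun u hu => ?_, fun v hv => ⟨?_, ?_, (hW v (hl v hv)).1⟩⟩
    · have := ho.filled u hu
      rwa [(hW _ (State.isSolid_of_arrow this)).1] at this
    · have hin : ∀ a b : ℤ, supNorm (a, b) ≤ N → supNorm (a - c1, b - c2) ≤ k + 2 →
          supNorm (a - c1, b - c2) ≤ k := by
        intro a b h1 h2
        have := (ho.isSolid_iff h2).1 (by simpa using hl (a, b) h1)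
        exact this
      simp only [supNorm_le_iff, Prod.fst_sub, Prod.snd_sub, Prod.fst_zero, Prod.snd_zero] at *
      push_cast at hin
      -- The obstacle contains `0`. If the ball left it, then the ball would contain one of these
      -- four margin cells on the axes, which are liquid.
      have e1 := hin (c1 + k + 1) 0
      have e2 := hin (c1 - k - 1) 0
      have e3 := hin 0 (c2 + k + 1)
      have e4 := hin 0 (c2 - k - 1)
      omega
    · rw [← (hW v (hl v hv)).1]
      exact hl v hv

/-! ### The metric in terms of balls -/

theorem dC_le {A : Type*} {x y : Cell → A} {M : ℕ} (h : ∀ v, supNorm v ≤ M → x v = y v) :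
    dC x y ≤ (1 / 2 : ℝ) ^ M := by
  unfold dC
  split_ifs with hxy
  · positivity
  · refine pow_le_pow_of_le_one (by norm_num) (by norm_num) ?_
    obtain ⟨v, hv⟩ := Function.ne_iff.1 hxy
    obtain ⟨i, hi, hn⟩ := Nat.sInf_mem (s := {n | ∃ i, x i ≠ y i ∧ supNorm i = n}) ⟨_, v, hv, rfl⟩
    rw [← hn]
    exact le_of_not_ge fun hle => hi (h i hle)

theorem le_dC {A : Type*} {x y : Cell → A} {N : ℕ} {p : Cell} (hp : supNorm p ≤ N)
    (h : x p ≠ y p) : (1 / 2 : ℝ) ^ N ≤ dC x y := by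
  unfold dC
  rw [if_neg fun hxy => h (congrFun hxy p)]
  have hmem : supNorm p ∈ {n | ∃ i, x i ≠ y i ∧ supNorm i = n} := ⟨p, h, rfl⟩
  exact pow_le_pow_of_le_one (by norm_num) (by norm_num) ((Nat.sInf_le hmem).trans hp)

theorem eq_of_dC_lt {A : Type*} {x y : Cell → A} {N : ℕ} (h : dC x y < (1 / 2 : ℝ) ^ N) {p : Cell}
    (hp : supNorm p ≤ N) : x p = y p := by
  by_contra hne
  exact absurd (le_dC hp hne) (not_le.2 h)

theorem exists_half_pow_lt {ε : ℝ} (h : 0 < ε) : ∃ n : ℕ, (1 / 2 : ℝ) ^ n < ε :=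
  exists_pow_lt_of_lt_one h (by norm_num)

/-! ### The onion over a valid tiling is an equicontinuous point -/

/-- The ball of radius `k` around the origin, cut out of a plane of solid cells. -/
def ballConfig (x : Cell → State T) (k : ℕ) (s : State T) : Cell → State T := fun v =>
  if supNorm v ≤ k then x v else s

theorem ballConfig_allowedAt {τ : TileSet T} {c : Cell → T} (hc : τ.IsTiling c) {k : ℕ} (hk : 1 ≤ k)
    {s : State T} (hs : s.IsLiquid) {m : Cell} (hm : supNorm m ≤ k + 1) :
    AllowedAt τ (ballConfig (fun v => .solid (c v) (onionArrow v)) k s) m := by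
  have htile : ∀ v t, (ballConfig (fun v => .solid (c v) (onionArrow v)) k s v).tile = some t →
      t = c v := by
    intro v t h
    unfold ballConfig at h
    split_ifs at h
    · exact (Option.some.inj h).symm
    · rw [hs.tile] at h
      cases h
  refine allowedAt_of_obstacle (c := 0) (k := k) (fun z s t h1 => ⟨fun h2 => ?_, fun h2 => ?_⟩)
    ⟨hk, fun u hu => ?_, fun u hu _ => ?_⟩ (by simpa using hm)
  · rw [htile _ _ h1, htile _ _ h2]
    exact (hc z).1
  · rw [htile _ _ h1, htile _ _ h2]
    exact (hc z).2
  · rw [zero_add, ballConfig, if_pos hu]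
    rfl
  · rw [zero_add, ballConfig, if_neg (not_le.2 hu)]
    exact hs

/-- A ball of an onion with a valid tiling is never destroyed. -/
theorem iterate_eq_onion {τ : TileSet T} {c : Cell → T} (hc : τ.IsTiling c) {k : ℕ} (hk : 1 ≤ k)
    {y : Cell → State T} (hy : ∀ v, supNorm v ≤ k + 2 → y v = .solid (c v) (onionArrow v)) (n : ℕ) :
    ∀ v, supNorm v ≤ k → (onionCA τ)^[n] y v = .solid (c v) (onionArrow v) := by
  induction n with
  | zero => exact fun v hv => hy v (by omega)
  | succ n ih =>
    intro v hv
    rw [Function.iterate_succ_apply']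
    have hz := ih v hv
    rw [onionCA_eq_of_not_eroded (a := onionArrow v) (by rw [hz]; rfl), hz]
    have hball : ∀ (K : ℕ) (s : State T) (u : Cell), supNorm u ≤ K →
        ballConfig (fun v => .solid (c v) (onionArrow v)) K s u = .solid (c u) (onionArrow u) :=
      fun K s u hu => if_pos hu
    have zero_liquid : (State.zero : State T).IsLiquid := State.isLiquid_of_eq_zero rfl
    rintro (h | ⟨w, -, hw, h⟩)
    · refine h ⟨0, fun u => ballConfig (fun v => .solid (c v) (onionArrow v)) k .zero (v + u),
        fun p hp => ?_, fun p hp => ?_, AllowedAt.shift (ballConfig_allowedAt hc hk zero_liquid ?_)⟩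
      · simpa [window] using hp.1
      · have := onionArrow_inside hv hp hk
        dsimp only
        rw [hball _ _ _ this, ih _ this]
      · rw [add_zero]
        omega
    · obtain ⟨m, hm, hm0, hmw⟩ : ∃ m, supNorm m ≤ 1 ∧ (0 : Cell) ∈ window m ∧ w ∈ window m := by
        rw [supNorm_le_iff] at hw
        push_cast at hw
        refine ⟨(max (-1) (min w.1 1), max (-1) (min w.2 1)), ?_, ?_, ?_⟩
        · rw [supNorm_le_iff]
          push_cast
          omega
        · rw [mem_window]
          simp only [Prod.fst_zero, Prod.snd_zero]
          omega
        · rw [mem_window]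
          omega
      have hmv : supNorm (v + m) ≤ k + 1 := by
        simp only [supNorm_le_iff, Prod.fst_add, Prod.snd_add] at *
        push_cast at *
        omega
      have hwv : supNorm (v + w) ≤ k + 2 := by
        simp only [supNorm_le_iff, Prod.fst_add, Prod.snd_add] at *
        push_cast at *
        omega
      have hsub : ({0, w} : Set Cell) ⊆ window m := by
        rintro p (rfl | rfl)
        · exact hm0
        · exact hmw
      -- A partner that is still solid has never changed, so it belongs to the ball of radius `k +
      -- 2` of the same onion. A liquid partner lies outside the ball of radius `k`, and that ball
      -- surrounded by the partner's liquid state shows the pair.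
      by_cases hs : ((onionCA τ)^[n] y (v + w)).IsSolid
      · refine h ⟨m, fun u => ballConfig (fun v => .solid (c v) (onionArrow v)) (k + 2) .zero (v + u),
          hsub, ?_, AllowedAt.shift (ballConfig_allowedAt hc (by omega) zero_liquid (by omega))⟩
        rintro p (rfl | rfl)
        · dsimp only
          rw [add_zero, hz, hball _ _ _ (by omega)]
        · dsimp only
          rw [iterate_eq_of_isSolid hs, hy _ hwv, hball _ _ _ hwv]
      · refine h ⟨m, fun u => ballConfig (fun v => .solid (c v) (onionArrow v)) k
          ((onionCA τ)^[n] y (v + w)) (v + u), hsub, ?_,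
          AllowedAt.shift (ballConfig_allowedAt hc hk hs hmv)⟩
        rintro p (rfl | rfl)
        · dsimp only
          rw [add_zero, hz, hball _ _ _ hv]
        · dsimp only
          refine if_neg fun h1 => hs ?_
          rw [ih _ h1]
          exact ⟨_, _, rfl⟩

theorem isEquicontinuousPoint_onion {τ : TileSet T} {c : Cell → T} (hc : τ.IsTiling c) :
    IsEquicontinuousPoint dC (onionCA τ) fun v => .solid (c v) (onionArrow v) := by
  intro ε hε
  obtain ⟨k, hk⟩ := exists_half_pow_lt hε
  refine ⟨(1 / 2 : ℝ) ^ (k + 1 + 2), by positivity, fun y hy n => ?_⟩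
  refine (dC_le (M := k + 1) fun v hv => ?_).trans_lt
    ((pow_le_pow_of_le_one (by norm_num) (by norm_num) (Nat.le_succ k)).trans_lt hk)
  rw [iterate_eq_onion hc (by omega) (fun v hv => (eq_of_dC_lt hy hv).symm) n v hv,
    iterate_eq_onion hc (by omega) (fun _ _ => rfl) n v hv]

/-! ### Compactness, and the two applications of the dichotomy -/

/-- `c` respects the constraints of the tile set in the ball of radius `N`. -/
def TileSet.IsTilingOn (τ : TileSet T) (N : ℕ) (c : Cell → T) : Prop :=
  ∀ z, supNorm z ≤ N → (supNorm (z + (1, 0)) ≤ N → τ.H (c z) (c (z + (1, 0)))) ∧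
    (supNorm (z + (0, 1)) ≤ N → τ.V (c z) (c (z + (0, 1))))

theorem supNorm_add_le (u v : Cell) : supNorm (u + v) ≤ supNorm u + supNorm v := by
  simp only [supNorm, Prod.fst_add, Prod.snd_add]
  omega

/-- Compactness of the product of finite discrete spaces: the tilings of balls form a decreasing
sequence of nonempty closed sets. -/
theorem TileSet.tilesPlane_of_isTilingOn [Finite T] {τ : TileSet T}
    (h : ∀ N, ∃ c, τ.IsTilingOn N c) : τ.TilesPlane := by
  let : TopologicalSpace T := ⊥
  have : DiscreteTopology T := ⟨rfl⟩
  have hclosed : ∀ (R : T → T → Prop) (z z' : Cell), IsClosed {c : Cell → T | R (c z) (c z')} := by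
    intro R z z'
    have hcont : Continuous fun c : Cell → T => (c z, c z') := by fun_prop
    exact (isClosed_discrete {p : T × T | R p.1 p.2}).preimage hcont
  have hK : ∀ N, IsClosed {c | τ.IsTilingOn N c} := by
    intro N
    simp only [TileSet.IsTilingOn, Set.ofPred_forall, Set.ofPred_and]
    refine isClosed_iInter fun z => isClosed_iInter fun _ => IsClosed.inter
      (isClosed_iInter fun _ => hclosed _ _ _) (isClosed_iInter fun _ => hclosed _ _ _)
  obtain ⟨c, hc⟩ := IsCompact.nonempty_iInter_of_sequence_nonempty_isCompact_isClosed
    (fun N => {c | τ.IsTilingOn N c})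
    (fun N c hc z hz => ⟨fun hz' => (hc z (by omega)).1 (by omega),
      fun hz' => (hc z (by omega)).2 (by omega)⟩)
    h (hK 0).isCompact hK
  rw [Set.mem_iInter] at hc
  refine ⟨c, fun z => ?_⟩
  have h1 : supNorm ((1, 0) : Cell) = 1 := by decide
  have h2 : supNorm ((0, 1) : Cell) = 1 := by decide
  have h3 := supNorm_add_le z (1, 0)
  have h4 := supNorm_add_le z (0, 1)
  have := hc (supNorm z + 1) z (by omega)
  exact ⟨this.1 (by omega), this.2 (by omega)⟩

theorem State.exists_tile {s : State T} (h : s.IsSolid) : ∃ t, s.tile = some t := by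
  obtain ⟨t, a, rfl⟩ := h
  exact ⟨t, rfl⟩

theorem isSensitive_of_not_tilesPlane [Finite T] {τ : TileSet T} (h : ¬ τ.TilesPlane) :
    IsSensitive dC (onionCA τ) := by
  obtain ⟨N, hN⟩ : ∃ N, ∀ c, ¬ τ.IsTilingOn N c := by
    by_contra! hc
    exact h (TileSet.tilesPlane_of_isTilingOn hc)
  -- The exponent `N + 1` instead of `N` makes the inequality strict.
  refine ⟨(1 / 2 : ℝ) ^ (N + 1), by positivity, fun δ hδ x => ?_⟩
  obtain ⟨M, hM⟩ := exists_half_pow_lt hδ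
  rcases exists_perturbation_or_filled τ x N M with ⟨y, n, p, hy, hp, hne⟩ | ⟨w, c, k, ht, -, hw⟩
  · refine ⟨y, n, (dC_le hy).trans_lt hM, lt_of_lt_of_le ?_ (le_dC hp hne)⟩
    exact pow_lt_pow_right_of_lt_one₀ (by norm_num) (by norm_num) (Nat.lt_succ_self N)
  · exfalso
    obtain ⟨t₀, -⟩ := State.exists_tile (hw 0 (by simp [supNorm])).2.1
    have htile : ∀ v, supNorm v ≤ N → (w v).tile = some ((w v).tile.getD t₀) := by
      intro v hv
      obtain ⟨t, ht⟩ := State.exists_tile (hw v hv).2.1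
      rw [(hw v hv).2.2, ht]
      rfl
    exact hN (fun v => (w v).tile.getD t₀) fun z hz =>
      ⟨fun hz' => (ht z _ _ (htile z hz)).1 (htile _ hz'),
        fun hz' => (ht z _ _ (htile z hz)).2 (htile _ hz')⟩

/-- Equicontinuity for `ε = 2 ^ (-N)` rules out the perturbation once `2 ^ (-M) < δ`. -/
theorem IsEquicontinuousPoint.exists_filled {τ : TileSet T} {x : Cell → State T}
    (h : IsEquicontinuousPoint dC (onionCA τ) x) (N : ℕ) :
    ∃ (w : Cell → State T) (c : Cell) (k : ℕ), TilesFit τ w ∧ Filled x c k ∧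
      ∀ v, supNorm v ≤ N → supNorm (v - c) ≤ k ∧ (x v).IsSolid ∧ w v = x v := by
  obtain ⟨δ, hδ, hx⟩ := h ((1 / 2 : ℝ) ^ N) (by positivity)
  obtain ⟨M, hM⟩ := exists_half_pow_lt hδ
  refine (exists_perturbation_or_filled τ x N M).resolve_left ?_
  rintro ⟨y, n, p, hy, hp, hne⟩
  exact hne (eq_of_dC_lt (hx y ((dC_le hy).trans_lt hM) n) hp)

end Onion

theorem mainTheorem9 {T : Type*} [Finite T] (τ : Onion.TileSet T) :
    (¬ τ.TilesPlane → Onion.IsSensitive Onion.dC (Onion.onionCA τ)) ∧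
    (τ.TilesPlane → ∃ x, Onion.IsEquicontinuousPoint Onion.dC (Onion.onionCA τ) x) ∧
    (∀ x, Onion.IsEquicontinuousPoint Onion.dC (Onion.onionCA τ) x →
      (∀ z, (x z).IsSolid) ∧
      (∃! z, (x z).arrow = some Onion.Arrow.bot) ∧
      (∃ c, τ.IsTiling c ∧ ∀ z, (x z).tile = some (c z))) := by
  refine ⟨Onion.isSensitive_of_not_tilesPlane,
    fun ⟨c, hc⟩ => ⟨_, Onion.isEquicontinuousPoint_onion hc⟩, fun x hx => ?_⟩
  have hsolid : ∀ z, (x z).IsSolid := fun z => by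
    obtain ⟨_, _, _, -, -, hw⟩ := hx.exists_filled (Onion.supNorm z)
    exact (hw z le_rfl).2.1
  refine ⟨hsolid, ?_, ?_⟩
  · obtain ⟨_, c, _, -, hf, -⟩ := hx.exists_filled 0
    refine ⟨c, ?_, fun z hz => ?_⟩
    · have := hf 0 (by simp [Onion.supNorm])
      rwa [add_zero, Onion.onionArrow_zero] at this
    · have hc : (x c).arrow = some Onion.Arrow.bot := by
        have := hf 0 (by simp [Onion.supNorm])
        rwa [add_zero, Onion.onionArrow_zero] at this
      -- A ball with both occurrences of `⊥` lies in one onion, where only the centre carries `⊥`.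
      obtain ⟨_, c', k', -, hf', hw⟩ := hx.exists_filled (max (Onion.supNorm z) (Onion.supNorm c))
      have key : ∀ v, Onion.supNorm v ≤ max (Onion.supNorm z) (Onion.supNorm c) →
          (x v).arrow = some Onion.Arrow.bot → v = c' := by
        intro v hv hb
        have := hf'.arrow (hw v hv).1
        rw [hb] at this
        exact sub_eq_zero.1 (Onion.onionArrow_eq_bot.1 (Option.some.inj this).symm)
      rw [key z (le_max_left _ _) hz, key c (le_max_right _ _) hc]
  · choose c hc using fun z => Onion.State.exists_tile (hsolid z)
    refine ⟨c, fun z => ?_, hc⟩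
    obtain ⟨w, _, _, ht, -, hw⟩ := hx.exists_filled (Onion.supNorm z + 1)
    have h1 := Onion.supNorm_add_le z (1, 0)
    have h2 := Onion.supNorm_add_le z (0, 1)
    rw [show Onion.supNorm (1, 0) = 1 by decide] at h1
    rw [show Onion.supNorm (0, 1) = 1 by decide] at h2
    have := ht z (c z)
    rw [(hw z (by omega)).2.2] at this
    refine ⟨(this _ (hc z)).1 ?_, (this _ (hc z)).2 ?_⟩
    · rw [(hw _ h1).2.2, hc]
    · rw [(hw _ h2).2.2, hc]
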